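/- Rings are commutative with $1$. For a ring $k$, a $k$-$k$-biring is a $k$-ring $S$ with a lift of the functor $\mathrm{Ring}_k(S,-)$ to a functor from $k$-rings to $k$-rings, i.e. with a coaddition $\Delta^+$, a comultiplication $\Delta^\times$ (with counits and antipode) and a ring map $\beta\colon k\to \mathrm{Ring}_k(S,k)$. For a $k$-$k$-biring $S$ and a $k$-ring $R$, the composition product $S\odot R$ is the $k$-ring representing $A\mapsto \mathrm{Ring}_k(R,\mathrm{Ring}_k(S,A))$; it makes $k$-$k$-birings a monoidal category with unit $k[e]$. A $k$-plethory is a monoid $P$ in this category, and a $P$-ring is a $k$-ring $R$ with an action $P\odot R\to R$, $\alpha\odot r\mapsto\alpha\circ r$. For a $k$-plethory $P$, a $P$-plethory is a $k$-plethory $X$ with a map of $k$-plethories $P\to X$; it is a $P$-ring through this map. A $k[e]$-$P$-biring is a $k$-$k$-biring $S$ with a right action $S\odot P\to S$ of $P$ by maps of birings. Let $\mathcal O$ be a Dedekind domain and $\mathfrak m$ an ideal of $\mathcal O$. Let $K$ be the subring of $\mathrm{Frac}(\mathcal O)$ of elements integral at all maximal ideals not dividing $\mathfrak m$, and $\mathfrak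 m^{-1}=\{x\in K: x\mathfrak m\subseteq\mathcal O\}$. An $\mathcal O$-module $M$ is $\mathfrak m$-torsion-free if no nonzero $x\in M$ satisfies $\mathfrak m^n x=0$ for some $n\in\mathbf N$. Let $P$ be an $\mathfrak m$-torsion-free $\mathcal O$-plethory, $Q$ an $\mathcal O/\mathfrak m$-plethory, and $P\to Q$ a surjective map of plethories over $\mathcal O\to\mathcal O/\mathfrak m$, with kernel $I$. A $P$-deformation of a $Q$-ring is an $\mathfrak m$-torsion-free $P$-ring $R$ such that the action of $P$ on $\mathcal O/\mathfrak m\otimes_{\mathcal O} R$ factors through an action of $Q$. The amplification $P'$ of $P$ along $Q$ is constructed as follows. Let $S$ be the $\mathcal O$-subring of $K\otimes_{\mathcal O} P$ generated by $\mathfrak m^{-1}\otimes I$, with the structure of an $\mathcal O[e]$-$P$-biring induced from $K\otimes_{\mathcal O} P$ and with the inclusion $P\to S$, $p\mapsto 1\otimes p$. Let $T$ be the free $P$-plethory on $P\to S$, i.e. the initial $P$-plethory equipped with a map of $\mathcal O[e]$-$P$-birings from $S$ that is compatible with the maps from $P$. Let $P'$ be the plethory that is the largest $\mathfrak m$-torsion-free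 $T$-ring quotient of $T$; it is a $P$-plethory through $P\to T\to P'$. **Theorem.** These constructions exist, and $P'$ has the following properties. 1. $P'$ is $\mathfrak m$-torsion-free. 2. The forgetful functor from the full category of $\mathfrak m$-torsion-free $P'$-rings to the category of $P$-rings identifies it with the full subcategory of $P$-deformations of $Q$-rings: the $P$-ring underlying an $\mathfrak m$-torsion-free $P'$-ring is a $P$-deformation of a $Q$-ring; on every $P$-deformation of a $Q$-ring the $P$-action extends to a unique $P'$-action; and an $\mathcal O$-ring map between $\mathfrak m$-torsion-free $P'$-rings is a map of $P'$-rings if and only if it is a map of $P$-rings. 3. Let $P''$ be a $P$-plethory whose underlying $P$-ring is a $P$-deformation of a $Q$-ring. Then there is a unique map $P'\to P''$ of $P$-rings commuting with the maps from $P$, and this map is a map of $P$-plethories. -/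

import Mathlib

open scoped TensorProduct

universe u v w

noncomputable section

namespace Plethystic

/-! ## Birings -/

/-- A `k`-`ℤ`-biring: a commutative `k`-algebra `S` with a coaddition and a comultiplication, that
is, a commutative ring object (on `Spec S`) in the opposite of the category of `k`-rings. -/
class Coring (k : Type u) (S : Type v) [CommRing k] [CommRing S] [Algebra k S] where
  /-- coaddition `Δ⁺` -/
  coadd : S →ₐ[k] S ⊗[k] S
  /-- additive counit `ε⁺` -/
  cozero : S →ₐ[k] k
  /-- antipode `σ` -/
  coneg : S →ₐ[k] S
  /-- comultiplication `Δ^×` -/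
  comul : S →ₐ[k] S ⊗[k] S
  /-- multiplicative counit `ε^×` -/
  coone : S →ₐ[k] k
  coadd_coassoc :
    (Algebra.TensorProduct.assoc k k k S S S).toAlgHom.comp
      ((Algebra.TensorProduct.map coadd (AlgHom.id k S)).comp coadd) =
    (Algebra.TensorProduct.map (AlgHom.id k S) coadd).comp coadd
  coadd_cocomm : (Algebra.TensorProduct.comm k S S).toAlgHom.comp coadd = coadd
  coadd_counit :
    (Algebra.TensorProduct.productMap ((Algebra.ofId k S).comp cozero) (AlgHom.id k S)).comp coadd =
      AlgHom.id k S
  coadd_antipode :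
    (Algebra.TensorProduct.productMap coneg (AlgHom.id k S)).comp coadd =
      (Algebra.ofId k S).comp cozero
  comul_coassoc :
    (Algebra.TensorProduct.assoc k k k S S S).toAlgHom.comp
      ((Algebra.TensorProduct.map comul (AlgHom.id k S)).comp comul) =
    (Algebra.TensorProduct.map (AlgHom.id k S) comul).comp comul
  comul_cocomm : (Algebra.TensorProduct.comm k S S).toAlgHom.comp comul = comul
  comul_counit :
    (Algebra.TensorProduct.productMap ((Algebra.ofId k S).comp coone) (AlgHom.id k S)).comp comul =
      AlgHom.id k S
  /-- `Δ^×` codistributes over `Δ⁺`. The right hand side is the dual of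
  `(x, y, z) ↦ x * y + x * z`. -/
  codistrib :
    (Algebra.TensorProduct.map (AlgHom.id k S) coadd).comp comul =
    (Algebra.TensorProduct.productMap
      ((Algebra.TensorProduct.map (AlgHom.id k S) Algebra.TensorProduct.includeLeft).comp comul)
      ((Algebra.TensorProduct.map (AlgHom.id k S) Algebra.TensorProduct.includeRight).comp
        comul)).comp coadd

/-- The set `Ring_k(S, A)` of `A`-valued points of `Spec S`. It is a type synonym, because we
equip it with the ring structure coming from a coring structure on `S`
(and not with composition of endomorphisms when `A = S`). -/
def Points (k : Type u) (S : Type v) (A : Type w) [CommRing k] [CommRing S] [Algebra k S]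
    [CommRing A] [Algebra k A] : Type (max v w) := S →ₐ[k] A

namespace Points

section

variable {k : Type u} {S : Type v} {A : Type w} [CommRing k] [CommRing S] [Algebra k S]
  [CommRing A] [Algebra k A]

instance : FunLike (Points k S A) S A := inferInstanceAs (FunLike (S →ₐ[k] A) S A)

instance : AlgHomClass (Points k S A) k S A := inferInstanceAs (AlgHomClass (S →ₐ[k] A) k S A)

/-- A point as an algebra homomorphism. -/
def toAlgHom (x : Points k S A) : S →ₐ[k] A := x

/-- An algebra homomorphism as a point. -/
def ofAlgHom (x : S →ₐ[k] A) : Points k S A := x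

/-- The value of the binary co-operation `Δ` at the points `x`, `y`: if `Δ s = ∑ sᵢ ⊗ tᵢ`, it is
`s ↦ ∑ x sᵢ * y tᵢ`. -/
def conv (Δ : S →ₐ[k] S ⊗[k] S) (x y : Points k S A) : Points k S A :=
  ofAlgHom ((Algebra.TensorProduct.productMap x.toAlgHom y.toAlgHom).comp Δ)

theorem conv_comm (Δ : S →ₐ[k] S ⊗[k] S)
    (h : (Algebra.TensorProduct.comm k S S).toAlgHom.comp Δ = Δ) (x y : Points k S A) :
    conv Δ x y = conv Δ y x := by
  have h2 : (Algebra.TensorProduct.productMap x.toAlgHom y.toAlgHom).comp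
      (Algebra.TensorProduct.comm k S S).toAlgHom =
      Algebra.TensorProduct.productMap y.toAlgHom x.toAlgHom := by
    ext <;> simp
  have h3 : conv Δ x y = ofAlgHom (((Algebra.TensorProduct.productMap x.toAlgHom y.toAlgHom).comp
      (Algebra.TensorProduct.comm k S S).toAlgHom).comp Δ) := by
    rw [AlgHom.comp_assoc, h]; rfl
  rw [h3, h2]; rfl

theorem productMap_comp_left {B : Type*} [CommRing B] [Algebra k B] (Δ : S →ₐ[k] B)
    (x : B →ₐ[k] A) (y : S →ₐ[k] A) :
    Algebra.TensorProduct.productMap (x.comp Δ) y =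
      (Algebra.TensorProduct.productMap x y).comp
        (Algebra.TensorProduct.map Δ (AlgHom.id k S)) := by
  ext <;> simp

theorem productMap_comp_right {B : Type*} [CommRing B] [Algebra k B] (Δ : S →ₐ[k] B)
    (x : S →ₐ[k] A) (y : B →ₐ[k] A) :
    Algebra.TensorProduct.productMap x (y.comp Δ) =
      (Algebra.TensorProduct.productMap x y).comp
        (Algebra.TensorProduct.map (AlgHom.id k S) Δ) := by
  ext <;> simp

theorem conv_assoc (Δ : S →ₐ[k] S ⊗[k] S)
    (h : (Algebra.TensorProduct.assoc k k k S S S).toAlgHom.comp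
      ((Algebra.TensorProduct.map Δ (AlgHom.id k S)).comp Δ) =
      (Algebra.TensorProduct.map (AlgHom.id k S) Δ).comp Δ) (x y z : Points k S A) :
    conv Δ (conv Δ x y) z = conv Δ x (conv Δ y z) := by
  have e3 : (Algebra.TensorProduct.productMap
      x.toAlgHom (Algebra.TensorProduct.productMap y.toAlgHom z.toAlgHom)).comp
      (Algebra.TensorProduct.assoc k k k S S S).toAlgHom = Algebra.TensorProduct.productMap
      (Algebra.TensorProduct.productMap x.toAlgHom y.toAlgHom) z.toAlgHom := by
    ext <;> simp [Algebra.TensorProduct.one_def]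
  change (Algebra.TensorProduct.productMap
      ((Algebra.TensorProduct.productMap x.toAlgHom y.toAlgHom).comp Δ) z.toAlgHom).comp Δ =
    (Algebra.TensorProduct.productMap x.toAlgHom
      ((Algebra.TensorProduct.productMap y.toAlgHom z.toAlgHom).comp Δ)).comp Δ
  rw [productMap_comp_left, productMap_comp_right, AlgHom.comp_assoc, AlgHom.comp_assoc, ← h, ← e3,
    AlgHom.comp_assoc]

theorem conv_unit (Δ : S →ₐ[k] S ⊗[k] S) (ε : S →ₐ[k] k)
    (h : (Algebra.TensorProduct.productMap ((Algebra.ofId k S).comp ε) (AlgHom.id k S)).comp Δ =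
      AlgHom.id k S) (x : Points k S A) :
    conv Δ (ofAlgHom ((Algebra.ofId k A).comp ε)) x = x := by
  have e1 : Algebra.TensorProduct.productMap ((Algebra.ofId k A).comp ε) x.toAlgHom =
      x.toAlgHom.comp
        (Algebra.TensorProduct.productMap ((Algebra.ofId k S).comp ε) (AlgHom.id k S)) := by
    ext s
    · simp [Algebra.ofId_apply]
    · simp
  change (Algebra.TensorProduct.productMap ((Algebra.ofId k A).comp ε) x.toAlgHom).comp Δ =
    x.toAlgHom
  rw [e1, AlgHom.comp_assoc, h]; rfl

variable [Coring k S]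

theorem neg_add_aux (x : Points k S A) :
    conv Coring.coadd (ofAlgHom (x.toAlgHom.comp Coring.coneg)) x =
      ofAlgHom ((Algebra.ofId k A).comp Coring.cozero) := by
  have e1 : Algebra.TensorProduct.productMap (x.toAlgHom.comp Coring.coneg) x.toAlgHom =
      x.toAlgHom.comp
        (Algebra.TensorProduct.productMap (Coring.coneg (k := k)) (AlgHom.id k S)) := by
    ext s <;> simp
  change (Algebra.TensorProduct.productMap (x.toAlgHom.comp Coring.coneg) x.toAlgHom).comp
    Coring.coadd = (Algebra.ofId k A).comp Coring.cozero
  rw [e1, AlgHom.comp_assoc, Coring.coadd_antipode]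
  ext s
  simp [Algebra.ofId_apply]

theorem distrib_aux (x y z : Points k S A) :
    conv Coring.comul x (conv Coring.coadd y z) =
      conv Coring.coadd (conv Coring.comul x y) (conv Coring.comul x z) := by
  change (Algebra.TensorProduct.productMap x.toAlgHom
      ((Algebra.TensorProduct.productMap y.toAlgHom z.toAlgHom).comp Coring.coadd)).comp
        Coring.comul = (Algebra.TensorProduct.productMap
      ((Algebra.TensorProduct.productMap x.toAlgHom y.toAlgHom).comp Coring.comul)
      ((Algebra.TensorProduct.productMap x.toAlgHom z.toAlgHom).comp Coring.comul)).comp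
        Coring.coadd
  rw [productMap_comp_right, AlgHom.comp_assoc, Coring.codistrib, ← AlgHom.comp_assoc]
  have hl : (Algebra.TensorProduct.productMap x.toAlgHom
      (Algebra.TensorProduct.productMap y.toAlgHom z.toAlgHom)).comp
      (Algebra.TensorProduct.map (AlgHom.id k S) Algebra.TensorProduct.includeLeft) =
      Algebra.TensorProduct.productMap x.toAlgHom y.toAlgHom := by
    ext <;> simp
  have hr : (Algebra.TensorProduct.productMap x.toAlgHom
      (Algebra.TensorProduct.productMap y.toAlgHom z.toAlgHom)).comp
      (Algebra.TensorProduct.map (AlgHom.id k S) Algebra.TensorProduct.includeRight) =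
      Algebra.TensorProduct.productMap x.toAlgHom z.toAlgHom := by
    ext <;> simp
  have key : ∀ (F : S ⊗[k] (S ⊗[k] S) →ₐ[k] A) (a b : S →ₐ[k] S ⊗[k] (S ⊗[k] S)),
      F.comp (Algebra.TensorProduct.productMap a b) =
        Algebra.TensorProduct.productMap (F.comp a) (F.comp b) := by
    intro F a b
    ext <;> simp
  rw [key, ← AlgHom.comp_assoc, ← AlgHom.comp_assoc, hl, hr]

instance : Add (Points k S A) := ⟨conv Coring.coadd⟩
instance : Mul (Points k S A) := ⟨conv Coring.comul⟩
instance : Zero (Points k S A) := ⟨ofAlgHom ((Algebra.ofId k A).comp Coring.cozero)⟩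
instance : One (Points k S A) := ⟨ofAlgHom ((Algebra.ofId k A).comp Coring.coone)⟩
instance : Neg (Points k S A) := ⟨fun x => ofAlgHom (x.toAlgHom.comp Coring.coneg)⟩

/-- The ring structure on `Ring_k(S, A)` given by the co-operations of `S`. -/
instance : CommRing (Points k S A) :=
  CommRing.ofMinimalAxioms
    (conv_assoc _ Coring.coadd_coassoc)
    (conv_unit _ _ Coring.coadd_counit)
    neg_add_aux
    (conv_assoc _ Coring.comul_coassoc)
    (conv_comm _ Coring.comul_cocomm)
    (conv_unit _ _ Coring.comul_counit)
    distrib_aux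

end

end Points

/-- A `k`-`k`-biring: a `k`-`ℤ`-biring with a co-`k`-linear structure `β : k → Ring_k(S, k)`. -/
class Biring (k : Type u) (S : Type v) [CommRing k] [CommRing S] [Algebra k S]
    extends Coring k S where
  /-- co-`k`-linear structure `β` -/
  colin : k →+* Points k S k

namespace Points

section

variable {k : Type u} {S : Type v} [CommRing k] [CommRing S] [Algebra k S]

/-- Functoriality of the ring `Ring_k(S, A)` in `A`, as a ring homomorphism. -/
def mapRingHom (S : Type v) [CommRing S] [Algebra k S] [Coring k S] {A : Type w} {B : Type*}
    [CommRing A] [Algebra k A] [CommRing B] [Algebra k B] (φ : A →ₐ[k] B) :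
    Points k S A →+* Points k S B where
  toFun x := ofAlgHom (φ.comp x.toAlgHom)
  map_one' := by
    change φ.comp ((Algebra.ofId k A).comp Coring.coone) = (Algebra.ofId k B).comp Coring.coone
    ext s; simp [Algebra.ofId_apply]
  map_zero' := by
    change φ.comp ((Algebra.ofId k A).comp Coring.cozero) = (Algebra.ofId k B).comp Coring.cozero
    ext s; simp [Algebra.ofId_apply]
  map_add' x y := by
    change φ.comp ((Algebra.TensorProduct.productMap x.toAlgHom y.toAlgHom).comp Coring.coadd) =
      (Algebra.TensorProduct.productMap (φ.comp x.toAlgHom) (φ.comp y.toAlgHom)).comp Coring.coadd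
    rw [← AlgHom.comp_assoc]
    congr 1
    ext <;> simp
  map_mul' x y := by
    change φ.comp ((Algebra.TensorProduct.productMap x.toAlgHom y.toAlgHom).comp Coring.comul) =
      (Algebra.TensorProduct.productMap (φ.comp x.toAlgHom) (φ.comp y.toAlgHom)).comp Coring.comul
    rw [← AlgHom.comp_assoc]
    congr 1
    ext <;> simp

variable [Biring k S]

/-- The `k`-algebra structure on `Ring_k(S, A)`: the scalar `c` is the composite of `β(c) : S → k`
with the structure map `k → A`. -/
instance {A : Type w} [CommRing A] [Algebra k A] : Algebra k (Points k S A) :=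
  ((mapRingHom S (Algebra.ofId k A)).comp Biring.colin).toAlgebra

/-- Functoriality of the `k`-ring `Ring_k(S, A)` in `A`. -/
def map (S : Type v) [CommRing S] [Algebra k S] [Biring k S] {A : Type w} {B : Type*}
    [CommRing A] [Algebra k A] [CommRing B] [Algebra k B] (φ : A →ₐ[k] B) :
    Points k S A →ₐ[k] Points k S B where
  toRingHom := mapRingHom S φ
  commutes' c := by
    change φ.comp ((Algebra.ofId k A).comp (Biring.colin c : Points k S k).toAlgHom) =
      (Algebra.ofId k B).comp (Biring.colin c : Points k S k).toAlgHom
    ext s; simp [Algebra.ofId_apply]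

end

end Points

/-- A morphism of birings `P → Q` over a ring map `k → ℓ`, where `P` is a `k`-`k`-biring and `Q` is
an `ℓ`-`ℓ`-biring: a map of `k`-rings that is compatible with `Δ⁺`, `Δ^×` and `β`. It is then
also compatible with the counits `ε⁺ = β(0)`, `ε^× = β(1)` and with the antipode. For `ℓ = k` this
is a morphism of `k`-`k`-birings. -/
structure IsBiringHom (k : Type u) (ℓ : Type*) {P : Type v} {Q : Type w} [CommRing k] [CommRing ℓ]
    [Algebra k ℓ] [CommRing P] [Algebra k P] [Biring k P] [CommRing Q] [Algebra ℓ Q] [Algebra k Q]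
    [IsScalarTower k ℓ Q] [Biring ℓ Q] (f : P →ₐ[k] Q) : Prop where
  coadd : ∀ p : P, Coring.coadd (k := ℓ) (f p) =
    Algebra.TensorProduct.productMap
      (((Algebra.TensorProduct.includeLeft : Q →ₐ[ℓ] Q ⊗[ℓ] Q).restrictScalars k).comp f)
      (((Algebra.TensorProduct.includeRight : Q →ₐ[ℓ] Q ⊗[ℓ] Q).restrictScalars k).comp f)
      (Coring.coadd (k := k) p)
  comul : ∀ p : P, Coring.comul (k := ℓ) (f p) =
    Algebra.TensorProduct.productMap
      (((Algebra.TensorProduct.includeLeft : Q →ₐ[ℓ] Q ⊗[ℓ] Q).restrictScalars k).comp f)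
      (((Algebra.TensorProduct.includeRight : Q →ₐ[ℓ] Q ⊗[ℓ] Q).restrictScalars k).comp f)
      (Coring.comul (k := k) p)
  colin : ∀ (c : k) (p : P), (Biring.colin (algebraMap k ℓ c) : Points ℓ Q ℓ) (f p) =
    algebraMap k ℓ ((Biring.colin c : Points k P k) p)

theorem productMap_hom_comp {k : Type u} {P : Type v} {Q : Type w} [CommRing k] [CommRing P]
    [Algebra k P] [CommRing Q] [Algebra k Q] {A : Type*} [CommRing A] [Algebra k A]
    (f : P →ₐ[k] Q) (x y : Q →ₐ[k] A) :
    (Algebra.TensorProduct.productMap x y).comp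
      (Algebra.TensorProduct.productMap
        (((Algebra.TensorProduct.includeLeft : Q →ₐ[k] Q ⊗[k] Q).restrictScalars k).comp f)
        (((Algebra.TensorProduct.includeRight : Q →ₐ[k] Q ⊗[k] Q).restrictScalars k).comp f)) =
    Algebra.TensorProduct.productMap (x.comp f) (y.comp f) := by
  ext <;> simp

/-- A morphism of `k`-`k`-birings `f : P → Q` induces maps of `k`-rings
`Ring_k(Q, A) → Ring_k(P, A)`. -/
def Points.comap {k : Type u} {P : Type v} {Q : Type w} [CommRing k] [CommRing P]
    [Algebra k P] [Biring k P] [CommRing Q] [Algebra k Q] [Biring k Q] {f : P →ₐ[k] Q}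
    (hf : IsBiringHom k k f) (A : Type*) [CommRing A] [Algebra k A] :
    Points k Q A →ₐ[k] Points k P A where
  toFun x := Points.ofAlgHom (x.toAlgHom.comp f)
  map_add' x y := by
    change ((Algebra.TensorProduct.productMap x.toAlgHom y.toAlgHom).comp Coring.coadd).comp f =
      (Algebra.TensorProduct.productMap (x.toAlgHom.comp f) (y.toAlgHom.comp f)).comp Coring.coadd
    ext p
    rw [← productMap_hom_comp]
    simp only [AlgHom.comp_apply]
    rw [hf.coadd]
  map_mul' x y := by
    change ((Algebra.TensorProduct.productMap x.toAlgHom y.toAlgHom).comp Coring.comul).comp f =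
      (Algebra.TensorProduct.productMap (x.toAlgHom.comp f) (y.toAlgHom.comp f)).comp Coring.comul
    ext p
    rw [← productMap_hom_comp]
    simp only [AlgHom.comp_apply]
    rw [hf.comul]
  map_zero' := by
    change ((Algebra.ofId k A).comp Coring.cozero).comp f = (Algebra.ofId k A).comp Coring.cozero
    ext p
    have h := hf.colin 0 p
    rw [map_zero, map_zero, map_zero] at h
    exact congrArg (algebraMap k A) h
  map_one' := by
    change ((Algebra.ofId k A).comp Coring.coone).comp f = (Algebra.ofId k A).comp Coring.coone
    ext p
    have h := hf.colin 1 p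
    rw [map_one, map_one, map_one] at h
    exact congrArg (algebraMap k A) h
  commutes' c := by
    change ((Algebra.ofId k A).comp (Biring.colin c : Points k Q k).toAlgHom).comp f =
      (Algebra.ofId k A).comp (Biring.colin c : Points k P k).toAlgHom
    ext p
    exact congrArg (algebraMap k A) (hf.colin c p)

/-! ## The composition product

Let `S` be a `k`-`k`-biring and `R`, `B` commutative `k`-algebras. The composition product `S ⊙ R`
is the `k`-ring generated by symbols `s ⊙ r` which are compatible with the `k`-ring operations in
`s` and satisfy `s ⊙ (r + r') = Δ⁺(s)(r, r')`, `s ⊙ (r r') = Δ^×(s)(r, r')`, `s ⊙ c = β(c)(s)`. So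
a map of `k`-rings `S ⊙ R → B`, `s ⊙ r ↦ s ∘ r`, is the same as a map of `k`-rings
`ρ : R → Ring_k(S, B)`, `ρ r s = s ∘ r`. We always write maps out of `S ⊙ R` in this form. -/

section Composition

variable {k : Type u} [CommRing k]

/-- For a ring map `S ⊙ R → B`, `s ⊙ r ↦ s ∘ r = ρ r s`, the induced map
`S ⊙ (R ⊗ R) = (S ⊙ R) ⊗ (S ⊙ R) → B ⊗ B`; it is determined by `s ∘ (r ⊗ 1) = (s ∘ r) ⊗ 1` and
`s ∘ (1 ⊗ r) = 1 ⊗ (s ∘ r)`. -/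
def compTensor {S R B : Type*} [CommRing S] [Algebra k S] [Biring k S] [CommRing R] [Algebra k R]
    [CommRing B] [Algebra k B] (ρ : R →ₐ[k] Points k S B) :
    R ⊗[k] R →ₐ[k] Points k S (B ⊗[k] B) :=
  Algebra.TensorProduct.productMap
    ((Points.map S (Algebra.TensorProduct.includeLeft : B →ₐ[k] B ⊗[k] B)).comp ρ)
    ((Points.map S (Algebra.TensorProduct.includeRight : B →ₐ[k] B ⊗[k] B)).comp ρ)

/-- The ring map `S ⊙ R → B`, `s ⊙ r ↦ s ∘ r = ρ r s`, is a map of `k`-`k`-birings. The biring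
structure on `S ⊙ R` represents the composite of the functors represented by `S` and `R`, so that
`Δ(s ⊙ r) = s ⊙ Δ(r)` in `S ⊙ (R ⊗ R) = (S ⊙ R) ⊗ (S ⊙ R)` for `Δ = Δ⁺, Δ^×`, and
`β(c)(s ⊙ r) = β(β(c)(r))(s)`. -/
structure IsBiringComp {S R B : Type*} [CommRing S] [Algebra k S] [Biring k S]
    [CommRing R] [Algebra k R] [Biring k R] [CommRing B] [Algebra k B] [Biring k B]
    (ρ : R →ₐ[k] Points k S B) : Prop where
  coadd : ∀ (s : S) (r : R),
    Coring.coadd (k := k) (ρ r s) = compTensor ρ (Coring.coadd (k := k) r) s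
  comul : ∀ (s : S) (r : R),
    Coring.comul (k := k) (ρ r s) = compTensor ρ (Coring.comul (k := k) r) s
  colin : ∀ (c : k) (s : S) (r : R), (Biring.colin c : Points k B k) (ρ r s) =
    (Biring.colin ((Biring.colin c : Points k R k) r) : Points k S k) s

end Composition

/-! ## Plethories and their actions -/

/-- A `k`-plethory: a monoid for the composition product in the category of `k`-`k`-birings.
We write `α ∘ β = compHom β α`. The unit `k[e] → P` is given by the image `e` of the variable; that
it is a map of birings is expressed by the formulas for the co-operations on `e`. -/
class Plethory (k : Type u) (P : Type v) [CommRing k] [CommRing P] [Algebra k P]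
    extends Biring k P where
  /-- the map `P ⊙ P → P`, `α ⊙ β ↦ α ∘ β = compHom β α` -/
  compHom : P →ₐ[k] Points k P P
  compHom_isBiringComp : IsBiringComp compHom
  /-- the unit of the composition -/
  e : P
  coadd_e : coadd e = e ⊗ₜ[k] 1 + 1 ⊗ₜ[k] e
  comul_e : comul e = e ⊗ₜ[k] e
  colin_e : ∀ c : k, colin c e = c
  comp_assoc : ∀ α β γ : P, compHom γ (compHom β α) = compHom (compHom γ β) α
  e_comp : ∀ α : P, compHom α e = α
  comp_e : ∀ α : P, compHom e α = α

/-- Composition `α ∘ β` in a plethory. -/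
def comp (k : Type u) {P : Type v} [CommRing k] [CommRing P] [Algebra k P] [Plethory k P]
    (α β : P) : P := (Plethory.compHom (k := k) β) α

/-- A morphism of plethories over a ring map `k → ℓ`: a morphism of birings that is a morphism of
monoids. For `ℓ = k` this is a morphism of `k`-plethories. -/
structure IsPlethoryHom (k : Type u) (ℓ : Type*) {P : Type v} {Q : Type w} [CommRing k]
    [CommRing ℓ] [Algebra k ℓ] [CommRing P] [Algebra k P] [Plethory k P] [CommRing Q] [Algebra ℓ Q]
    [Algebra k Q] [IsScalarTower k ℓ Q] [Plethory ℓ Q] (f : P →ₐ[k] Q) : Prop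
    extends IsBiringHom k ℓ f where
  map_e : f (Plethory.e k) = Plethory.e ℓ
  map_comp : ∀ α β : P, f (comp k α β) = comp ℓ (f α) (f β)

/-- A (left) action of the `k`-plethory `P` on the `k`-ring `R`; a `P`-ring is a `k`-ring with such
an action. The map `P ⊙ R → R`, `α ⊙ r ↦ α ∘ r` is given as `α ∘ r = actHom r α`. -/
@[ext]
structure PAction (k : Type u) (P : Type v) (R : Type w) [CommRing k] [CommRing P] [Algebra k P]
    [Plethory k P] [CommRing R] [Algebra k R] where
  /-- the map `P ⊙ R → R`, `α ⊙ r ↦ α ∘ r = actHom r α` -/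
  actHom : R →ₐ[k] Points k P R
  comp_act : ∀ (α β : P) (r : R), actHom r (comp k α β) = actHom (actHom r β) α
  e_act : ∀ r : R, actHom r (Plethory.e k) = r

namespace PAction

variable {k : Type u} {P : Type v} [CommRing k] [CommRing P] [Algebra k P] [Plethory k P]

/-- The action `α ∘ r` of `α : P` on `r : R`. -/
def act {R : Type w} [CommRing R] [Algebra k R] (a : PAction k P R) (α : P) (r : R) : R :=
  a.actHom r α

/-- The left action of a plethory on itself. -/
def self (k : Type u) (P : Type v) [CommRing k] [CommRing P] [Algebra k P] [Plethory k P] :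
    PAction k P P where
  actHom := Plethory.compHom
  comp_act α β γ := Plethory.comp_assoc α β γ
  e_act := Plethory.e_comp

/-- A ring map between two `P`-rings is a map of `P`-rings if it is `P`-equivariant. -/
def IsEquivariant {R : Type w} {R' : Type*} [CommRing R] [Algebra k R] [CommRing R'] [Algebra k R']
    (a : PAction k P R) (a' : PAction k P R') (g : R →ₐ[k] R') : Prop :=
  ∀ (α : P) (r : R), g (a.act α r) = a'.act α (g r)

/-- Restriction of an action of `P'` along a morphism `φ : P → P'` of `k`-plethories:
`α ∘ r = φ(α) ∘ r`. -/
def restrict {P' : Type*} [CommRing P'] [Algebra k P'] [Plethory k P'] {φ : P →ₐ[k] P'}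
    (hφ : IsPlethoryHom k k φ) {R : Type w} [CommRing R] [Algebra k R] (a : PAction k P' R) :
    PAction k P R where
  actHom := (Points.comap hφ.toIsBiringHom R).comp a.actHom
  comp_act α β r := by
    change a.actHom r (φ (comp k α β)) = a.actHom (a.actHom r (φ β)) (φ α)
    rw [hφ.map_comp, a.comp_act]
  e_act r := by
    change a.actHom r (φ (Plethory.e k)) = r
    rw [hφ.map_e, a.e_act]

end PAction

/-- A composite of morphisms of `k`-plethories is a morphism of `k`-plethories. -/
theorem IsPlethoryHom.trans {k : Type u} {P P' P'' : Type*} [CommRing k] [CommRing P] [Algebra k P]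
    [Plethory k P] [CommRing P'] [Algebra k P'] [Plethory k P'] [CommRing P''] [Algebra k P'']
    [Plethory k P''] {g : P' →ₐ[k] P''} {f : P →ₐ[k] P'} (hg : IsPlethoryHom k k g)
    (hf : IsPlethoryHom k k f) : IsPlethoryHom k k (g.comp f) where
  coadd p := by
    simp only [AlgHom.comp_apply]
    rw [hg.coadd, hf.coadd, ← AlgHom.comp_apply, productMap_hom_comp]
    rfl
  comul p := by
    simp only [AlgHom.comp_apply]
    rw [hg.comul, hf.comul, ← AlgHom.comp_apply, productMap_hom_comp]
    rfl
  colin c p := by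
    have h1 := hg.colin c (f p)
    have h2 := hf.colin c p
    exact h1.trans h2
  map_e := by rw [AlgHom.comp_apply, hf.map_e, hg.map_e]
  map_comp α β := by simp only [AlgHom.comp_apply, hf.map_comp, hg.map_comp]

/-- A right action `s ∘ p = ρ p s` of the `k`-plethory `P` on the `k`-`k`-biring `S`, given by a map
of birings `S ⊙ P → S`. A `k`-`k`-biring with a right `P`-action is a `k[e]`-`P`-biring. -/
structure IsRightAction (k : Type u) {P : Type v} {S : Type w} [CommRing k] [CommRing P]
    [Algebra k P] [Plethory k P] [CommRing S] [Algebra k S] [Biring k S]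
    (ρ : P →ₐ[k] Points k S S) : Prop where
  isBiringComp : IsBiringComp ρ
  act_comp : ∀ (s : S) (α β : P), ρ (comp k α β) s = ρ β (ρ α s)
  act_e : ∀ s : S, ρ (Plethory.e k) s = s

/-! ## The amplification -/

section Amplification

variable {O : Type u} [CommRing O] (m : Ideal O)

/-- The `m`-torsion submodule of `M` is trivial. -/
def IsTorsionFreeAt (M : Type*) [AddCommGroup M] [Module O M] : Prop :=
  ∀ x : M, (∃ n : ℕ, ∀ a ∈ m ^ n, a • x = 0) → x = 0

variable {P Q : Type u} [CommRing P] [Algebra O P] [Plethory O P]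
  [CommRing Q] [Algebra (O ⧸ m) Q] [Algebra O Q] [IsScalarTower O (O ⧸ m) Q] [Plethory (O ⧸ m) Q]

/-- A `P`-ring `R` is a `P`-deformation of a `Q`-ring (for `f : P → Q` surjective): it is
`m`-torsion-free, and the action of `P` on `(O/m) ⊗ R`, which is given by
`α ∘ (1 ⊗ r) = 1 ⊗ (α ∘ r)`, factors through an action of `Q` along `f`. -/
structure IsDeformation (f : P →ₐ[O] Q) {R : Type v} [CommRing R] [Algebra O R]
    (a : PAction O P R) : Prop where
  torsionFree : IsTorsionFreeAt m R
  factors : ∃ c : PAction (O ⧸ m) Q ((O ⧸ m) ⊗[O] R), ∀ (α : P) (r : R),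
    c.act (f α) (1 ⊗ₜ[O] r) = 1 ⊗ₜ[O] a.act α r

variable [IsDedekindDomain O]

/-- The subring `K` of the field of fractions of `O` of the elements that are integral at all
maximal ideals not dividing `m`. -/
def IntegersAway : Type u :=
  Set.integer {v : IsDedekindDomain.HeightOneSpectrum O | m ≤ v.asIdeal} (FractionRing O)

instance : CommRing (IntegersAway m) :=
  inferInstanceAs (CommRing
    (Set.integer {v : IsDedekindDomain.HeightOneSpectrum O | m ≤ v.asIdeal} (FractionRing O)))

instance : Algebra O (IntegersAway m) :=
  inferInstanceAs (Algebra O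
    (Set.integer {v : IsDedekindDomain.HeightOneSpectrum O | m ≤ v.asIdeal} (FractionRing O)))

/-- The sub-`O`-ring `S` of `K ⊗ P` generated by `m⁻¹ ⊗ I`, where `I` is the kernel of `f : P → Q`
and `m⁻¹` is the set of all `x : K` with `x m ⊆ O`. -/
def blowup (f : P →ₐ[O] Q) : Subalgebra O (IntegersAway m ⊗[O] P) :=
  Algebra.adjoin O {z | ∃ (x : IntegersAway m) (p : P),
    (∀ a ∈ m, ∃ b : O, algebraMap O (IntegersAway m) b = a • x) ∧ f p = 0 ∧ z = x ⊗ₜ[O] p}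

/-- The map `S ⊗ S → (K ⊗ P) ⊗_K (K ⊗ P) = K ⊗ (P ⊗ P)`. -/
def blowupTensor (f : P →ₐ[O] Q) :
    blowup m f ⊗[O] blowup m f →ₐ[O] IntegersAway m ⊗[O] (P ⊗[O] P) :=
  Algebra.TensorProduct.productMap
    ((Algebra.TensorProduct.map (AlgHom.id O (IntegersAway m))
      (Algebra.TensorProduct.includeLeft : P →ₐ[O] P ⊗[O] P)).comp (blowup m f).val)
    ((Algebra.TensorProduct.map (AlgHom.id O (IntegersAway m))
      (Algebra.TensorProduct.includeRight : P →ₐ[O] P ⊗[O] P)).comp (blowup m f).val)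

/-- The `O`-`O`-biring structure on `S ⊆ K ⊗ P` and the right action `ρ` of `P` on it are induced
by the biring structure and the right action of `P` on `K ⊗ P`, and `incl : P → S` is the inclusion
`p ↦ 1 ⊗ p`. -/
structure IsInduced (f : P →ₐ[O] Q) [Biring O (blowup m f)]
    (ρ : P →ₐ[O] Points O (blowup m f) (blowup m f)) (incl : P →ₐ[O] blowup m f) : Prop where
  coadd : ∀ s : blowup m f, blowupTensor m f (Coring.coadd (k := O) s) =
    Algebra.TensorProduct.map (AlgHom.id O (IntegersAway m)) (Coring.coadd (k := O) (S := P)) s.1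
  comul : ∀ s : blowup m f, blowupTensor m f (Coring.comul (k := O) s) =
    Algebra.TensorProduct.map (AlgHom.id O (IntegersAway m)) (Coring.comul (k := O) (S := P)) s.1
  colin : ∀ (c : O) (s : blowup m f),
    algebraMap O (IntegersAway m) ((Biring.colin c : Points O (blowup m f) O) s) =
      Algebra.TensorProduct.productMap (AlgHom.id O (IntegersAway m))
        ((Algebra.ofId O (IntegersAway m)).comp (Biring.colin c : Points O P O).toAlgHom) s.1
  act : ∀ (p : P) (s : blowup m f), (ρ p s).1 =
    Algebra.TensorProduct.map (AlgHom.id O (IntegersAway m))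
      (Plethory.compHom (k := O) p).toAlgHom s.1
  incl : ∀ p : P, (incl p).1 = 1 ⊗ₜ[O] p

end Amplification

/-- For a `k[e]`-`P`-biring `S` (with right action `ρ` of `P`) with a map `g : P → S`, and a
`P`-plethory `X` with structure map `φ : P → X`: the map `i : S → X` is a map of
`k[e]`-`P`-birings that agrees with `φ` on `P`. -/
structure IsPointedMap {k : Type u} [CommRing k] {P S X : Type*} [CommRing P] [Algebra k P]
    [Plethory k P] [CommRing S] [Algebra k S] [Biring k S] [CommRing X] [Algebra k X] [Plethory k X]
    (ρ : P →ₐ[k] Points k S S) (g : P →ₐ[k] S) (φ : P →ₐ[k] X) (i : S →ₐ[k] X) : Prop where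
  isPlethoryHom : IsPlethoryHom k k φ
  isBiringHom : IsBiringHom k k i
  map_act : ∀ (s : S) (p : P), i (ρ p s) = comp k (i s) (φ p)
  comp_eq : i.comp g = φ

/-- `T` with `φ : P → T` and `i : S → T` is the free `P`-plethory on the pointed
`k[e]`-`P`-biring `g : P → S`: the initial `P`-plethory equipped with a map of `k[e]`-`P`-birings
from `S` that respects the maps from `P`. -/
structure IsFreePointed {k : Type u} [CommRing k] {P S T : Type u} [CommRing P] [Algebra k P]
    [Plethory k P] [CommRing S] [Algebra k S] [Biring k S] [CommRing T] [Algebra k T] [Plethory k T]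
    (ρ : P →ₐ[k] Points k S S) (g : P →ₐ[k] S) (φ : P →ₐ[k] T) (i : S →ₐ[k] T) : Prop where
  isPointedMap : IsPointedMap ρ g φ i
  initial : ∀ (X : Type u) [CommRing X] [Algebra k X] [Plethory k X] (φ' : P →ₐ[k] X)
    (i' : S →ₐ[k] X), IsPointedMap ρ g φ' i' →
    ∃! h : T →ₐ[k] X, IsPlethoryHom k k h ∧ h.comp φ = φ' ∧ h.comp i = i'

/-- The map of plethories `π : T → T'` is the maximal `m`-torsion-free quotient of the plethory `T`:
it is surjective, `T'` is `m`-torsion-free, and it dominates every `m`-torsion-free quotient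
`T`-ring of `T`. -/
structure IsMaximalTorsionFreeQuotient {O : Type u} [CommRing O] (m : Ideal O) {T T' : Type u}
    [CommRing T] [Algebra O T] [Plethory O T] [CommRing T'] [Algebra O T'] [Plethory O T']
    (π : T →ₐ[O] T') : Prop where
  isPlethoryHom : IsPlethoryHom O O π
  surjective : Function.Surjective π
  torsionFree : IsTorsionFreeAt m T'
  maximal : ∀ (R : Type u) [CommRing R] [Algebra O R] (a : PAction O T R) (ψ : T →ₐ[O] R),
    IsTorsionFreeAt m R → Function.Surjective ψ → (PAction.self O T).IsEquivariant a ψ →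
    ∀ t : T, π t = 0 → ψ t = 0

/-- An amplification of `P` along `f : P → Q`. Its constituents are, in this order: the
`O[e]`-`P`-biring `S` generated by `m⁻¹ ⊗ I` in `K ⊗ P`, pointed by the inclusion `P → S`; the free
`P`-plethory `T` on it; and the maximal `m`-torsion-free quotient `P'` of `T`. All of these are
unique up to unique isomorphism. -/
structure Amplification {O : Type u} [CommRing O] [IsDedekindDomain O] (m : Ideal O)
    {P Q : Type u} [CommRing P] [Algebra O P] [Plethory O P] [CommRing Q] [Algebra (O ⧸ m) Q]
    [Algebra O Q] [IsScalarTower O (O ⧸ m) Q] [Plethory (O ⧸ m) Q] (f : P →ₐ[O] Q) where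
  /-- the biring structure on `S` -/
  [biring : Biring O (blowup m f)]
  /-- the right action of `P` on `S` -/
  ρ : P →ₐ[O] Points O (blowup m f) (blowup m f)
  isRightAction : IsRightAction O ρ
  /-- the inclusion `P → S` -/
  incl : P →ₐ[O] blowup m f
  isInduced : IsInduced m f ρ incl
  /-- the free plethory on the pointed biring `S` -/
  T : Type u
  [commRingT : CommRing T]
  [algebraT : Algebra O T]
  [plethoryT : Plethory O T]
  /-- the structure map of the `P`-plethory `T` -/
  toT : P →ₐ[O] T
  /-- the universal map from `S` to `T` -/
  ι : blowup m f →ₐ[O] T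
  isFree : IsFreePointed ρ incl toT ι
  /-- the amplification, which is the maximal `m`-torsion-free quotient of `T` -/
  P' : Type u
  [commRing : CommRing P']
  [algebra : Algebra O P']
  [plethory : Plethory O P']
  /-- the projection from `T` to its maximal `m`-torsion-free quotient -/
  π : T →ₐ[O] P'
  isQuotient : IsMaximalTorsionFreeQuotient m π

namespace Amplification

variable {O : Type u} [CommRing O] [IsDedekindDomain O] {m : Ideal O}
  {P Q : Type u} [CommRing P] [Algebra O P] [Plethory O P] [CommRing Q] [Algebra (O ⧸ m) Q]
  [Algebra O Q] [IsScalarTower O (O ⧸ m) Q] [Plethory (O ⧸ m) Q] {f : P →ₐ[O] Q}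

attribute [instance] commRingT algebraT plethoryT commRing algebra plethory

/-- The structure map `P → P'` of the `P`-plethory `P'`. -/
def structureMap (A : Amplification m f) : P →ₐ[O] A.P' := A.π.comp A.toT

theorem isPlethoryHom_structureMap (A : Amplification m f) :
    IsPlethoryHom O O A.structureMap :=
  letI := A.biring
  A.isQuotient.isPlethoryHom.trans A.isFree.isPointedMap.isPlethoryHom

/-- The `P`-ring underlying a `P'`-ring. -/
def forget (A : Amplification m f) {R : Type u} [CommRing R] [Algebra O R]
    (a : PAction O A.P' R) : PAction O P R :=
  a.restrict A.isPlethoryHom_structureMap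

end Amplification

end Plethystic

/-! Let `I = ker f` and let `S` be the blowup. The plethories involved are determined by what they
act on.

For an `m`-torsion-free `P`-ring `R` three conditions agree: `P` acts on `R/mR` through `Q`; `I ∘ r
⊆ mR` for all `r`; each map `P → R`, `p ↦ p ∘ r`, extends to `S`. The last equivalence is the
universal property of the blowup: ring maps `S → R` are ring maps `P → R` carrying `I` into `mR`
(`exists_blowup_lift`, `blowup_algHom_ext`, `mapsKer_incl`). Indeed `R` embeds into `K ⊗ R`, `m` is
invertible in `K`, and a power of `m` moves any element of `S` into `P`. The same property, applied
to `S ⊗ S`, `O` and `S`, extends the biring structure and the right action from `P` to `S`. Thus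
deformations are the `m`-torsion-free rings with operations from the pointed biring `S`
(`IsPointedOp`), and `P'` has to be the plethory of all operations on them.

Such plethories come from universal algebra. A class of rings with operations that contains the base
ring and is closed under tensor products and subobjects of products has a free object `T` on one
generator `e`, a ring of term functions (`exists_isFreeOn`). Since `T ⊗ T` and the base ring lie in
the class, the homomorphisms sending `e` to `e ⊗ 1 + 1 ⊗ e`, to `e ⊗ e`, to a constant or to an
element of `T` are the coaddition, the comultiplication, `β` and right composition. Every axiom
equates two homomorphisms out of `T` and is checked at `e` (`IsFreeOn.plethory`). The class of all
pointed `S`-rings gives the free plethory, and the subclass of `m`-torsion-free ones gives its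
maximal torsion-free quotient; no ideal has to be shown compatible with co-operations. What has to
be shown is that `m`-torsion-free modules are stable under tensor products
(`IsTorsionFreeAt.tensor`); this uses that `O` is Dedekind and `m ≠ 0`. The latter is automatic, as
`P` has a counit to `O` and so is nonzero.

An arbitrary amplification is handled through its universal properties. Its actions on deformations
exist by `exists_forget_eq`, and a `P`-equivariant map into an `m`-torsion-free ring is
`P'`-equivariant by `isEquivariant_iff`. Applied to the structure maps of a `P`-plethory `P''` that
is a deformation, this makes `α ↦ α ∘ e` a map of plethories `P' → P''`. -/

namespace Plethystic

open Algebra.TensorProduct (includeLeft includeRight productMap)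

/-! ## Rings with operations from a biring -/

namespace Points

section

variable {k S A B : Type*} [CommRing k] [CommRing S] [Algebra k S] [CommRing A] [Algebra k A]
  [CommRing B] [Algebra k B]

@[ext]
theorem ext {x y : Points k S A} (h : ∀ s, x s = y s) : x = y := DFunLike.ext _ _ h

@[simp]
theorem ofAlgHom_apply (x : S →ₐ[k] A) (s : S) : (ofAlgHom x : Points k S A) s = x s := rfl

@[simp]
theorem toAlgHom_apply (x : Points k S A) (s : S) : x.toAlgHom s = x s := rfl

theorem add_apply [Coring k S] (x y : Points k S A) (s : S) :
    (x + y) s = productMap x.toAlgHom y.toAlgHom (Coring.coadd (k := k) s) := rfl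

theorem mul_apply [Coring k S] (x y : Points k S A) (s : S) :
    (x * y) s = productMap x.toAlgHom y.toAlgHom (Coring.comul (k := k) s) := rfl

variable [Biring k S]

theorem algebraMap_apply (c : k) (s : S) :
    (algebraMap k (Points k S A) c) s = algebraMap k A ((Biring.colin c : Points k S k) s) := rfl

@[simp]
theorem map_apply (φ : A →ₐ[k] B) (x : Points k S A) (s : S) : map S φ x s = φ (x s) := rfl

variable {P : Type*} [CommRing P] [Algebra k P]

@[simp]
theorem comap_apply [Biring k P] {g : P →ₐ[k] S} (hg : IsBiringHom k k g)
    (x : Points k S A) (p : P) : comap hg A x p = x (g p) := rfl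

end

end Points

section

variable {k S : Type*} [CommRing k] [CommRing S] [Algebra k S] [Biring k S]
variable {R R' R'' R₃ : Type*} [CommRing R] [Algebra k R] [CommRing R'] [Algebra k R']
  [CommRing R''] [Algebra k R''] [CommRing R₃] [Algebra k R₃]

theorem algHom_comp_productMap (F : R'' →ₐ[k] R₃) (a : R →ₐ[k] R'') (b : R' →ₐ[k] R'') :
    F.comp (productMap a b) = productMap (F.comp a) (F.comp b) := by
  ext <;> simp

theorem tensor_hom_ext {a b : R ⊗[k] R' →ₐ[k] R''}
    (h1 : ∀ r, a (r ⊗ₜ 1) = b (r ⊗ₜ 1)) (h2 : ∀ r, a (1 ⊗ₜ r) = b (1 ⊗ₜ r)) : a = b := by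
  ext r
  · simpa using h1 r
  · simpa using h2 r

/-- A map between rings with an action of the operations in `S` is compatible with the
operations. -/
def IsOpHom (ρ : R →ₐ[k] Points k S R) (ρ' : R' →ₐ[k] Points k S R') (h : R →ₐ[k] R') : Prop :=
  (Points.map S h).comp ρ = ρ'.comp h

theorem isOpHom_iff {ρ : R →ₐ[k] Points k S R} {ρ' : R' →ₐ[k] Points k S R'} {h : R →ₐ[k] R'} :
    IsOpHom ρ ρ' h ↔ ∀ r s, h (ρ r s) = ρ' (h r) s :=
  ⟨fun H r s => DFunLike.congr_fun (DFunLike.congr_fun H r) s,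
    fun H => AlgHom.ext fun r => Points.ext fun s => H r s⟩

theorem IsOpHom.apply {ρ : R →ₐ[k] Points k S R} {ρ' : R' →ₐ[k] Points k S R'} {h : R →ₐ[k] R'}
    (H : IsOpHom ρ ρ' h) (r : R) (s : S) : h (ρ r s) = ρ' (h r) s := isOpHom_iff.1 H r s

theorem IsOpHom.id (ρ : R →ₐ[k] Points k S R) : IsOpHom ρ ρ (AlgHom.id k R) := rfl

theorem IsOpHom.comp {ρ : R →ₐ[k] Points k S R} {ρ' : R' →ₐ[k] Points k S R'}
    {ρ'' : R'' →ₐ[k] Points k S R''} {g : R' →ₐ[k] R''} {h : R →ₐ[k] R'}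
    (hg : IsOpHom ρ' ρ'' g) (hh : IsOpHom ρ ρ' h) : IsOpHom ρ ρ'' (g.comp h) :=
  isOpHom_iff.2 fun r s => by simp [hh.apply, hg.apply]

/-- The operations on the base ring are compatible with structure maps. -/
theorem isOpHom_ofId (ρ : R →ₐ[k] Points k S R) :
    IsOpHom (Algebra.ofId k (Points k S k)) ρ (Algebra.ofId k R) :=
  Subsingleton.elim _ _

/-- The operations on a tensor product. -/
def tensorOp (ρ : R →ₐ[k] Points k S R) (ρ' : R' →ₐ[k] Points k S R') :
    R ⊗[k] R' →ₐ[k] Points k S (R ⊗[k] R') :=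
  productMap ((Points.map S includeLeft).comp ρ) ((Points.map S includeRight).comp ρ')

variable {ρ : R →ₐ[k] Points k S R} {ρ' : R' →ₐ[k] Points k S R'}
    {ρ'' : R'' →ₐ[k] Points k S R''} {ρ₃ : R₃ →ₐ[k] Points k S R₃}

theorem isOpHom_includeLeft (ρ : R →ₐ[k] Points k S R) (ρ' : R' →ₐ[k] Points k S R') :
    IsOpHom ρ (tensorOp ρ ρ') includeLeft := by
  refine AlgHom.ext fun r => ?_
  simp [tensorOp]

theorem isOpHom_includeRight (ρ : R →ₐ[k] Points k S R) (ρ' : R' →ₐ[k] Points k S R') :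
    IsOpHom ρ' (tensorOp ρ ρ') includeRight := by
  refine AlgHom.ext fun r => ?_
  simp [tensorOp]

theorem tensorOp_tmul_one (r : R) :
    tensorOp ρ ρ' (r ⊗ₜ 1) = Points.map S includeLeft (ρ r) := by simp [tensorOp]

theorem tensorOp_one_tmul (r : R') :
    tensorOp ρ ρ' (1 ⊗ₜ r) = Points.map S includeRight (ρ' r) := by simp [tensorOp]

theorem IsOpHom.productMap {a : R →ₐ[k] R''} {b : R' →ₐ[k] R''}
    (ha : IsOpHom ρ ρ'' a) (hb : IsOpHom ρ' ρ'' b) :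
    IsOpHom (tensorOp ρ ρ') ρ'' (productMap a b) := by
  refine tensor_hom_ext (fun r => ?_) (fun r => ?_)
  · ext s; simp [tensorOp_tmul_one, ha.apply]
  · ext s; simp [tensorOp_one_tmul, hb.apply]

theorem IsOpHom.tensorMap {a : R →ₐ[k] R''} {b : R' →ₐ[k] R₃}
    (ha : IsOpHom ρ ρ'' a) (hb : IsOpHom ρ' ρ₃ b) :
    IsOpHom (tensorOp ρ ρ') (tensorOp ρ'' ρ₃) (Algebra.TensorProduct.map a b) := by
  have : Algebra.TensorProduct.map a b =
      Algebra.TensorProduct.productMap (includeLeft.comp a) (includeRight.comp b) := by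
    ext <;> simp
  rw [this]
  exact ((isOpHom_includeLeft _ _).comp ha).productMap ((isOpHom_includeRight _ _).comp hb)

theorem isOpHom_comm (ρ : R →ₐ[k] Points k S R) (ρ' : R' →ₐ[k] Points k S R') :
    IsOpHom (tensorOp ρ ρ') (tensorOp ρ' ρ) (Algebra.TensorProduct.comm k R R').toAlgHom := by
  have : (Algebra.TensorProduct.comm k R R').toAlgHom =
      Algebra.TensorProduct.productMap includeRight includeLeft := by
    ext <;> simp
  rw [this]
  exact (isOpHom_includeRight _ _).productMap (isOpHom_includeLeft _ _)

theorem isOpHom_assoc (ρ : R →ₐ[k] Points k S R) (ρ' : R' →ₐ[k] Points k S R')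
    (ρ'' : R'' →ₐ[k] Points k S R'') :
    IsOpHom (tensorOp (tensorOp ρ ρ') ρ'') (tensorOp ρ (tensorOp ρ' ρ''))
      (Algebra.TensorProduct.assoc k k k R R' R'').toAlgHom := by
  have : (Algebra.TensorProduct.assoc k k k R R' R'').toAlgHom =
      Algebra.TensorProduct.productMap (Algebra.TensorProduct.productMap includeLeft
        (includeRight.comp includeLeft)) (includeRight.comp includeRight) := by
    ext <;> simp [Algebra.TensorProduct.one_def]
  rw [this]
  exact ((isOpHom_includeLeft _ _).productMap
    ((isOpHom_includeRight _ _).comp (isOpHom_includeLeft _ _))).productMap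
    ((isOpHom_includeRight _ _).comp (isOpHom_includeRight _ _))

/-- A function into `Points k S R` is a homomorphism if it is one after composition with enough
homomorphisms out of `R`. -/
theorem exists_algHom_points {X : Type*} [CommRing X] [Algebra k X] (F : X → S → R)
    (I : Type*) (B : I → Type*) [∀ i, CommRing (B i)] [∀ i, Algebra k (B i)]
    (π : ∀ i, R →ₐ[k] B i) (hπ : ∀ x y, (∀ i, π i x = π i y) → x = y)
    (G : ∀ i, X →ₐ[k] Points k S (B i)) (hG : ∀ i x s, π i (F x s) = G i x s) :
    ∃ H : X →ₐ[k] Points k S R, ∀ x s, H x s = F x s := by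
  -- The axioms are verified twice, in `s` for fixed `x` and then in `x`. Each is an identity in
  -- `R`, tested after the jointly injective `π i`.
  let F' (x : X) : Points k S R := Points.ofAlgHom
    { toFun := F x
      map_one' := hπ _ _ fun i => by rw [hG]; simp
      map_zero' := hπ _ _ fun i => by rw [hG]; simp
      map_mul' s t := hπ _ _ fun i => by simp [hG]
      map_add' s t := hπ _ _ fun i => by simp [hG]
      commutes' c := hπ _ _ fun i => by
        rw [hG, AlgHom.commutes]; exact AlgHomClass.commutes (G i x) c }
  have hinj : ∀ x y : Points k S R, (∀ i, Points.map S (π i) x = Points.map S (π i) y) → x = y :=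
    fun x y h => Points.ext fun s => hπ _ _ fun i => DFunLike.congr_fun (h i) s
  have hF' : ∀ i x, Points.map S (π i) (F' x) = G i x := fun i x => Points.ext fun s => hG i x s
  exact ⟨{  toFun := F'
            map_one' := hinj _ _ fun i => by rw [hF']; simp
            map_zero' := hinj _ _ fun i => by rw [hF']; simp
            map_mul' s t := hinj _ _ fun i => by simp [hF']
            map_add' s t := hinj _ _ fun i => by simp [hF']
            commutes' c := hinj _ _ fun i => by rw [hF']; simp }, fun _ _ => rfl⟩

end

/-! ## Free rings with operations -/

section

variable {k S : Type u} [CommRing k] [CommRing S] [Algebra k S] [Biring k S]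

variable (k S) in
/-- A predicate on rings with operations from `S`. -/
abbrev OpPred : Type (u + 1) :=
  ∀ (R : Type u) [CommRing R] [Algebra k R], (R →ₐ[k] Points k S R) → Prop

/-- A class of rings with operations that contains the base ring and is closed under tensor
products and under subobjects of products. -/
structure IsOpVariety (𝒱 : OpPred k S) : Prop where
  base : 𝒱 k (Algebra.ofId k (Points k S k))
  tensor : ∀ (R R' : Type u) [CommRing R] [Algebra k R] [CommRing R'] [Algebra k R']
    (ρ : R →ₐ[k] Points k S R) (ρ' : R' →ₐ[k] Points k S R'), 𝒱 R ρ → 𝒱 R' ρ' →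
    𝒱 (R ⊗[k] R') (tensorOp ρ ρ')
  separated : ∀ (T : Type u) [CommRing T] [Algebra k T] (τ : T →ₐ[k] Points k S T),
    (∀ x y : T, (∀ (R : Type u) [CommRing R] [Algebra k R] (ρ : R →ₐ[k] Points k S R)
      (h : T →ₐ[k] R), 𝒱 R ρ → IsOpHom τ ρ h → h x = h y) → x = y) → 𝒱 T τ

/-- `T` is freely generated by `e` in the class `𝒱` of rings with operations. -/
structure IsFreeOn (𝒱 : OpPred k S) {T : Type u} [CommRing T] [Algebra k T]
    (τ : T →ₐ[k] Points k S T) (e : T) : Prop where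
  mem : 𝒱 T τ
  exists_lift : ∀ (R : Type u) [CommRing R] [Algebra k R] (ρ : R →ₐ[k] Points k S R), 𝒱 R ρ →
    ∀ r : R, ∃ h : T →ₐ[k] R, IsOpHom τ ρ h ∧ h e = r
  hom_ext : ∀ (R : Type u) [CommRing R] [Algebra k R] (ρ : R →ₐ[k] Points k S R), 𝒱 R ρ →
    ∀ h h' : T →ₐ[k] R, IsOpHom τ ρ h → IsOpHom τ ρ h' → h e = h' e → h = h'

/-- A ring with operations in the class `𝒱`, together with an element. -/
structure PointedOp (𝒱 : OpPred k S) : Type (u + 1) where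
  R : Type u
  [commRing : CommRing R]
  [algebra : Algebra k R]
  ρ : R →ₐ[k] Points k S R
  mem : 𝒱 R ρ
  pt : R

attribute [instance] PointedOp.commRing PointedOp.algebra

variable (k S) in
/-- Terms in one variable in the language of rings with operations. -/
inductive OpTerm : Type u
  | gen : OpTerm
  | const (c : k) : OpTerm
  | add (s t : OpTerm) : OpTerm
  | mul (s t : OpTerm) : OpTerm
  | app (s : S) (t : OpTerm) : OpTerm

namespace OpTerm

variable {𝒱 : OpPred k S}

/-- The value of a term at an element. -/
def eval (X : PointedOp 𝒱) : OpTerm k S → X.R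
  | gen => X.pt
  | const c => algebraMap k X.R c
  | add s t => eval X s + eval X t
  | mul s t => eval X s * eval X t
  | app s t => X.ρ (eval X t) s

variable (𝒱) in
/-- The ring of values of terms, as functions on all rings in `𝒱` with an element. -/
def values : Subalgebra k (∀ X : PointedOp 𝒱, X.R) where
  carrier := Set.range fun t X => eval X t
  mul_mem' := by
    rintro _ _ ⟨s, rfl⟩ ⟨t, rfl⟩
    exact ⟨mul s t, rfl⟩
  add_mem' := by
    rintro _ _ ⟨s, rfl⟩ ⟨t, rfl⟩
    exact ⟨add s t, rfl⟩
  algebraMap_mem' c := ⟨const c, rfl⟩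

/-- The product runs over a family in `Type (u + 1)`, but its subring of values is the image of the
terms, which live in `Type u`. -/
instance : Small.{u} (values 𝒱) :=
  inferInstanceAs (Small.{u} (Set.range fun (t : OpTerm k S) (X : PointedOp 𝒱) => eval X t))

variable (𝒱) in
/-- The free ring with operations on one generator in the class `𝒱`. -/
def FreeOp : Type u := Shrink.{u} (values 𝒱)

instance : CommRing (FreeOp 𝒱) := inferInstanceAs (CommRing (Shrink.{u} (values 𝒱)))

instance : Algebra k (FreeOp 𝒱) := inferInstanceAs (Algebra k (Shrink.{u} (values 𝒱)))

/-- The free ring as a ring of functions. -/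
def toValues : FreeOp 𝒱 ≃ₐ[k] values 𝒱 := Shrink.algEquiv k (values 𝒱)

/-- The class of a term in the free ring. -/
def mk (t : OpTerm k S) : FreeOp 𝒱 := toValues.symm ⟨fun X => eval X t, t, rfl⟩

theorem mk_surjective : Function.Surjective (mk : OpTerm k S → FreeOp 𝒱) := by
  intro x
  obtain ⟨t, ht⟩ := (toValues x).2
  refine ⟨t, ?_⟩
  rw [mk, AlgEquiv.symm_apply_eq]
  exact Subtype.ext ht

/-- The value at an element, as a homomorphism. -/
def evalHom (X : PointedOp 𝒱) : FreeOp 𝒱 →ₐ[k] X.R :=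
  (Pi.evalAlgHom k (fun X : PointedOp 𝒱 => X.R) X).comp ((values 𝒱).val.comp toValues.toAlgHom)

theorem evalHom_mk (X : PointedOp 𝒱) (t : OpTerm k S) : evalHom X (mk t) = eval X t := by
  simp [evalHom, mk]

theorem evalHom_separates {x y : FreeOp 𝒱} (h : ∀ X, evalHom X x = evalHom X y) : x = y :=
  toValues.injective (Subtype.ext (funext h))

end OpTerm

-- Term functions form the free object, as in Birkhoff's theorem: evaluation at a pointed ring is
-- the required homomorphism, and homomorphisms agreeing at the generator agree on all terms by
-- induction.
open OpTerm in
theorem exists_isFreeOn {𝒱 : OpPred k S} (h𝒱 : IsOpVariety 𝒱) :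
    ∃ (τ : FreeOp 𝒱 →ₐ[k] Points k S (FreeOp 𝒱)) (e : FreeOp 𝒱), IsFreeOn 𝒱 τ e := by
  -- The operation `s` takes the class of `t` to that of `app s t`. The choice of `t` is harmless,
  -- because the value of `app s t` at a pointed ring depends only on the value of `t` there.
  obtain ⟨τ, hτ⟩ := exists_algHom_points
    (fun (x : FreeOp 𝒱) (s : S) => (mk (app s (mk_surjective x).choose) : FreeOp 𝒱))
    (PointedOp 𝒱) PointedOp.R evalHom (fun _ _ => evalHom_separates)
    (fun X => X.ρ.comp (evalHom X)) (fun X x s => by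
      conv_rhs => rw [← (mk_surjective x).choose_spec]
      simp [evalHom_mk, eval])
  have hom (X) : IsOpHom τ X.ρ (evalHom X) := isOpHom_iff.2 fun x s => by
    rw [hτ]
    conv_rhs => rw [← (mk_surjective x).choose_spec]
    simp [evalHom_mk, eval]
  -- The evaluations are jointly injective homomorphisms into members of the class, so the ring of
  -- values belongs to the class.
  refine ⟨τ, mk gen, h𝒱.separated _ _ fun x y h => evalHom_separates fun X =>
    h X.R X.ρ _ X.mem (hom X), fun R _ _ ρ hρ r => ⟨evalHom ⟨R, ρ, hρ, r⟩, hom _, evalHom_mk _ _⟩,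
    fun R _ _ ρ hρ h h' hh hh' he => AlgHom.ext fun x => ?_⟩
  have key (t : OpTerm k S) : mk (𝒱 := 𝒱) t = match t with
      | gen => mk gen
      | const c => algebraMap k _ c
      | add s t => mk s + mk t
      | mul s t => mk s * mk t
      | app s t => τ (mk t) s := by
    refine evalHom_separates fun X => ?_
    cases t <;> simp [evalHom_mk, eval, (hom X).apply]
  obtain ⟨t, rfl⟩ := mk_surjective x
  induction t with
  | gen => exact he
  | const c => simp [key (const c)]
  | add s t h1 h2 => simp [key (add s t), h1, h2]
  | mul s t h1 h2 => simp [key (mul s t), h1, h2]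
  | app s t h => rw [key (app s t)]; simp [hh.apply, hh'.apply, h]

end

/-! ## The plethory structure on a free ring with operations -/

namespace IsFreeOn

variable {k S T : Type u} [CommRing k] [CommRing S] [Algebra k S] [Biring k S]
  [CommRing T] [Algebra k T] {𝒱 : OpPred k S} {τ : T →ₐ[k] Points k S T} {e : T}

section Lift

variable {R : Type u} [CommRing R] [Algebra k R] {ρ : R →ₐ[k] Points k S R}

/-- The homomorphism of rings with operations that maps the generator to `r`. -/
def lift (hT : IsFreeOn 𝒱 τ e) (hρ : 𝒱 R ρ) (r : R) : T →ₐ[k] R :=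
  (hT.exists_lift R ρ hρ r).choose

theorem isOpHom_lift (hT : IsFreeOn 𝒱 τ e) (hρ : 𝒱 R ρ) (r : R) :
    IsOpHom τ ρ (hT.lift hρ r) := (hT.exists_lift R ρ hρ r).choose_spec.1

@[simp]
theorem lift_e (hT : IsFreeOn 𝒱 τ e) (hρ : 𝒱 R ρ) (r : R) : hT.lift hρ r e = r :=
  (hT.exists_lift R ρ hρ r).choose_spec.2

theorem eq_lift (hT : IsFreeOn 𝒱 τ e) (hρ : 𝒱 R ρ) {r : R} {h : T →ₐ[k] R}
    (hh : IsOpHom τ ρ h) (he : h e = r) : h = hT.lift hρ r :=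
  hT.hom_ext R ρ hρ _ _ hh (hT.isOpHom_lift hρ r) (by simp [he])

/-- Both sides are homomorphisms that take `e` to `h r`. Associativity of composition and the
compatibility of composition with the co-operations are instances of this. -/
theorem lift_natural {R' : Type u} [CommRing R'] [Algebra k R'] {ρ' : R' →ₐ[k] Points k S R'}
    (hT : IsFreeOn 𝒱 τ e) (hρ : 𝒱 R ρ) (hρ' : 𝒱 R' ρ') {h : R →ₐ[k] R'} (hh : IsOpHom ρ ρ' h)
    (r : R) (t : T) : h (hT.lift hρ r t) = hT.lift hρ' (h r) t := by
  rw [← hT.eq_lift hρ' (hh.comp (hT.isOpHom_lift hρ r)) (by simp)]; rfl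

end Lift

variable (h𝒱 : IsOpVariety 𝒱) (hT : IsFreeOn 𝒱 τ e)

include h𝒱 hT

theorem mem_tensor : 𝒱 (T ⊗[k] T) (tensorOp τ τ) := h𝒱.tensor _ _ _ _ hT.mem hT.mem

/-- The co-operations on a free ring with operations. -/
abbrev coring : Coring k T where
  -- Each axiom below equates two homomorphisms of rings with operations, so it reduces to an
  -- identity between the images of `e`.
  coadd := hT.lift (hT.mem_tensor h𝒱) (e ⊗ₜ 1 + 1 ⊗ₜ e)
  cozero := hT.lift h𝒱.base 0
  coneg := hT.lift hT.mem (-e)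
  comul := hT.lift (hT.mem_tensor h𝒱) (e ⊗ₜ e)
  coone := hT.lift h𝒱.base 1
  coadd_coassoc := hT.hom_ext _ _ (h𝒱.tensor _ _ _ _ hT.mem (hT.mem_tensor h𝒱)) _ _
    ((isOpHom_assoc _ _ _).comp (((hT.isOpHom_lift _ _).tensorMap (.id _)).comp
      (hT.isOpHom_lift _ _)))
    (((IsOpHom.id _).tensorMap (hT.isOpHom_lift _ _)).comp (hT.isOpHom_lift _ _))
    (by simp [TensorProduct.add_tmul, TensorProduct.tmul_add, Algebra.TensorProduct.one_def,
      add_assoc])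
  coadd_cocomm := hT.hom_ext _ _ (hT.mem_tensor h𝒱) _ _
    ((isOpHom_comm _ _).comp (hT.isOpHom_lift _ _)) (hT.isOpHom_lift _ _) (by simp [add_comm])
  coadd_counit := hT.hom_ext _ _ hT.mem _ _
    ((((isOpHom_ofId _).comp (hT.isOpHom_lift _ _)).productMap (.id _)).comp (hT.isOpHom_lift _ _))
    (.id _) (by simp)
  coadd_antipode := hT.hom_ext _ _ hT.mem _ _
    (((hT.isOpHom_lift _ _).productMap (.id _)).comp (hT.isOpHom_lift _ _))
    ((isOpHom_ofId _).comp (hT.isOpHom_lift _ _)) (by simp)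
  comul_coassoc := hT.hom_ext _ _ (h𝒱.tensor _ _ _ _ hT.mem (hT.mem_tensor h𝒱)) _ _
    ((isOpHom_assoc _ _ _).comp (((hT.isOpHom_lift _ _).tensorMap (.id _)).comp
      (hT.isOpHom_lift _ _)))
    (((IsOpHom.id _).tensorMap (hT.isOpHom_lift _ _)).comp (hT.isOpHom_lift _ _))
    (by simp)
  comul_cocomm := hT.hom_ext _ _ (hT.mem_tensor h𝒱) _ _
    ((isOpHom_comm _ _).comp (hT.isOpHom_lift _ _)) (hT.isOpHom_lift _ _) (by simp)
  comul_counit := hT.hom_ext _ _ hT.mem _ _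
    ((((isOpHom_ofId _).comp (hT.isOpHom_lift _ _)).productMap (.id _)).comp (hT.isOpHom_lift _ _))
    (.id _) (by simp)
  codistrib := hT.hom_ext _ _ (h𝒱.tensor _ _ _ _ hT.mem (hT.mem_tensor h𝒱)) _ _
    (((IsOpHom.id _).tensorMap (hT.isOpHom_lift _ _)).comp (hT.isOpHom_lift _ _))
    (((((IsOpHom.id _).tensorMap (isOpHom_includeLeft _ _)).comp (hT.isOpHom_lift _ _)).productMap
      (((IsOpHom.id _).tensorMap (isOpHom_includeRight _ _)).comp (hT.isOpHom_lift _ _))).comp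
      (hT.isOpHom_lift _ _))
    (by simp [TensorProduct.tmul_add])

section

variable {R : Type u} [CommRing R] [Algebra k R] {ρ : R →ₐ[k] Points k S R} (hρ : 𝒱 R ρ)

/-- The operations of the free ring `T` on a ring in the class. -/
abbrev actRingHom :
    letI := hT.coring h𝒱
    R →+* Points k T R :=
  letI := hT.coring h𝒱
  -- The sum of the points `lift r` and `lift s` is again a homomorphism of rings with operations
  -- and takes `e` to `r + s`, so it is `lift (r + s)`. The other laws are similar.
  { toFun := fun r => Points.ofAlgHom (hT.lift hρ r)
    map_zero' := (hT.eq_lift hρ ((isOpHom_ofId _).comp (hT.isOpHom_lift h𝒱.base 0)) (by simp)).symm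
    map_one' := (hT.eq_lift hρ ((isOpHom_ofId _).comp (hT.isOpHom_lift h𝒱.base 1)) (by simp)).symm
    map_add' := fun r s => (hT.eq_lift hρ (((hT.isOpHom_lift hρ r).productMap
      (hT.isOpHom_lift hρ s)).comp (hT.isOpHom_lift (hT.mem_tensor h𝒱) _)) (by simp)).symm
    map_mul' := fun r s => (hT.eq_lift hρ (((hT.isOpHom_lift hρ r).productMap
      (hT.isOpHom_lift hρ s)).comp (hT.isOpHom_lift (hT.mem_tensor h𝒱) _)) (by simp)).symm }

end

/-- The biring structure on a free ring with operations. -/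
abbrev biring : Biring k T :=
  letI := hT.coring h𝒱
  -- `β(c)` is evaluation at `c` in the base ring; for this the base ring must belong to the class.
  { colin := hT.actRingHom h𝒱 h𝒱.base }

section

variable {R R' : Type u} [CommRing R] [Algebra k R] {ρ : R →ₐ[k] Points k S R} (hρ : 𝒱 R ρ)
  [CommRing R'] [Algebra k R'] {ρ' : R' →ₐ[k] Points k S R'} (hρ' : 𝒱 R' ρ')

/-- The operations of the free ring `T` on a ring in the class. -/
abbrev actAlgHom :
    letI := hT.biring h𝒱
    R →ₐ[k] Points k T R :=
  letI := hT.biring h𝒱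
  { hT.actRingHom h𝒱 hρ with
    commutes' := fun c => (hT.eq_lift hρ
      ((isOpHom_ofId _).comp (hT.isOpHom_lift h𝒱.base c)) (by simp)).symm }

/-- The inclusions of the two factors respect the operations from `S`, so they commute with `lift`;
and the factors generate. -/
theorem tensorOp_actAlgHom :
    letI := hT.biring h𝒱
    tensorOp (hT.actAlgHom h𝒱 hρ) (hT.actAlgHom h𝒱 hρ') =
      hT.actAlgHom h𝒱 (h𝒱.tensor _ _ _ _ hρ hρ') := by
  let _ := hT.biring h𝒱
  refine tensor_hom_ext (fun r => ?_) (fun r => ?_)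
  · rw [tensorOp_tmul_one]
    exact Points.ext fun t => hT.lift_natural hρ (h𝒱.tensor _ _ _ _ hρ hρ') (isOpHom_includeLeft _ _) r t
  · rw [tensorOp_one_tmul]
    exact Points.ext fun t => hT.lift_natural hρ' (h𝒱.tensor _ _ _ _ hρ hρ') (isOpHom_includeRight _ _) r t

end

/-- This turns `s ∘ Δ(r)` into evaluation at `Δ(r)`, so that `lift_natural` for `Δ` shows that
composition is a map of birings. -/
theorem compTensor_act (z : T ⊗[k] T) :
    letI := hT.biring h𝒱
    compTensor (hT.actAlgHom h𝒱 hT.mem) z =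
      Points.ofAlgHom (hT.lift (hT.mem_tensor h𝒱) z) :=
  let _ := hT.biring h𝒱
  DFunLike.congr_fun (hT.tensorOp_actAlgHom h𝒱 hT.mem hT.mem) z

/-- The plethory structure on a free ring with operations. -/
abbrev plethory : Plethory k T :=
  letI := hT.biring h𝒱
  -- `α ∘ β` is the value at `α` of the homomorphism with `e ↦ β`.
  { compHom := hT.actAlgHom h𝒱 hT.mem
    compHom_isBiringComp :=
      { coadd := fun s r => by
          rw [hT.compTensor_act h𝒱]
          exact hT.lift_natural hT.mem (hT.mem_tensor h𝒱) (hT.isOpHom_lift _ _) r s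
        comul := fun s r => by
          rw [hT.compTensor_act h𝒱]
          exact hT.lift_natural hT.mem (hT.mem_tensor h𝒱) (hT.isOpHom_lift _ _) r s
        colin := fun c s r =>
          hT.lift_natural hT.mem h𝒱.base (hT.isOpHom_lift h𝒱.base c) r s }
    e := e
    coadd_e := hT.lift_e _ _
    comul_e := hT.lift_e _ _
    colin_e := hT.lift_e h𝒱.base
    comp_assoc := fun α β γ =>
      hT.lift_natural hT.mem hT.mem (hT.isOpHom_lift hT.mem γ) β α
    e_comp := hT.lift_e hT.mem
    comp_e := fun α => by
      change hT.lift hT.mem e α = α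
      exact (DFunLike.congr_fun (hT.eq_lift hT.mem (.id τ) rfl) α).symm }

/-- The action of the plethory `T` on a ring in the class. -/
abbrev action {R : Type u} [CommRing R] [Algebra k R] {ρ : R →ₐ[k] Points k S R} (hρ : 𝒱 R ρ) :
    letI := hT.plethory h𝒱
    PAction k T R :=
  letI := hT.plethory h𝒱
  { actHom := hT.actAlgHom h𝒱 hρ
    comp_act := fun α β r =>
      hT.lift_natural hT.mem hρ (hT.isOpHom_lift hρ r) β α
    e_act := hT.lift_e hρ }

end IsFreeOn

/-! ## Pointed birings with a right action of a plethory -/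

section

variable {k : Type*} [CommRing k]

variable {P S : Type*} [CommRing P] [Algebra k P] [Plethory k P] [CommRing S] [Algebra k S]
  [Biring k S]

section

variable (k P) in
/-- The evaluation `Ring_k(P, A) → A` at the unit `e` of a plethory. -/
def Points.evalUnit (A : Type*) [CommRing A] [Algebra k A] : Points k P A →ₐ[k] A where
  toFun x := x (Plethory.e k)
  map_one' := by
    -- The counits are not among the formulas for `e`; their values come from `β(1)` here and from
    -- `β(0)` below.
    have := DFunLike.congr_fun (map_one (Biring.colin (k := k) (S := P))) (Plethory.e k)
    rw [Plethory.colin_e] at this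
    exact (congrArg (algebraMap k A) this).symm.trans (map_one _)
  map_zero' := by
    have := DFunLike.congr_fun (map_zero (Biring.colin (k := k) (S := P))) (Plethory.e k)
    rw [Plethory.colin_e] at this
    exact (congrArg (algebraMap k A) this).symm.trans (map_zero _)
  map_add' x y := by simp [Points.add_apply, Plethory.coadd_e]
  map_mul' x y := by simp [Points.mul_apply, Plethory.comul_e]
  commutes' c := by rw [Points.algebraMap_apply, Plethory.colin_e]

@[simp]
theorem Points.evalUnit_apply {A : Type*} [CommRing A] [Algebra k A] (x : Points k P A) :
    Points.evalUnit k P A x = x (Plethory.e k) := rfl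

variable {R B : Type*} [CommRing R] [Algebra k R] [Biring k R] [CommRing B] [Algebra k B]
  [Biring k B]

/-- A map of birings `S ⊙ R → B` induces maps `Ring_k(B, A) → Ring_k(R, Ring_k(S, A))`. -/
def IsBiringComp.curry {ρ : R →ₐ[k] Points k S B} (hρ : IsBiringComp ρ)
    (A : Type*) [CommRing A] [Algebra k A] :
    Points k B A →ₐ[k] Points k R (Points k S A) :=
  let F : Points k B A → Points k R (Points k S A) :=
    fun y => Points.ofAlgHom ((Points.map S y.toAlgHom).comp ρ)
  have hc : ∀ c : k, F (algebraMap k _ c) = algebraMap k _ c := fun c =>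
    Points.ext fun r => Points.ext fun s => congrArg (algebraMap k A) (hρ.colin c s r)
  have key (y z : Points k B A) : (Points.map S (productMap y.toAlgHom z.toAlgHom)).comp
      (compTensor ρ) = productMap (F y).toAlgHom (F z).toAlgHom := by
    refine tensor_hom_ext (fun r => ?_) (fun r => ?_) <;>
    · ext s
      simp [compTensor, F]
  { toFun := F
    map_zero' := by simpa using hc 0
    map_one' := by simpa using hc 1
    map_add' := fun y z => Points.ext fun r => by
      rw [Points.add_apply, ← key]
      exact Points.ext fun s => congrArg (productMap y.toAlgHom z.toAlgHom) (hρ.coadd s r)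
    map_mul' := fun y z => Points.ext fun r => by
      rw [Points.mul_apply, ← key]
      exact Points.ext fun s => congrArg (productMap y.toAlgHom z.toAlgHom) (hρ.comul s r)
    commutes' := hc }

@[simp]
theorem IsBiringComp.curry_apply {ρ : R →ₐ[k] Points k S B} (hρ : IsBiringComp ρ)
    {A : Type*} [CommRing A] [Algebra k A] (x : Points k B A) (r : R) (s : S) :
    hρ.curry A x r s = x (ρ r s) := rfl

end

/-- The operations of `S` on `R` form an action of the pointed `k[e]`-`P`-biring `g : P → S`. -/
structure IsPointedOp (ρ : P →ₐ[k] Points k S S) (g : P →ₐ[k] S) {R : Type*} [CommRing R]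
    [Algebra k R] (σ : R →ₐ[k] Points k S R) : Prop where
  unit : ∀ r : R, σ r (g (Plethory.e k)) = r
  act : ∀ (p : P) (s : S) (r : R), σ r (ρ p s) = σ (σ r (g p)) s

/-- A pointed `k[e]`-`P`-biring: the map `g : P → S` is a map of birings that respects the right
actions of `P`. -/
structure IsPointed (ρ : P →ₐ[k] Points k S S) (g : P →ₐ[k] S) : Prop where
  isBiringComp : IsBiringComp ρ
  isBiringHom : IsBiringHom k k g
  map_comp : ∀ p q : P, g (comp k p q) = ρ q (g p)

variable {ρ : P →ₐ[k] Points k S S} {g : P →ₐ[k] S}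
  {R R' : Type*} [CommRing R] [Algebra k R] [CommRing R'] [Algebra k R']
  {σ : R →ₐ[k] Points k S R} {σ' : R' →ₐ[k] Points k S R'}

theorem IsPointedOp.unit_eq_of_isOpHom (hσ : IsPointedOp ρ g σ) {h : R →ₐ[k] R'}
    (hh : IsOpHom σ σ' h) (r : R) : σ' (h r) (g (Plethory.e k)) = h r := by
  rw [← hh.apply, hσ.unit]

theorem IsPointedOp.act_eq_of_isOpHom (hσ : IsPointedOp ρ g σ) {h : R →ₐ[k] R'}
    (hh : IsOpHom σ σ' h) (p : P) (s : S) (r : R) :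
    σ' (h r) (ρ p s) = σ' (σ' (h r) (g p)) s := by
  rw [← hh.apply, hσ.act, hh.apply, hh.apply]

/-- In this form the axioms equate algebra homomorphisms out of `R`. So they hold automatically on
the base ring, and on a tensor product they need only be checked on the two factors. -/
theorem IsPointed.isPointedOp_iff (hg : IsPointed ρ g) (σ : R →ₐ[k] Points k S R) :
    IsPointedOp ρ g σ ↔
      (Points.evalUnit k P R).comp ((Points.comap hg.isBiringHom R).comp σ) = AlgHom.id k R ∧
      (hg.isBiringComp.curry R).comp σ =
        (Points.map P σ).comp ((Points.comap hg.isBiringHom R).comp σ) :=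
  ⟨fun h => ⟨AlgHom.ext h.unit,
    AlgHom.ext fun r => Points.ext fun p => Points.ext fun s => h.act p s r⟩,
   fun h => ⟨DFunLike.congr_fun h.1,
    fun p s r => DFunLike.congr_fun (DFunLike.congr_fun (DFunLike.congr_fun h.2 r) p) s⟩⟩

theorem IsPointed.isPointedOp_base (hg : IsPointed ρ g) :
    IsPointedOp ρ g (Algebra.ofId k (Points k S k)) :=
  (hg.isPointedOp_iff _).2 ⟨Subsingleton.elim _ _, Subsingleton.elim _ _⟩

theorem IsPointed.isPointedOp_tensor (hg : IsPointed ρ g) (hσ : IsPointedOp ρ g σ)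
    (hσ' : IsPointedOp ρ g σ') : IsPointedOp ρ g (tensorOp σ σ') := by
  refine (hg.isPointedOp_iff _).2 ⟨tensor_hom_ext (fun r => ?_) (fun r => ?_),
    tensor_hom_ext (fun r => ?_) (fun r => ?_)⟩
  · exact hσ.unit_eq_of_isOpHom (isOpHom_includeLeft σ σ') r
  · exact hσ'.unit_eq_of_isOpHom (isOpHom_includeRight σ σ') r
  · exact Points.ext fun p => Points.ext fun s =>
      hσ.act_eq_of_isOpHom (isOpHom_includeLeft σ σ') p s r
  · exact Points.ext fun p => Points.ext fun s =>
      hσ'.act_eq_of_isOpHom (isOpHom_includeRight σ σ') p s r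

theorem isBiringHom_id {S : Type*} [CommRing S] [Algebra k S] [Biring k S] :
    IsBiringHom k k (AlgHom.id k S) := by
  have : productMap (((includeLeft : S →ₐ[k] S ⊗[k] S).restrictScalars k).comp (AlgHom.id k S))
      (((includeRight : S →ₐ[k] S ⊗[k] S).restrictScalars k).comp (AlgHom.id k S)) =
      AlgHom.id k (S ⊗[k] S) := by
    ext <;> simp
  exact ⟨fun p => by rw [this]; rfl, fun p => by rw [this]; rfl, fun c p => rfl⟩

-- With `S = P` and `g = id`, actions of a plethory become pointed operations, and actions on the
-- base ring and on tensor products come for free.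
variable (k P) in
theorem isPointed_self : IsPointed (Plethory.compHom (k := k) (P := P)) (AlgHom.id k P) :=
  ⟨Plethory.compHom_isBiringComp, isBiringHom_id, fun _ _ => rfl⟩

theorem PAction.isPointedOp (a : PAction k P R) :
    IsPointedOp (Plethory.compHom (k := k) (P := P)) (AlgHom.id k P) a.actHom :=
  ⟨a.e_act, fun p s r => a.comp_act s p r⟩

/-- Operations from a plethory that satisfy the axioms of an action. -/
def IsPointedOp.toPAction {σ : R →ₐ[k] Points k P R}
    (hσ : IsPointedOp (Plethory.compHom (k := k) (P := P)) (AlgHom.id k P) σ) : PAction k P R where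
  actHom := σ
  comp_act α β r := hσ.act β α r
  e_act := hσ.unit

variable (k P) in
/-- The action of a plethory on the base ring. -/
def PAction.base : PAction k P k := (isPointed_self k P).isPointedOp_base.toPAction

/-- The action of a plethory on a tensor product. -/
def PAction.tensor (a : PAction k P R) (b : PAction k P R') : PAction k P (R ⊗[k] R') :=
  ((isPointed_self k P).isPointedOp_tensor a.isPointedOp b.isPointedOp).toPAction

theorem PAction.isOpHom {a : PAction k P R} {b : PAction k P R'} {h : R →ₐ[k] R'}
    (H : a.IsEquivariant b h) : IsOpHom a.actHom b.actHom h :=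
  isOpHom_iff.2 fun r s => H s r

theorem tensorOp_comap {S' : Type*} [CommRing S'] [Algebra k S'] [Biring k S'] {j : S' →ₐ[k] S}
    (hj : IsBiringHom k k j) (z : R ⊗[k] R') (s : S') :
    tensorOp ((Points.comap hj R).comp σ) ((Points.comap hj R').comp σ') z s =
      tensorOp σ σ' z (j s) := by
  have : tensorOp ((Points.comap hj R).comp σ) ((Points.comap hj R').comp σ') =
      (Points.comap hj (R ⊗[k] R')).comp (tensorOp σ σ') := by
    refine tensor_hom_ext (fun r => ?_) (fun r => ?_)
    · rw [tensorOp_tmul_one, AlgHom.comp_apply, AlgHom.comp_apply, tensorOp_tmul_one]; rfl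
    · rw [tensorOp_one_tmul, AlgHom.comp_apply, AlgHom.comp_apply, tensorOp_one_tmul]; rfl
  rw [this]; rfl

/-- The action of `P` on a `P'`-ring, where `P → P'` is a morphism of plethories, is a pointed
action along `S → P'`. -/
theorem IsPointedMap.isPointedOp {X : Type*} [CommRing X] [Algebra k X] [Plethory k X]
    {φ : P →ₐ[k] X} {i : S →ₐ[k] X} (h : IsPointedMap ρ g φ i) (a : PAction k X R) :
    IsPointedOp ρ g ((Points.comap h.isBiringHom R).comp a.actHom) where
  unit r := by
    have : i (g (Plethory.e k)) = Plethory.e k := by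
      rw [← AlgHom.comp_apply, h.comp_eq, h.isPlethoryHom.map_e]
    simp [this, a.e_act]
  act p s r := by
    have : i (g p) = φ p := by rw [← h.comp_eq]; rfl
    simp [h.map_act, a.comp_act, this]

end

/-! ### The co-operations of a plethory are equivariant -/

section

variable {k P : Type*} [CommRing k] [CommRing P] [Algebra k P] [Plethory k P]

variable (k P) in
theorem isEquivariant_coadd : (PAction.self k P).IsEquivariant
    ((PAction.self k P).tensor (PAction.self k P)) Coring.coadd :=
  fun α r => Plethory.compHom_isBiringComp.coadd α r

variable (k P) in
theorem isEquivariant_comul : (PAction.self k P).IsEquivariant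
    ((PAction.self k P).tensor (PAction.self k P)) Coring.comul :=
  fun α r => Plethory.compHom_isBiringComp.comul α r

variable (P) in
theorem isEquivariant_colin (c : k) : (PAction.self k P).IsEquivariant
    (PAction.base k P) (Biring.colin c : Points k P k).toAlgHom :=
  fun α r => Plethory.compHom_isBiringComp.colin c α r

/-- Right composition with an element. -/
theorem isEquivariant_actHom {R : Type*} [CommRing R] [Algebra k R] (a : PAction k P R) (r : R) :
    (PAction.self k P).IsEquivariant a (a.actHom r).toAlgHom :=
  fun α β => a.comp_act α β r

/-- Equivariant maps out of a plethory are determined by the image of `e`. -/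
theorem PAction.hom_ext {R : Type*} [CommRing R] [Algebra k R] {a : PAction k P R}
    {h h' : P →ₐ[k] R} (hh : (PAction.self k P).IsEquivariant a h)
    (hh' : (PAction.self k P).IsEquivariant a h') (he : h (Plethory.e k) = h' (Plethory.e k)) :
    h = h' := by
  ext α
  have (h : P →ₐ[k] R) (hh : (PAction.self k P).IsEquivariant a h) :
      h α = a.act α (h (Plethory.e k)) := by
    rw [← hh]; exact congrArg h (Plethory.comp_e α).symm
  rw [this h hh, this h' hh', he]

/-- The structure maps of the plethory `T` are compatible with operations from `S`. -/
structure IsPlethoryOp {S T : Type*} [CommRing S] [Algebra k S] [Biring k S] [CommRing T]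
    [Algebra k T] [Plethory k T] (τ : T →ₐ[k] Points k S T) : Prop where
  coadd : IsOpHom τ (tensorOp τ τ) Coring.coadd
  comul : IsOpHom τ (tensorOp τ τ) Coring.comul
  colin : ∀ c : k, IsOpHom τ (Algebra.ofId k (Points k S k))
    (Biring.colin c : Points k T k).toAlgHom
  comp : ∀ β : T, IsOpHom τ τ (Plethory.compHom β).toAlgHom

/-- The plethory axioms express that the structure maps of `T` are equivariant under all of `T`, in
particular under the operations `i s`. -/
theorem isPlethoryOp_comap {S T : Type*} [CommRing S] [Algebra k S] [Biring k S] [CommRing T]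
    [Algebra k T] [Plethory k T] {i : S →ₐ[k] T} (hi : IsBiringHom k k i) :
    IsPlethoryOp ((Points.comap hi T).comp Plethory.compHom) where
  coadd := isOpHom_iff.2 fun r s => by
    rw [tensorOp_comap]
    exact Plethory.compHom_isBiringComp.coadd (i s) r
  comul := isOpHom_iff.2 fun r s => by
    rw [tensorOp_comap]
    exact Plethory.compHom_isBiringComp.comul (i s) r
  colin c := isOpHom_iff.2 fun r s =>
    (Plethory.compHom_isBiringComp.colin c (i s) r).trans (hi.colin _ s)
  comp β := isOpHom_iff.2 fun r s => Plethory.comp_assoc (i s) r β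

/-- A map of rings with operations between plethories that respects the units is a morphism of
plethories, if maps of rings with operations are determined by their values at the unit. -/
theorem IsPlethoryOp.isPlethoryHom {S T X : Type*} [CommRing S] [Algebra k S] [Biring k S]
    [CommRing T] [Algebra k T] [Plethory k T] [CommRing X] [Algebra k X] [Plethory k X]
    {τ : T →ₐ[k] Points k S T} (hτ : IsPlethoryOp τ) {σ : X →ₐ[k] Points k S X}
    (hσ : IsPlethoryOp σ) {h : T →ₐ[k] X} (hh : IsOpHom τ σ h)
    (he : h (Plethory.e k) = Plethory.e k)
    (ext₁ : ∀ a b : T →ₐ[k] X, IsOpHom τ σ a → IsOpHom τ σ b →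
      a (Plethory.e k) = b (Plethory.e k) → a = b)
    (ext₂ : ∀ a b : T →ₐ[k] X ⊗[k] X, IsOpHom τ (tensorOp σ σ) a → IsOpHom τ (tensorOp σ σ) b →
      a (Plethory.e k) = b (Plethory.e k) → a = b)
    (ext₀ : ∀ a b : T →ₐ[k] k, IsOpHom τ (Algebra.ofId k (Points k S k)) a →
      IsOpHom τ (Algebra.ofId k (Points k S k)) b →
      a (Plethory.e k) = b (Plethory.e k) → a = b) :
    IsPlethoryHom k k h := by
  have hm : productMap (((includeLeft : X →ₐ[k] X ⊗[k] X).restrictScalars k).comp h)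
      (((includeRight : X →ₐ[k] X ⊗[k] X).restrictScalars k).comp h) =
      Algebra.TensorProduct.map h h := by
    ext <;> simp
  -- Each compatibility equates two maps out of `T` that respect the operations and agree at the
  -- unit.
  refine ⟨⟨fun p => ?_, fun p => ?_, fun c p => ?_⟩, he, fun α β => ?_⟩
  · rw [hm]
    exact DFunLike.congr_fun (ext₂ (Coring.coadd.comp h)
      ((Algebra.TensorProduct.map h h).comp Coring.coadd) (hσ.coadd.comp hh)
      ((hh.tensorMap hh).comp hτ.coadd) (by simp [he, Plethory.coadd_e])) p
  · rw [hm]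
    exact DFunLike.congr_fun (ext₂ (Coring.comul.comp h)
      ((Algebra.TensorProduct.map h h).comp Coring.comul) (hσ.comul.comp hh)
      ((hh.tensorMap hh).comp hτ.comul) (by simp [he, Plethory.comul_e])) p
  · exact DFunLike.congr_fun (ext₀ ((Biring.colin c : Points k X k).toAlgHom.comp h)
      (Biring.colin c : Points k T k).toAlgHom ((hσ.colin c).comp hh) (hτ.colin c)
      (by simp [he, Plethory.colin_e])) p
  · exact (DFunLike.congr_fun (ext₁ ((Plethory.compHom (h β)).toAlgHom.comp h)
      (h.comp (Plethory.compHom β).toAlgHom) ((hσ.comp _).comp hh) (hh.comp (hτ.comp _))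
      (by simp [he, Plethory.e_comp])) α).symm

end

/-! ## The free plethory on a pointed biring -/

section

variable {k : Type*} [CommRing k]

theorem IsBiringHom.trans {P P' P'' : Type*} [CommRing P] [Algebra k P] [Biring k P] [CommRing P']
    [Algebra k P'] [Biring k P'] [CommRing P''] [Algebra k P''] [Biring k P''] {g : P' →ₐ[k] P''}
    {f : P →ₐ[k] P'} (hg : IsBiringHom k k g) (hf : IsBiringHom k k f) :
    IsBiringHom k k (g.comp f) where
  coadd p := by
    simp only [AlgHom.comp_apply]
    rw [hg.coadd, hf.coadd, ← AlgHom.comp_apply, productMap_hom_comp]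
    rfl
  comul p := by
    simp only [AlgHom.comp_apply]
    rw [hg.comul, hf.comul, ← AlgHom.comp_apply, productMap_hom_comp]
    rfl
  colin c p := (hg.colin c (f p)).trans (hf.colin c p)

variable {S R : Type*} [CommRing S] [Algebra k S] [Biring k S] [CommRing R] [Algebra k R]

theorem exists_op_subalgebra (σ : R →ₐ[k] Points k S R) (U : Subalgebra k R)
    (hU : ∀ r ∈ U, ∀ s, σ r s ∈ U) : ∃ σ' : U →ₐ[k] Points k S U, IsOpHom σ' σ U.val := by
  obtain ⟨σ', h⟩ := exists_algHom_points (k := k) (fun (x : U) (s : S) => (⟨σ x s, hU _ x.2 s⟩ : U))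
    Unit (fun _ => R) (fun _ => U.val) (fun x y h => Subtype.ext (h ()))
    (fun _ => σ.comp U.val) (fun _ _ _ => rfl)
  exact ⟨σ', isOpHom_iff.2 fun r s => by rw [h]; rfl⟩

end

/-! ### Classes of pointed operations and their free objects -/

section

variable {k P S : Type u} [CommRing k] [CommRing P] [Algebra k P] [Plethory k P] [CommRing S]
  [Algebra k S] [Biring k S] {ρ : P →ₐ[k] Points k S S} {g : P →ₐ[k] S}

variable (ρ g) in
/-- The class of rings with an action of a pointed biring such that the underlying ring satisfies
`X`. -/
def pointedOps (X : ∀ (R : Type u) [CommRing R] [Algebra k R], Prop) : OpPred k S :=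
  fun R _ _ σ => IsPointedOp ρ g σ ∧ X R

/-- The axioms of a pointed action are equations, hence inherited by subobjects of products; the
hypotheses on `X` demand the corresponding closure properties of `X`. -/
theorem IsPointed.isOpVariety (hg : IsPointed ρ g)
    {X : ∀ (R : Type u) [CommRing R] [Algebra k R], Prop} (hk : X k)
    (ht : ∀ (R R' : Type u) [CommRing R] [Algebra k R] [CommRing R'] [Algebra k R'],
      X R → X R' → X (R ⊗[k] R'))
    (hs : ∀ (T : Type u) [CommRing T] [Algebra k T], (∀ x y : T, (∀ (R : Type u) [CommRing R]
      [Algebra k R] (h : T →ₐ[k] R), X R → h x = h y) → x = y) → X T) :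
    IsOpVariety (pointedOps ρ g X) where
  base := ⟨hg.isPointedOp_base, hk⟩
  tensor R R' _ _ _ _ σ σ' h h' := ⟨hg.isPointedOp_tensor h.1 h'.1, ht R R' h.2 h'.2⟩
  separated T _ _ τ H := by
    refine ⟨⟨fun r => H _ _ fun R _ _ σ h hσ hh => ?_, fun p s r => H _ _ fun R _ _ σ h hσ hh => ?_⟩,
      hs T fun x y h => H x y fun R _ _ σ h' hσ _ => h R h' hσ.2⟩
    · rw [hh.apply, hσ.1.unit]
    · simp only [hh.apply, hσ.1.act]

variable {𝒱 : OpPred k S} {T : Type u} [CommRing T] [Algebra k T] {τ : T →ₐ[k] Points k S T} {e : T}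

theorem IsOpVariety.mem_of_injective (h𝒱 : IsOpVariety 𝒱) {R U : Type u} [CommRing R] [Algebra k R]
    [CommRing U] [Algebra k U] {σ : R →ₐ[k] Points k S R} (hσ : 𝒱 R σ) {σ' : U →ₐ[k] Points k S U}
    {j : U →ₐ[k] R} (hj : IsOpHom σ' σ j) (hinj : Function.Injective j) : 𝒱 U σ' :=
  h𝒱.separated _ _ fun _ _ h => hinj (h R σ j hσ hj)

/-- A subring of the free ring that contains the generator and is stable under the operations is
the whole ring. -/
theorem IsFreeOn.eq_top (hT : IsFreeOn 𝒱 τ e) (h𝒱 : IsOpVariety 𝒱) (U : Subalgebra k T)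
    (he : e ∈ U) (hU : ∀ r ∈ U, ∀ s, τ r s ∈ U) : U = ⊤ := by
  obtain ⟨σ, hσ⟩ := exists_op_subalgebra τ U hU
  have hm : 𝒱 U σ := h𝒱.mem_of_injective hT.mem hσ Subtype.val_injective
  -- The homomorphism `T → U` fixing the generator, followed by the inclusion, is the identity by
  -- freeness.
  have h := hT.hom_ext _ _ hT.mem (U.val.comp (hT.lift hm ⟨e, he⟩)) (.id k T)
    (hσ.comp (hT.isOpHom_lift _ _)) (.id τ) (by simp)
  refine eq_top_iff.2 fun t _ => ?_
  have ht := DFunLike.congr_fun h t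
  rw [AlgHom.id_apply] at ht
  rw [← ht]
  exact (hT.lift hm ⟨e, he⟩ t).2

namespace IsFreeOn

variable (h𝒱 : IsOpVariety 𝒱) (hT : IsFreeOn 𝒱 τ e)

/-- The map `s ↦ s ∘ e` from a biring to the free ring with operations. -/
def unitMap (_ : IsFreeOn 𝒱 τ e) : S →ₐ[k] T := (τ e).toAlgHom

theorem unitMap_apply (s : S) : hT.unitMap s = τ e s := rfl

theorem isPlethoryOp :
    letI := hT.plethory h𝒱
    IsPlethoryOp τ :=
  let _ := hT.plethory h𝒱
  ⟨hT.isOpHom_lift _ _, hT.isOpHom_lift _ _, fun c => hT.isOpHom_lift h𝒱.base c,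
    fun β => hT.isOpHom_lift hT.mem β⟩

/-- Since `Δ⁺` respects the operations, `Δ⁺(s ∘ e) = s ∘ (e ⊗ 1 + 1 ⊗ e)`, and an operation on a sum
is computed by the coaddition of `S`. The same argument works for `Δ^×` and `β`. -/
theorem isBiringHom_unitMap :
    letI := hT.plethory h𝒱
    IsBiringHom k k hT.unitMap := by
  let _ := hT.plethory h𝒱
  refine ⟨fun s => ?_, fun s => ?_, fun c s => ?_⟩
  · rw [unitMap_apply, (hT.isPlethoryOp h𝒱).coadd.apply]
    change tensorOp τ τ (hT.lift _ _ e) s = _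
    rw [lift_e, map_add, tensorOp_tmul_one, tensorOp_one_tmul]
    rfl
  · rw [unitMap_apply, (hT.isPlethoryOp h𝒱).comul.apply]
    change tensorOp τ τ (hT.lift _ _ e) s = _
    have : e ⊗ₜ[k] e = (e ⊗ₜ 1) * (1 ⊗ₜ e) := by simp
    rw [lift_e, this, map_mul, tensorOp_tmul_one, tensorOp_one_tmul]
    rfl
  · rw [unitMap_apply]
    refine ((hT.isPlethoryOp h𝒱).colin c).apply e s |>.trans ?_
    change Algebra.ofId k (Points k S k) (hT.lift h𝒱.base c e) s = _
    rw [lift_e]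
    rfl

theorem isPointedMap (hle : ∀ R [CommRing R] [Algebra k R] σ, 𝒱 R σ → IsPointedOp ρ g σ)
    (hg : IsPointed ρ g) :
    letI := hT.plethory h𝒱
    IsPointedMap ρ g (hT.unitMap.comp g) hT.unitMap := by
  let _ := hT.plethory h𝒱
  have hτ := hle _ _ hT.mem
  -- `(s ∘ e) ∘ t = s ∘ t`: left composition with an element coming from `S` is the corresponding
  -- operation.
  have hcomp (s : S) (t : T) : comp k (hT.unitMap s) t = τ t s := by
    change hT.lift hT.mem t (τ e s) = _
    rw [(hT.isOpHom_lift hT.mem t).apply, lift_e]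
  have hact (s : S) (p : P) : hT.unitMap (ρ p s) = comp k (hT.unitMap s) (hT.unitMap.comp g p) := by
    rw [hcomp, unitMap_apply, hτ.act]; rfl
  exact
    { isPlethoryHom :=
        { (hT.isBiringHom_unitMap h𝒱).trans hg.isBiringHom with
          map_e := hτ.unit e
          map_comp := fun p q => by rw [AlgHom.comp_apply, hg.map_comp, hact]; rfl }
      isBiringHom := hT.isBiringHom_unitMap h𝒱
      map_act := hact
      comp_eq := rfl }

theorem action_unitMap {R : Type u} [CommRing R] [Algebra k R] {σ : R →ₐ[k] Points k S R}
    (hσ : 𝒱 R σ) (r : R) (s : S) :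
    letI := hT.plethory h𝒱
    (hT.action h𝒱 hσ).actHom r (hT.unitMap s) = σ r s := by
  change hT.lift hσ r (τ e s) = _
  rw [(hT.isOpHom_lift hσ r).apply, lift_e]

theorem isPlethoryHom_lift {X : Type u} [CommRing X] [Algebra k X] [Plethory k X]
    {σ : X →ₐ[k] Points k S X} (hσ : 𝒱 X σ) (hX : IsPlethoryOp σ) :
    letI := hT.plethory h𝒱
    IsPlethoryHom k k (hT.lift hσ (Plethory.e k)) :=
  let _ := hT.plethory h𝒱
  (hT.isPlethoryOp h𝒱).isPlethoryHom hX (hT.isOpHom_lift hσ _) (hT.lift_e _ _)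
    (hT.hom_ext _ _ hσ) (hT.hom_ext _ _ (h𝒱.tensor _ _ _ _ hσ hσ)) (hT.hom_ext _ _ h𝒱.base)

/-- A competitor `X` carries operations from `S` by composition and lies in the class, which gives
`T → X` with `e ↦ e`. Conversely, since `s ∘ t` is the composite of the image of `s` with `t`, any
plethory map over `S` respects the operations, hence is this one. -/
theorem isFreePointed (hle : ∀ R [CommRing R] [Algebra k R] σ, 𝒱 R σ ↔ IsPointedOp ρ g σ)
    (hg : IsPointed ρ g) :
    letI := hT.plethory h𝒱
    IsFreePointed ρ g (hT.unitMap.comp g) hT.unitMap := by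
  let _ := hT.plethory h𝒱
  refine ⟨hT.isPointedMap h𝒱 (fun R _ _ σ => (hle R σ).1) hg, fun X _ _ _ φ' i' hX => ?_⟩
  have hσ : 𝒱 X ((Points.comap hX.isBiringHom X).comp Plethory.compHom) :=
    (hle _ _).2 (hX.isPointedOp (PAction.self k X))
  have hi : (hT.lift hσ (Plethory.e k)).comp hT.unitMap = i' := by
    ext s
    rw [AlgHom.comp_apply, unitMap_apply, (hT.isOpHom_lift hσ _).apply, lift_e]
    exact Plethory.comp_e (k := k) (i' s)
  refine ⟨hT.lift hσ (Plethory.e k), ⟨hT.isPlethoryHom_lift h𝒱 hσ (isPlethoryOp_comap _), ?_, hi⟩,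
    fun h ⟨hh, _, hhi⟩ => hT.eq_lift hσ (isOpHom_iff.2 fun t s => ?_) hh.map_e⟩
  · rw [← AlgHom.comp_assoc, hi, hX.comp_eq]
  · have : τ t s = comp k (hT.unitMap s) t := ((hT.action_unitMap h𝒱 hT.mem t s)).symm
    rw [this, hh.map_comp]
    exact congrArg (fun x => comp k x (h t)) (DFunLike.congr_fun hhi s)

end IsFreeOn

end

/-! ## Torsion-free modules -/

section

variable {O : Type*} [CommRing O] {m : Ideal O}

/-- If `m ^ (n + 1)` kills `x`, then `m` kills `b • x` for each `b ∈ m ^ n`. -/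
theorem isTorsionFreeAt_iff {M : Type*} [AddCommGroup M] [Module O M] :
    IsTorsionFreeAt m M ↔ ∀ x : M, (∀ a ∈ m, a • x = 0) → x = 0 := by
  refine ⟨fun h x hx => h x ⟨1, by simpa using hx⟩, fun h x ⟨n, hn⟩ => ?_⟩
  induction n with
  | zero => simpa using hn 1 (by simp)
  | succ n ih =>
    refine ih fun b hb => h _ fun a ha => ?_
    rw [smul_smul]
    exact hn _ (by rw [pow_succ']; exact Ideal.mul_mem_mul ha hb)

theorem IsTorsionFreeAt.of_injective {M N : Type*} [AddCommGroup M] [Module O M] [AddCommGroup N]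
    [Module O N] (hN : IsTorsionFreeAt m N) (j : M →ₗ[O] N) (hj : Function.Injective j) :
    IsTorsionFreeAt m M := fun x ⟨n, hn⟩ => hj <| by
  rw [map_zero]
  exact hN _ ⟨n, fun a ha => by rw [← map_smul, hn a ha, map_zero]⟩

theorem isTorsionFreeAt_self [IsDomain O] (hm : m ≠ ⊥) : IsTorsionFreeAt m O := by
  refine isTorsionFreeAt_iff.2 fun x hx => ?_
  obtain ⟨a, ha, ha0⟩ := Submodule.exists_mem_ne_zero_of_ne_bot hm
  exact (mul_eq_zero.1 (hx a ha)).resolve_left ha0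

variable (m) in
/-- The elements of a module that vanish after localization at `1 + m`. -/
def oneAddTorsion (M : Type*) [AddCommGroup M] [Module O M] : Submodule O M where
  carrier := {x | ∃ v : O, 1 - v ∈ m ∧ v • x = 0}
  zero_mem' := ⟨1, by simp⟩
  smul_mem' c x := fun ⟨v, hv, h⟩ => ⟨v, hv, by rw [smul_comm, h, smul_zero]⟩
  add_mem' := fun {x y} ⟨v, hv, hx⟩ ⟨w, hw, hy⟩ => by
    refine ⟨v * w, ?_, ?_⟩
    · have : 1 - v * w = (1 - v) + v * (1 - w) := by ring
      rw [this]
      exact add_mem hv (m.mul_mem_left _ hw)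
    · rw [smul_add, mul_smul v w y, hy, mul_comm v w, mul_smul w v x, hx, smul_zero, smul_zero,
        add_zero]

/-! ### Torsion over a Dedekind domain -/

variable [IsDedekindDomain O]

/-- A nonzero ideal contains a power of `m` after localization at `1 + m`. -/
theorem exists_mul_pow_le (m : Ideal O) (J : Ideal O) (hJ : J ≠ ⊥) :
    ∃ v : O, 1 - v ∈ m ∧ ∃ n : ℕ, ∀ a ∈ m ^ n, v * a ∈ J := by
  induction J using IsNoetherian.induction with
  | hgt J ih =>
  by_cases h : J ⊔ m = ⊤
  -- If `J` and `m` are coprime, some `v ∈ J` is congruent to `1`, and `n = 0` works.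
  · obtain ⟨v, hv, a, ha, hva⟩ := Submodule.mem_sup.1 ((Ideal.eq_top_iff_one _).1 h)
    exact ⟨v, by rwa [← hva, add_sub_cancel_left], 0, fun a _ => Ideal.mul_mem_right a J hv⟩
  -- Otherwise `J = p * J'` with a maximal ideal `p ⊇ m` and `J'` strictly larger than `J`. From `v
  -- m ^ n ⊆ J'` follows `v m ^ (n + 1) ⊆ m J' ⊆ p J'`.
  · obtain ⟨p, hp, hle⟩ := Ideal.exists_le_maximal _ h
    obtain ⟨J', rfl⟩ := Ideal.dvd_iff_le.2 (le_sup_left.trans hle)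
    have hJ' : J' ≠ ⊥ := by rintro rfl; exact hJ (Ideal.mul_bot p)
    have hlt : p * J' < J' := lt_of_le_of_ne Ideal.mul_le_right fun he =>
      hp.ne_top (by rw [← Ideal.one_eq_top]; exact mul_right_cancel₀ (b := J') hJ' (by simpa using he))
    obtain ⟨v, hv, n, hn⟩ := ih J' hlt hJ'
    refine ⟨v, hv, n + 1, fun a ha => ?_⟩
    rw [pow_succ'] at ha
    refine Submodule.mul_induction_on ha (fun b hb c hc => ?_) fun b c hb hc => ?_
    · rw [mul_left_comm]
      exact Ideal.mul_mem_mul (hle (Ideal.mem_sup_right hb)) (hn c hc)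
    · rw [mul_add]; exact add_mem hb hc

variable {M N : Type*} [AddCommGroup M] [Module O M] [AddCommGroup N] [Module O N]

/-- If `b x = 0` with `b ≠ 0`, then `(b)` contains `v m ^ n` with `v ≡ 1`, so `v x` is killed by `m
^ n` and vanishes. -/
theorem IsTorsionFreeAt.exists_smul_eq_zero (hM : IsTorsionFreeAt m M) {x : M}
    (hx : x ∈ Submodule.torsion O M) : x ∈ oneAddTorsion m M := by
  obtain ⟨b, hb⟩ := hx
  obtain ⟨v, hv, n, hn⟩ := exists_mul_pow_le m (Ideal.span {(b : O)})
    (by simp)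
  refine ⟨v, hv, hM _ ⟨n, fun a ha => ?_⟩⟩
  obtain ⟨c, hc⟩ := Ideal.mem_span_singleton'.1 (hn a ha)
  have hb' : (b : O) • x = 0 := hb
  rw [smul_smul, mul_comm, ← hc, mul_smul, hb', smul_zero]

/-- Tensor products of torsion-free modules are torsion-free. -/
theorem IsTorsionFreeAt.tensor (hm : m ≠ ⊥) (hM : IsTorsionFreeAt m M) (hN : IsTorsionFreeAt m N) :
    IsTorsionFreeAt m (M ⊗[O] N) := by
  let M' := M ⧸ Submodule.torsion O M
  let N' := N ⧸ Submodule.torsion O N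
  have : Module.Flat O M' := IsDedekindDomain.flat_iff_torsion_eq_bot.2
    Submodule.QuotientTorsion.torsion_eq_bot
  have : Module.Flat O N' := IsDedekindDomain.flat_iff_torsion_eq_bot.2
    Submodule.QuotientTorsion.torsion_eq_bot
  refine isTorsionFreeAt_iff.2 fun z hz => ?_
  let q := TensorProduct.map (Submodule.torsion O M).mkQ (Submodule.torsion O N).mkQ
  -- The target of `q` is flat, so a nonzero element of `m` acts injectively on it.
  have hq : q z = 0 := by
    obtain ⟨a, ha, ha0⟩ := Submodule.exists_mem_ne_zero_of_ne_bot hm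
    refine (smul_eq_zero.1 (?_ : a • q z = 0)).resolve_left ha0
    rw [← map_smul, hz a ha, map_zero]
  have hz' : z ∈ LinearMap.ker q := hq
  -- The kernel of `q` is generated by tensors with a torsion factor, and each such factor is killed
  -- by some `v ≡ 1` modulo `m`.
  rw [TensorProduct.map_ker (LinearMap.exact_subtype_mkQ _) (Submodule.mkQ_surjective _)
    (LinearMap.exact_subtype_mkQ _) (Submodule.mkQ_surjective _)] at hz'
  have h : z ∈ oneAddTorsion m (M ⊗[O] N) := by
    refine SetLike.le_def.1 (sup_le ?_ ?_) hz'
    · rintro _ ⟨y, rfl⟩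
      induction y with
      | zero => simp
      | tmul x y =>
        obtain ⟨v, hv, h⟩ := hN.exists_smul_eq_zero y.2
        exact ⟨v, hv, by simp [← TensorProduct.tmul_smul, h]⟩
      | add x y hx hy => rw [map_add]; exact add_mem hx hy
    · rintro _ ⟨y, rfl⟩
      induction y with
      | zero => simp
      | tmul x y =>
        obtain ⟨v, hv, h⟩ := hM.exists_smul_eq_zero x.2
        exact ⟨v, hv, by simp [TensorProduct.smul_tmul', h]⟩
      | add x y hx hy => rw [map_add]; exact add_mem hx hy
  -- Now `z` is killed by `v` and by `1 - v ∈ m`, hence by `1`.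
  obtain ⟨v, hv, h⟩ := h
  have := hz _ hv
  rwa [sub_smul, h, sub_zero, one_smul] at this

end

/-! ## The ring of integers away from `m` -/

namespace IntegersAway

variable {O : Type u} [CommRing O] [IsDedekindDomain O] {m : Ideal O}

open IsDedekindDomain

variable (m) in
/-- The inclusion of `K` into the field of fractions. -/
def toFraction : IntegersAway m →ₐ[O] FractionRing O :=
  (Set.integer {v : HeightOneSpectrum O | m ≤ v.asIdeal} (FractionRing O)).val

theorem toFraction_injective : Function.Injective (toFraction m) := Subtype.val_injective

theorem exists_toFraction_eq {x : FractionRing O}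
    (hx : ∀ v : HeightOneSpectrum O, ¬ m ≤ v.asIdeal → v.valuation (FractionRing O) x ≤ 1) :
    ∃ y, toFraction m y = x := ⟨⟨x, hx⟩, rfl⟩

theorem valuation_toFraction_le_one (x : IntegersAway m) {v : HeightOneSpectrum O}
    (hv : ¬ m ≤ v.asIdeal) : v.valuation (FractionRing O) (toFraction m x) ≤ 1 := x.2 v hv

/-- `K` lies in the field of fractions, so it is torsion-free, and over a Dedekind domain this means
flat. -/
instance : Module.Flat O (IntegersAway m) := by
  rw [IsDedekindDomain.flat_iff_torsion_eq_bot, eq_bot_iff]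
  rintro x ⟨b, hb⟩
  have hb' : (b : O) • x = 0 := hb
  have := congrArg (toFraction m) hb'
  rw [map_smul, map_zero, smul_eq_zero] at this
  exact toFraction_injective ((this.resolve_left (nonZeroDivisors.coe_ne_zero b)).trans
    (map_zero _).symm)

/-- The elements `x` of `K` with `x m ⊆ O`. -/
def invIdeal (m : Ideal O) : Submodule O (IntegersAway m) where
  carrier := {x | ∀ a ∈ m, ∃ b : O, algebraMap O (IntegersAway m) b = a • x}
  zero_mem' a _ := ⟨0, by simp⟩
  add_mem' {x y} hx hy a ha := by
    obtain ⟨b, hb⟩ := hx a ha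
    obtain ⟨c, hc⟩ := hy a ha
    exact ⟨b + c, by rw [map_add, hb, hc, smul_add]⟩
  smul_mem' c x hx a ha := by
    obtain ⟨b, hb⟩ := hx a ha
    exact ⟨c * b, by rw [map_mul, hb, smul_comm, Algebra.smul_def c]⟩

/-- The ideal `m` is invertible. -/
theorem one_mem_smul_invIdeal (hm : m ≠ ⊥) : (1 : IntegersAway m) ∈ m • invIdeal m := by
  obtain ⟨a, ha, ha0⟩ := Submodule.exists_mem_ne_zero_of_ne_bot hm
  -- Here `n` is the ideal with `(a) = m n`; the inverse of `m` is realized by the fractions `y / a`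
  -- with `y ∈ n`.
  obtain ⟨n, hn⟩ := Ideal.dvd_span_singleton.2 ha
  have ha' : algebraMap O (FractionRing O) a ≠ 0 := by simpa using ha0
  have h1 (y : O) (hy : y ∈ n) (c : O) (hc : c ∈ m) : ∃ b : O,
      algebraMap O (FractionRing O) b = c • (algebraMap O _ y / algebraMap O _ a) := by
    have : c * y ∈ Ideal.span {a} := hn ▸ Ideal.mul_mem_mul hc hy
    obtain ⟨b, hb⟩ := Ideal.mem_span_singleton'.1 this
    refine ⟨b, ?_⟩
    rw [Algebra.smul_def, ← mul_div_assoc, ← map_mul, ← hb, map_mul, mul_div_cancel_right₀ _ ha']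
  have h2 (y : O) (hy : y ∈ n) : ∃ k ∈ invIdeal m,
      toFraction m k = algebraMap O _ y / algebraMap O _ a := by
    obtain ⟨k, hk⟩ := exists_toFraction_eq (m := m)
      (x := algebraMap O (FractionRing O) y / algebraMap O _ a) fun v hv => by
        -- At `v` not dividing `m`, some `c ∈ m` is a unit; as `c * (y / a)` lies in `O`, the
        -- fraction `y / a` is integral at `v`.
        obtain ⟨c, hc, hcv⟩ := Set.not_subset.1 hv
        obtain ⟨b, hb⟩ := h1 y hy c hc
        have hval := congrArg (v.valuation (FractionRing O)) hb
        rw [Algebra.smul_def, map_mul] at hval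
        have hc1 : v.valuation (FractionRing O) (algebraMap O _ c) = 1 := by
          refine le_antisymm (v.valuation_le_one c) (not_lt.1 fun h => hcv ?_)
          exact (v.valuation_lt_one_iff_mem c).1 h
        rw [hc1, one_mul] at hval
        rw [← hval]
        exact v.valuation_le_one b
    refine ⟨k, fun c hc => ?_, hk⟩
    obtain ⟨b, hb⟩ := h1 y hy c hc
    exact ⟨b, toFraction_injective (by rw [map_smul, hk, ← hb, AlgHom.commutes])⟩
  -- Dividing `m n` by `a` lands in `m m⁻¹`; the case `z = a` gives the claim.
  have h3 (z : O) (hz : z ∈ m * n) : ∃ k ∈ m • invIdeal m,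
      toFraction m k = algebraMap O _ z / algebraMap O _ a := by
    refine Submodule.mul_induction_on hz (fun c hc y hy => ?_) fun y z hy hz => ?_
    · obtain ⟨k, hk, hky⟩ := h2 y hy
      exact ⟨c • k, Submodule.smul_mem_smul hc hk, by
        rw [map_smul, hky, Algebra.smul_def, ← mul_div_assoc, ← map_mul]⟩
    · obtain ⟨k, hk, hky⟩ := hy
      obtain ⟨l, hl, hlz⟩ := hz
      exact ⟨k + l, add_mem hk hl, by rw [map_add, hky, hlz, map_add, add_div]⟩
  obtain ⟨k, hk, hk1⟩ := h3 a (hn ▸ Ideal.mem_span_singleton_self a)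
  rw [div_self ha'] at hk1
  rwa [toFraction_injective (hk1.trans (map_one _).symm)] at hk

/-- Elements of `K` have only powers of `m` as denominators. -/
theorem exists_pow_smul_mem (x : IntegersAway m) :
    ∃ n : ℕ, ∀ a ∈ m ^ n, ∃ b : O, algebraMap O (IntegersAway m) b = a • x := by
  -- `J` is the ideal of denominators of `x`; a power of `m` lies in it once `m ⊆ √J`.
  let J : Ideal O := (LinearMap.range (Algebra.linearMap O (IntegersAway m))).comap
    (LinearMap.toSpanSingleton O (IntegersAway m) x)
  have hJ (a : O) : a ∈ J ↔ ∃ b : O, algebraMap O (IntegersAway m) b = a • x := Iff.rfl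
  have hJf (a : O) : a ∈ J ↔
      ∃ b : O, algebraMap O (FractionRing O) b = algebraMap O _ a * toFraction m x := by
    rw [hJ]
    refine exists_congr fun b => ?_
    rw [← toFraction_injective.eq_iff, AlgHom.commutes, map_smul, Algebra.smul_def]
  obtain ⟨n, hn⟩ := Ideal.exists_pow_le_of_le_radical_of_fg (I := m) (J := J) (by
    rw [Ideal.radical_eq_sInf]
    refine le_sInf fun q ⟨hq, hqp⟩ => ?_
    by_contra hmq
    -- A prime `q ⊇ J` not containing `m` would be nonzero, since `x` has a nonzero denominator.
    -- Then `x` is integral at `q` and has a denominator outside `q`, a contradiction.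
    have hq0 : q ≠ ⊥ := by
      rintro rfl
      obtain ⟨⟨b, d⟩, h⟩ := IsLocalization.surj (nonZeroDivisors O) (toFraction m x)
      exact nonZeroDivisors.coe_ne_zero d ((Submodule.mem_bot O).1
        (hq ((hJf d).2 ⟨b, by rw [mul_comm]; exact h.symm⟩)))
    obtain ⟨b, d, h⟩ := HeightOneSpectrum.exists_primeCompl_mul_eq_of_integer ⟨q, hqp, hq0⟩
      (toFraction m x) (valuation_toFraction_le_one x hmq)
    exact d.2 (hq ((hJf d).2 ⟨b, by rw [mul_comm]; exact h.symm⟩))) (IsNoetherian.noetherian m)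
  exact ⟨n, fun a ha => (hJ a).1 (hn ha)⟩

/-! ### Base change of modules to `K` -/

variable {M : Type*} [AddCommGroup M] [Module O M]

variable (M) in
-- An element killed by `m` is killed by `m m⁻¹`, which contains `1`.
theorem isTorsionFreeAt_tensor (hm : m ≠ ⊥) : IsTorsionFreeAt m (IntegersAway m ⊗[O] M) := by
  refine isTorsionFreeAt_iff.2 fun z hz => ?_
  have (k : IntegersAway m) (hk : k ∈ m • invIdeal m) : k • z = 0 := by
    refine Submodule.smul_induction_on hk (fun a ha x _ => ?_) fun x y hx hy => ?_
    · rw [smul_assoc, smul_comm, hz a ha, smul_zero]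
    · rw [add_smul, hx, hy, add_zero]
  simpa using this 1 (one_mem_smul_invIdeal hm)

/-- A torsion-free module embeds into its base change to `K`. -/
theorem eq_zero_of_one_tmul_eq_zero (hM : IsTorsionFreeAt m M) {y : M}
    (hy : (1 : IntegersAway m) ⊗ₜ[O] y = 0) : y = 0 := by
  -- By flatness of `K` one may replace `M` by the cyclic module `O y ≅ O/J`. Then `1 ⊗ 1 = 0` in `K
  -- ⊗ O/J = K/JK`, that is, `1 ∈ JK`.
  let φ := LinearMap.toSpanSingleton O M y
  let J : Ideal O := LinearMap.ker φ
  have hinj : Function.Injective ((J.liftQ φ le_rfl).lTensor (IntegersAway m)) :=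
    Module.Flat.lTensor_preserves_injective_linearMap _
      (LinearMap.ker_eq_bot.1 (Submodule.ker_liftQ_eq_bot _ _ _ le_rfl))
  have h1 : (1 : IntegersAway m) ⊗ₜ[O] (Submodule.Quotient.mk (p := J) 1) = 0 := hinj (by
    rw [map_zero, LinearMap.lTensor_tmul, Submodule.liftQ_apply]
    simpa [φ] using hy)
  have h2 := congrArg (TensorProduct.tensorQuotEquivQuotSMul (IntegersAway m) J) h1
  rw [map_zero] at h2
  erw [TensorProduct.tensorQuotEquivQuotSMul_tmul_mk] at h2
  have h3 : (1 : IntegersAway m) ∈ J • (⊤ : Submodule O (IntegersAway m)) := by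
    rwa [one_smul, Submodule.Quotient.mk_eq_zero] at h2
  -- Clearing denominators in `1 ∈ JK` yields `m ^ n ⊆ J`, so `m ^ n` kills `y`.
  have key (k : IntegersAway m) (hk : k ∈ J • (⊤ : Submodule O (IntegersAway m))) :
      ∃ n : ℕ, ∀ a ∈ m ^ n, ∃ b ∈ J, algebraMap O (IntegersAway m) b = a • k := by
    refine Submodule.smul_induction_on hk (fun c hc x _ => ?_) fun x y hx hy => ?_
    · obtain ⟨n, hn⟩ := exists_pow_smul_mem x
      refine ⟨n, fun a ha => ?_⟩
      obtain ⟨b, hb⟩ := hn a ha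
      exact ⟨c * b, Ideal.mul_mem_right b J hc, by
        rw [map_mul, hb, ← Algebra.smul_def, smul_comm]⟩
    · obtain ⟨n, hn⟩ := hx
      obtain ⟨l, hl⟩ := hy
      refine ⟨n + l, fun a ha => ?_⟩
      obtain ⟨b, hb, hbx⟩ := hn a (Ideal.pow_le_pow_right (Nat.le_add_right n l) ha)
      obtain ⟨c, hc, hcy⟩ := hl a (Ideal.pow_le_pow_right (Nat.le_add_left l n) ha)
      exact ⟨b + c, add_mem hb hc, by rw [map_add, hbx, hcy, smul_add]⟩
  obtain ⟨n, hn⟩ := key 1 h3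
  refine hM y ⟨n, fun a ha => ?_⟩
  obtain ⟨b, hb, hba⟩ := hn a ha
  have : b = a := by
    refine IsFractionRing.injective O (FractionRing O) ?_
    have := congrArg (toFraction m) hba
    simpa [Algebra.smul_def] using this
  exact this ▸ hb

theorem one_tmul_injective (hM : IsTorsionFreeAt m M) :
    Function.Injective fun y : M => (1 : IntegersAway m) ⊗ₜ[O] y := fun x y h => by
  rw [← sub_eq_zero]
  refine eq_zero_of_one_tmul_eq_zero (m := m) hM ?_
  rw [TensorProduct.tmul_sub]
  exact sub_eq_zero.2 h

end IntegersAway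

/-! ## The universal property of the blowup -/

theorem exists_lift_of_injective {k A B C : Type*} [CommRing k] [CommRing A] [Algebra k A]
    [CommRing B] [Algebra k B] [CommRing C] [Algebra k C] (c : B →ₐ[k] C)
    (hc : Function.Injective c) (H : A →ₐ[k] C) (h : ∀ a, ∃ b, c b = H a) :
    ∃ H' : A →ₐ[k] B, ∀ a, c (H' a) = H a := by
  refine ⟨(AlgEquiv.ofInjective c hc).symm.toAlgHom.comp (H.codRestrict c.range h), fun a => ?_⟩
  exact congrArg Subtype.val ((AlgEquiv.ofInjective c hc).apply_symm_apply (H.codRestrict c.range h a))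

section

variable {O : Type u} [CommRing O] (m : Ideal O) {P Q : Type u} [CommRing P] [Algebra O P]
  [CommRing Q] [Algebra O Q] (f : P →ₐ[O] Q)

/-- The map `F` carries the kernel of `f` into the ideal generated by `m`. -/
def MapsKer {R : Type*} [CommRing R] [Algebra O R] (F : P →ₐ[O] R) : Prop :=
  ∀ p, f p = 0 → F p ∈ m.map (algebraMap O R)

variable {m f}

theorem map_mem_map {R R' : Type*} [CommRing R] [Algebra O R] [CommRing R'] [Algebra O R']
    (h : R →ₐ[O] R') {r : R} (hr : r ∈ m.map (algebraMap O R)) : h r ∈ m.map (algebraMap O R') := by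
  have := Ideal.mem_map_of_mem (h : R →+* R') hr
  rwa [Ideal.map_map, AlgHom.comp_algebraMap] at this

theorem MapsKer.comp {R R' : Type*} [CommRing R] [Algebra O R] [CommRing R'] [Algebra O R']
    {F : P →ₐ[O] R} (hF : MapsKer m f F) (h : R →ₐ[O] R') : MapsKer m f (h.comp F) :=
  fun p hp => map_mem_map h (hF p hp)

/-- As `f` is surjective, the kernel of `f ⊗ f` is generated by `I ⊗ 1` and `1 ⊗ I`. -/
theorem MapsKer.productMap_mem (hsurj : Function.Surjective f) {R : Type*} [CommRing R]
    [Algebra O R] {a b : P →ₐ[O] R} (ha : MapsKer m f a) (hb : MapsKer m f b) {z : P ⊗[O] P}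
    (hz : Algebra.TensorProduct.map f f z = 0) : productMap a b z ∈ m.map (algebraMap O R) := by
  have hz' : z ∈ RingHom.ker (Algebra.TensorProduct.map f f) := hz
  rw [Algebra.TensorProduct.map_ker f f hsurj hsurj] at hz'
  refine (sup_le (a := (RingHom.ker f).map (includeLeft : P →ₐ[O] P ⊗[O] P))
    (b := (RingHom.ker f).map (includeRight : P →ₐ[O] P ⊗[O] P))
    (c := (m.map (algebraMap O R)).comap (productMap a b)) ?_ ?_) hz'
  · exact Ideal.map_le_iff_le_comap.2 fun p hp => by simpa using ha p hp
  · exact Ideal.map_le_iff_le_comap.2 fun p hp => by simpa using hb p hp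

theorem MapsKer.tensorMap (hsurj : Function.Surjective f) {R : Type*} [CommRing R] [Algebra O R]
    {F : P →ₐ[O] R} (hF : MapsKer m f F) {z : P ⊗[O] P}
    (hz : Algebra.TensorProduct.map f f z = 0) :
    Algebra.TensorProduct.map F F z ∈ m.map (algebraMap O (R ⊗[O] R)) := by
  have hmap : productMap ((includeLeft : R →ₐ[O] R ⊗[O] R).comp F)
      ((includeRight : R →ₐ[O] R ⊗[O] R).comp F) = Algebra.TensorProduct.map F F := by
    ext <;> simp
  rw [← hmap]
  exact MapsKer.productMap_mem hsurj (hF.comp _) (hF.comp _) hz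

section

variable [Algebra (O ⧸ m) Q] [IsScalarTower O (O ⧸ m) Q]

theorem map_smul_eq_zero {a : O} (ha : a ∈ m) (f : P →ₐ[O] Q) (p : P) : f (a • p) = 0 := by
  rw [map_smul, ← algebraMap_smul (O ⧸ m) a (f p)]
  have : algebraMap O (O ⧸ m) a = 0 := Ideal.Quotient.eq_zero_iff_mem.2 ha
  rw [this, zero_smul]

/-- A map of birings over `O → O/m` is expressed in the tensor product over `O/m`; because `O → O/m`
is surjective, that is the tensor product over `O`. -/
theorem map_eq_zero_of_productMap_eq_zero {z : P ⊗[O] P}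
    (hz : productMap
      (((includeLeft : Q →ₐ[O ⧸ m] Q ⊗[O ⧸ m] Q).restrictScalars O).comp f)
      (((includeRight : Q →ₐ[O ⧸ m] Q ⊗[O ⧸ m] Q).restrictScalars O).comp f) z = 0) :
    Algebra.TensorProduct.map f f z = 0 := by
  have : TensorProduct.CompatibleSMul O (O ⧸ m) Q Q :=
    .of_algebraMap_surjective _ _ Ideal.Quotient.mk_surjective
  have h : (Algebra.TensorProduct.mapOfCompatibleSMul O (O ⧸ m) O Q Q).comp (productMap
      (((includeLeft : Q →ₐ[O ⧸ m] Q ⊗[O ⧸ m] Q).restrictScalars O).comp f)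
      (((includeRight : Q →ₐ[O ⧸ m] Q ⊗[O ⧸ m] Q).restrictScalars O).comp f)) =
      Algebra.TensorProduct.map f f :=
    tensor_hom_ext (fun p => by simp) (fun p => by simp)
  rw [← h, AlgHom.comp_apply, hz, map_zero]

end

variable [IsDedekindDomain O]

open IntegersAway

theorem tmul_mem_blowup {x : IntegersAway m} (hx : x ∈ invIdeal m) {p : P} (hp : f p = 0) :
    x ⊗ₜ[O] p ∈ blowup m f := Algebra.subset_adjoin ⟨x, p, hx, hp, rfl⟩

/-- Writing `1 = ∑ a x` with `a ∈ m`, `x ∈ m⁻¹` gives `1 ⊗ p = ∑ a (x ⊗ p)`, a combination of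
generators of the blowup with coefficients in `m`. -/
theorem exists_mem_map_of_ker (hm : m ≠ ⊥) {p : P} (hp : f p = 0) :
    ∃ s ∈ m.map (algebraMap O (blowup m f)), s.1 = 1 ⊗ₜ[O] p := by
  have (k : IntegersAway m) (hk : k ∈ m • invIdeal m) :
      ∃ s ∈ m.map (algebraMap O (blowup m f)), s.1 = k ⊗ₜ[O] p := by
    refine Submodule.smul_induction_on hk (fun a ha x hx => ?_) fun x y ⟨s, hs, hsx⟩ ⟨t, ht, hty⟩ => ?_
    · refine ⟨algebraMap O _ a * ⟨x ⊗ₜ p, tmul_mem_blowup hx hp⟩,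
        Ideal.mul_mem_right _ _ (Ideal.mem_map_of_mem _ ha), ?_⟩
      rw [← Algebra.smul_def]
      rfl
    · exact ⟨s + t, add_mem hs ht, by rw [TensorProduct.add_tmul, ← hsx, ← hty]; rfl⟩
  exact this 1 (one_mem_smul_invIdeal hm)

theorem isTorsionFreeAt_blowup (hm : m ≠ ⊥) (f : P →ₐ[O] Q) : IsTorsionFreeAt m (blowup m f) :=
  (isTorsionFreeAt_tensor P hm).of_injective (blowup m f).val.toLinearMap Subtype.val_injective

theorem exists_pow_smul_eq_tmul (z : IntegersAway m ⊗[O] P) :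
    ∃ n : ℕ, ∀ a ∈ m ^ n, ∃ p : P, (1 : IntegersAway m) ⊗ₜ[O] p = a • z := by
  induction z with
  | zero => exact ⟨0, fun a _ => ⟨0, by simp⟩⟩
  | tmul x p =>
    obtain ⟨n, hn⟩ := exists_pow_smul_mem x
    refine ⟨n, fun a ha => ?_⟩
    obtain ⟨b, hb⟩ := hn a ha
    exact ⟨b • p, by rw [TensorProduct.smul_tmul', ← hb, Algebra.algebraMap_eq_smul_one,
      TensorProduct.smul_tmul]⟩
  | add x y hx hy =>
    obtain ⟨n, hn⟩ := hx
    obtain ⟨l, hl⟩ := hy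
    refine ⟨n + l, fun a ha => ?_⟩
    obtain ⟨b, hbx⟩ := hn a (Ideal.pow_le_pow_right (Nat.le_add_right n l) ha)
    obtain ⟨c, hcy⟩ := hl a (Ideal.pow_le_pow_right (Nat.le_add_left l n) ha)
    exact ⟨b + c, by rw [TensorProduct.tmul_add, hbx, hcy, smul_add]⟩

/-! ### Maps out of the blowup -/

section Incl

variable {incl : P →ₐ[O] blowup m f} (hincl : ∀ p, (incl p).1 = 1 ⊗ₜ[O] p)

include hincl

theorem mapsKer_incl (hm : m ≠ ⊥) : MapsKer m f incl := fun p hp => by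
  obtain ⟨s, hs, hsp⟩ := exists_mem_map_of_ker (f := f) hm hp
  rwa [← Subtype.ext (hsp.trans (hincl p).symm)]

theorem exists_pow_smul_eq_incl (s : blowup m f) :
    ∃ n : ℕ, ∀ a ∈ m ^ n, ∃ p : P, incl p = a • s := by
  obtain ⟨n, hn⟩ := exists_pow_smul_eq_tmul s.1
  refine ⟨n, fun a ha => ?_⟩
  obtain ⟨p, hp⟩ := hn a ha
  exact ⟨p, Subtype.ext ((hincl p).trans hp)⟩

/-- A power of `m` moves `s` into `P`, where the two maps agree; so it kills the difference of their
values at `s`. -/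
theorem blowup_linearMap_ext {N : Type*} [AddCommGroup N] [Module O N] (hN : IsTorsionFreeAt m N)
    {L L' : blowup m f →ₗ[O] N} (h : ∀ p, L (incl p) = L' (incl p)) : L = L' := by
  refine LinearMap.ext fun s => ?_
  obtain ⟨n, hn⟩ := exists_pow_smul_eq_incl hincl s
  rw [← sub_eq_zero]
  refine hN _ ⟨n, fun a ha => ?_⟩
  obtain ⟨p, hp⟩ := hn a ha
  rw [smul_sub, ← map_smul, ← map_smul, ← hp, h, sub_self]

variable {R : Type*} [CommRing R] [Algebra O R] (hR : IsTorsionFreeAt m R)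

include hR

theorem blowup_algHom_ext {h h' : blowup m f →ₐ[O] R} (H : ∀ p, h (incl p) = h' (incl p)) :
    h = h' :=
  AlgHom.toLinearMap_injective (blowup_linearMap_ext hincl hR H)

/-- Under `K ⊗ P → K ⊗ R` the generators `m⁻¹ ⊗ I` go into `m⁻¹ ⊗ mR`, which lies in the image of
`R`; and `R` embeds because it is `m`-torsion-free. -/
theorem exists_blowup_lift {F : P →ₐ[O] R} (hF : MapsKer m f F) :
    ∃ F' : blowup m f →ₐ[O] R, ∀ p, F' (incl p) = F p := by
  let j : R →ₐ[O] IntegersAway m ⊗[O] R := includeRight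
  have hj : Function.Injective j := one_tmul_injective hR
  let G := Algebra.TensorProduct.map (AlgHom.id O (IntegersAway m)) F
  have hle : blowup m f ≤ j.range.comap G := by
    refine Algebra.adjoin_le ?_
    rintro _ ⟨x, p, hx, hp, rfl⟩
    change x ⊗ₜ[O] F p ∈ j.range
    have hFp : F p ∈ m • (⊤ : Submodule O R) := by
      rw [Ideal.smul_top_eq_map]; exact hF p hp
    refine Submodule.smul_induction_on hFp (fun a ha r _ => ?_) fun r t hr ht => ?_
    · obtain ⟨b, hb⟩ := hx a ha
      refine ⟨b • r, ?_⟩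
      rw [← TensorProduct.smul_tmul, ← hb, Algebra.algebraMap_eq_smul_one,
        TensorProduct.smul_tmul]
      rfl
    · rw [TensorProduct.tmul_add]
      exact add_mem hr ht
  obtain ⟨F', hF'⟩ := exists_lift_of_injective j hj (G.comp (blowup m f).val) fun s => hle s.2
  refine ⟨F', fun p => hj ?_⟩
  rw [hF', AlgHom.comp_apply, Subalgebra.val_apply, hincl]
  rfl

end Incl

theorem exists_blowup_lift_tensor (hm : m ≠ ⊥) {incl : P →ₐ[O] blowup m f}
    (hincl : ∀ p, (incl p).1 = 1 ⊗ₜ[O] p) (hsurj : Function.Surjective f) (δ : P →ₐ[O] P ⊗[O] P)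
    (hδ : ∀ p, f p = 0 → Algebra.TensorProduct.map f f (δ p) = 0) :
    ∃ Δ : blowup m f →ₐ[O] blowup m f ⊗[O] blowup m f,
      ∀ p, Δ (incl p) = Algebra.TensorProduct.map incl incl (δ p) := by
  have hS := isTorsionFreeAt_blowup hm f
  have hF : MapsKer (R := blowup m f ⊗[O] blowup m f) m f
      ((Algebra.TensorProduct.map incl incl).comp δ) :=
    fun p hp => (mapsKer_incl hincl hm).tensorMap hsurj (hδ p hp)
  exact exists_blowup_lift hincl (R := blowup m f ⊗[O] blowup m f) (hS.tensor hm hS) hF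

section Quotient

variable [Algebra (O ⧸ m) Q] [IsScalarTower O (O ⧸ m) Q]

/-- Since `m` annihilates `Q`, one has `m P ⊆ I`. With `1 = ∑ a x` as before, `1 ⊗ p = ∑ x ⊗ a p` is
a sum of generators. -/
theorem exists_blowup_incl (hm : m ≠ ⊥) (f : P →ₐ[O] Q) :
    ∃ incl : P →ₐ[O] blowup m f, ∀ p, (incl p).1 = 1 ⊗ₜ[O] p := by
  have (p : P) : (1 : IntegersAway m) ⊗ₜ[O] p ∈ blowup m f := by
    have (k : IntegersAway m) (hk : k ∈ m • invIdeal m) : k ⊗ₜ[O] p ∈ blowup m f := by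
      refine Submodule.smul_induction_on hk (fun a ha x hx => ?_) fun x y hx hy => ?_
      · rw [TensorProduct.smul_tmul]
        exact tmul_mem_blowup hx (map_smul_eq_zero ha f p)
      · rw [TensorProduct.add_tmul]; exact add_mem hx hy
    exact this 1 (one_mem_smul_invIdeal hm)
  exact ⟨includeRight.codRestrict (blowup m f) this, fun p => rfl⟩

end Quotient

end

/-! ## The biring structure on the blowup -/

section

variable {k : Type*} [CommRing k] {P S A : Type*} [CommRing P] [Algebra k P] [CommRing S]
  [Algebra k S] [CommRing A] [Algebra k A] {j : P →ₐ[k] S}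
  {δ : P →ₐ[k] P ⊗[k] P} {Δ : S →ₐ[k] S ⊗[k] S}

theorem productMap_map_apply (x y : S →ₐ[k] A) (z : P ⊗[k] P) :
    productMap x y (Algebra.TensorProduct.map j j z) = productMap (x.comp j) (y.comp j) z := by
  rw [← AlgHom.comp_apply]
  congr 1
  ext <;> simp

theorem coassoc_of_map (h : ∀ p, Δ (j p) = Algebra.TensorProduct.map j j (δ p))
    (hδ : (Algebra.TensorProduct.assoc k k k P P P).toAlgHom.comp
      ((Algebra.TensorProduct.map δ (AlgHom.id k P)).comp δ) =
      (Algebra.TensorProduct.map (AlgHom.id k P) δ).comp δ) (p : P) :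
    (Algebra.TensorProduct.assoc k k k S S S).toAlgHom.comp
      ((Algebra.TensorProduct.map Δ (AlgHom.id k S)).comp Δ) (j p) =
      (Algebra.TensorProduct.map (AlgHom.id k S) Δ).comp Δ (j p) := by
  have h' : Δ.comp j = (Algebra.TensorProduct.map j j).comp δ := AlgHom.ext h
  have e1 : (Algebra.TensorProduct.map Δ (AlgHom.id k S)).comp (Algebra.TensorProduct.map j j) =
      (Algebra.TensorProduct.map (Algebra.TensorProduct.map j j) j).comp
        (Algebra.TensorProduct.map δ (AlgHom.id k P)) := by
    rw [← Algebra.TensorProduct.map_comp, ← Algebra.TensorProduct.map_comp, h']; rfl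
  have e2 : (Algebra.TensorProduct.map (AlgHom.id k S) Δ).comp (Algebra.TensorProduct.map j j) =
      (Algebra.TensorProduct.map j (Algebra.TensorProduct.map j j)).comp
        (Algebra.TensorProduct.map (AlgHom.id k P) δ) := by
    rw [← Algebra.TensorProduct.map_comp, ← Algebra.TensorProduct.map_comp, h']; rfl
  have e3 : (Algebra.TensorProduct.assoc k k k S S S).toAlgHom.comp
      (Algebra.TensorProduct.map (Algebra.TensorProduct.map j j) j) =
      (Algebra.TensorProduct.map j (Algebra.TensorProduct.map j j)).comp
        (Algebra.TensorProduct.assoc k k k P P P).toAlgHom := by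
    ext <;> simp [Algebra.TensorProduct.one_def]
  have hδ' := DFunLike.congr_fun hδ p
  have e1' := DFunLike.congr_fun e1 (δ p)
  have e2' := DFunLike.congr_fun e2 (δ p)
  simp only [AlgHom.comp_apply] at hδ' e1' e2' ⊢
  rw [h, e1', e2', ← hδ']
  exact DFunLike.congr_fun e3 _

theorem cocomm_of_map (h : ∀ p, Δ (j p) = Algebra.TensorProduct.map j j (δ p))
    (hδ : (Algebra.TensorProduct.comm k P P).toAlgHom.comp δ = δ) (p : P) :
    (Algebra.TensorProduct.comm k S S).toAlgHom.comp Δ (j p) = Δ (j p) := by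
  have e : (Algebra.TensorProduct.comm k S S).toAlgHom.comp (Algebra.TensorProduct.map j j) =
      (Algebra.TensorProduct.map j j).comp (Algebra.TensorProduct.comm k P P).toAlgHom := by
    ext <;> simp
  rw [AlgHom.comp_apply, h]
  conv_rhs => rw [← hδ]
  exact DFunLike.congr_fun e (δ p)

theorem productMap_of_map (h : ∀ p, Δ (j p) = Algebra.TensorProduct.map j j (δ p))
    {x y : S →ₐ[k] S} {x' y' : P →ₐ[k] P} (hx : ∀ p, x (j p) = j (x' p))
    (hy : ∀ p, y (j p) = j (y' p)) (p : P) :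
    (productMap x y).comp Δ (j p) = j ((productMap x' y').comp δ p) := by
  have hx' : x.comp j = j.comp x' := AlgHom.ext hx
  have hy' : y.comp j = j.comp y' := AlgHom.ext hy
  rw [AlgHom.comp_apply, h, productMap_map_apply, hx', hy', AlgHom.comp_apply,
    ← algHom_comp_productMap]
  rfl

theorem codistrib_of_map {δ' : P →ₐ[k] P ⊗[k] P} {Δ' : S →ₐ[k] S ⊗[k] S}
    (h : ∀ p, Δ (j p) = Algebra.TensorProduct.map j j (δ p))
    (h' : ∀ p, Δ' (j p) = Algebra.TensorProduct.map j j (δ' p))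
    (hδ : (Algebra.TensorProduct.map (AlgHom.id k P) δ).comp δ' =
      (productMap ((Algebra.TensorProduct.map (AlgHom.id k P) includeLeft).comp δ')
        ((Algebra.TensorProduct.map (AlgHom.id k P) includeRight).comp δ')).comp δ) (p : P) :
    (Algebra.TensorProduct.map (AlgHom.id k S) Δ).comp Δ' (j p) =
      (productMap ((Algebra.TensorProduct.map (AlgHom.id k S) includeLeft).comp Δ')
        ((Algebra.TensorProduct.map (AlgHom.id k S) includeRight).comp Δ')).comp Δ (j p) := by
  let J := Algebra.TensorProduct.map j (Algebra.TensorProduct.map j j)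
  have hj : Δ.comp j = (Algebra.TensorProduct.map j j).comp δ := AlgHom.ext h
  have hj' : Δ'.comp j = (Algebra.TensorProduct.map j j).comp δ' := AlgHom.ext h'
  have e1 : (Algebra.TensorProduct.map (AlgHom.id k S) Δ).comp (Algebra.TensorProduct.map j j) =
      J.comp (Algebra.TensorProduct.map (AlgHom.id k P) δ) := by
    rw [← Algebra.TensorProduct.map_comp, ← Algebra.TensorProduct.map_comp, hj]; rfl
  have e2 : (Algebra.TensorProduct.map (AlgHom.id k S)
      (includeLeft : S →ₐ[k] S ⊗[k] S)).comp (Algebra.TensorProduct.map j j) =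
      J.comp (Algebra.TensorProduct.map (AlgHom.id k P) includeLeft) := by
    ext <;> simp [J]
  have e3 : (Algebra.TensorProduct.map (AlgHom.id k S)
      (includeRight : S →ₐ[k] S ⊗[k] S)).comp (Algebra.TensorProduct.map j j) =
      J.comp (Algebra.TensorProduct.map (AlgHom.id k P) includeRight) := by
    ext <;> simp [J]
  have hl : (Algebra.TensorProduct.map (AlgHom.id k S) Δ).comp Δ' (j p) =
      J ((Algebra.TensorProduct.map (AlgHom.id k P) δ).comp δ' p) := by
    rw [AlgHom.comp_apply, h']
    exact DFunLike.congr_fun e1 (δ' p)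
  rw [hl, hδ, AlgHom.comp_apply, AlgHom.comp_apply, h, productMap_map_apply, AlgHom.comp_assoc,
    AlgHom.comp_assoc, hj', ← AlgHom.comp_assoc, ← AlgHom.comp_assoc, e2, e3, AlgHom.comp_assoc,
    AlgHom.comp_assoc, ← algHom_comp_productMap]
  rfl

theorem isBiringHom_iff [Biring k P] [Biring k S] {j : P →ₐ[k] S} : IsBiringHom k k j ↔
    (∀ p, Coring.coadd (k := k) (j p) = Algebra.TensorProduct.map j j (Coring.coadd (k := k) p)) ∧
    (∀ p, Coring.comul (k := k) (j p) = Algebra.TensorProduct.map j j (Coring.comul (k := k) p)) ∧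
    ∀ (c : k) (p : P), (Biring.colin c : Points k S k) (j p) = (Biring.colin c : Points k P k) p := by
  have hm : productMap (((includeLeft : S →ₐ[k] S ⊗[k] S).restrictScalars k).comp j)
      (((includeRight : S →ₐ[k] S ⊗[k] S).restrictScalars k).comp j) =
      Algebra.TensorProduct.map j j := by
    ext <;> simp
  constructor
  · rintro ⟨h1, h2, h3⟩
    rw [hm] at h1 h2
    exact ⟨h1, h2, h3⟩
  · rintro ⟨h1, h2, h3⟩
    exact ⟨by rwa [hm], by rwa [hm], h3⟩

/-- Co-operations that extend those of a biring define a biring, if extensions are unique. -/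
theorem exists_biring_of_map [Biring k P]
    (ext₁ : ∀ a b : S →ₐ[k] S, (∀ p, a (j p) = b (j p)) → a = b)
    (ext₂ : ∀ a b : S →ₐ[k] S ⊗[k] S, (∀ p, a (j p) = b (j p)) → a = b)
    (ext₃ : ∀ a b : S →ₐ[k] S ⊗[k] (S ⊗[k] S), (∀ p, a (j p) = b (j p)) → a = b)
    (ext₀ : ∀ a b : S →ₐ[k] k, (∀ p, a (j p) = b (j p)) → a = b)
    {M : S →ₐ[k] S ⊗[k] S} {σ : S →ₐ[k] S} {β : k → (S →ₐ[k] k)}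
    (hΔ : ∀ p, Δ (j p) = Algebra.TensorProduct.map j j (Coring.coadd (k := k) p))
    (hM : ∀ p, M (j p) = Algebra.TensorProduct.map j j (Coring.comul (k := k) p))
    (hσ : ∀ p, σ (j p) = j (Coring.coneg (k := k) p))
    (hβ : ∀ c p, β c (j p) = (Biring.colin c : Points k P k) p) :
    ∃ _ : Biring k S, IsBiringHom k k j := by
  have hid (x : S →ₐ[k] k) (x' : P →ₐ[k] k) (h : ∀ p, x (j p) = x' p) (p : P) :
      ((Algebra.ofId k _).comp x) (j p) = j (((Algebra.ofId k P).comp x') p) := by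
    simp [h, Algebra.ofId_apply]
  have h0 (p : P) : β 0 (j p) = Coring.cozero p := by
    rw [hβ, map_zero]; rfl
  have h1 (p : P) : β 1 (j p) = Coring.coone p := by
    rw [hβ, map_one]; rfl
  -- With `β 0` and `β 1` as counits, `β` preserves `0` and `1` by definition.
  let _ : Coring k S :=
    { coadd := Δ
      cozero := β 0
      coneg := σ
      comul := M
      coone := β 1
      coadd_coassoc := ext₃ _ _ (coassoc_of_map hΔ Coring.coadd_coassoc)
      coadd_cocomm := ext₂ _ _ (cocomm_of_map hΔ Coring.coadd_cocomm)
      coadd_counit := ext₁ _ _ fun p => by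
        rw [productMap_of_map hΔ (hid _ _ h0) (y' := AlgHom.id k P) (fun _ => rfl),
          Coring.coadd_counit]; rfl
      coadd_antipode := ext₁ _ _ fun p => by
        rw [productMap_of_map hΔ hσ (y' := AlgHom.id k P) (fun _ => rfl),
          Coring.coadd_antipode, hid _ _ h0]
      comul_coassoc := ext₃ _ _ (coassoc_of_map hM Coring.comul_coassoc)
      comul_cocomm := ext₂ _ _ (cocomm_of_map hM Coring.comul_cocomm)
      comul_counit := ext₁ _ _ fun p => by
        rw [productMap_of_map hM (hid _ _ h1) (y' := AlgHom.id k P) (fun _ => rfl),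
          Coring.comul_counit]; rfl
      codistrib := ext₃ _ _ (codistrib_of_map hΔ hM Coring.codistrib) }
  have hβ' (c : k) : (β c).comp j = (Biring.colin c : Points k P k).toAlgHom :=
    AlgHom.ext (hβ c)
  let _ : Biring k S := { colin :=
    { toFun := fun c => Points.ofAlgHom (β c)
      map_zero' := rfl
      map_one' := rfl
      map_add' := fun c d => ext₀ _ _ fun p => by
        change β _ (j p) = _
        rw [hβ, map_add]
        change _ = productMap (β c) (β d) (Δ (j p))
        rw [hΔ, productMap_map_apply, hβ', hβ']
        rfl
      map_mul' := fun c d => ext₀ _ _ fun p => by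
        change β _ (j p) = _
        rw [hβ, map_mul]
        change _ = productMap (β c) (β d) (M (j p))
        rw [hM, productMap_map_apply, hβ', hβ']
        rfl } }
  exact ⟨inferInstance, isBiringHom_iff.2 ⟨hΔ, hM, hβ⟩⟩

end

section

variable {O : Type u} [CommRing O] {m : Ideal O} {P Q : Type u} [CommRing P] [Algebra O P]
  [CommRing Q] [Algebra O Q] {f : P →ₐ[O] Q} [Algebra (O ⧸ m) Q] [IsScalarTower O (O ⧸ m) Q]
  [Biring O P] [Biring (O ⧸ m) Q]

theorem mapsKer_colin (hf : IsBiringHom O (O ⧸ m) f) (c : O) :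
    MapsKer m f (Biring.colin c : Points O P O).toAlgHom := fun p hp => by
  have := hf.colin c p
  rw [hp, map_zero] at this
  simpa using Ideal.Quotient.eq_zero_iff_mem.1 this.symm

theorem map_coadd_eq_zero (hf : IsBiringHom O (O ⧸ m) f) {p : P} (hp : f p = 0) :
    Algebra.TensorProduct.map f f (Coring.coadd (k := O) p) = 0 :=
  map_eq_zero_of_productMap_eq_zero (m := m) (by rw [← hf.coadd, hp, map_zero])

theorem map_comul_eq_zero (hf : IsBiringHom O (O ⧸ m) f) {p : P} (hp : f p = 0) :
    Algebra.TensorProduct.map f f (Coring.comul (k := O) p) = 0 :=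
  map_eq_zero_of_productMap_eq_zero (m := m) (by rw [← hf.comul, hp, map_zero])

/-- Compatibility with the antipode is not part of `IsBiringHom`, but the antipode is multiplication
by `β(-1)`, so the claim reduces to `β` and `Δ^×`. -/
theorem mapsKer_coneg (hf : IsBiringHom O (O ⧸ m) f) (hsurj : Function.Surjective f)
    {R : Type*} [CommRing R] [Algebra O R] {F : P →ₐ[O] R} (hF : MapsKer m f F) :
    MapsKer m f (F.comp Coring.coneg) := by
  have hneg : (Coring.coneg : P →ₐ[O] P) =
      (productMap ((Algebra.ofId O P).comp (Biring.colin (-1) : Points O P O).toAlgHom)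
        (AlgHom.id O P)).comp Coring.comul := by
    have : (-Points.ofAlgHom (AlgHom.id O P) : Points O P P) =
        algebraMap O (Points O P P) (-1) * Points.ofAlgHom (AlgHom.id O P) := by
      rw [map_neg, map_one, neg_mul, one_mul]
    exact this
  intro p hp
  rw [hneg, ← AlgHom.comp_assoc, algHom_comp_productMap]
  refine MapsKer.productMap_mem hsurj ?_ hF (map_comul_eq_zero hf hp)
  rw [← AlgHom.comp_assoc]
  exact (mapsKer_colin hf _).comp _

variable [IsDedekindDomain O]

/-- The biring structure on the blowup for which `incl` is a map of birings. -/
theorem exists_biring_blowup (hm : m ≠ ⊥) (hf : IsBiringHom O (O ⧸ m) f)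
    (hsurj : Function.Surjective f) {incl : P →ₐ[O] blowup m f}
    (hincl : ∀ p, (incl p).1 = 1 ⊗ₜ[O] p) :
    ∃ _ : Biring O (blowup m f), IsBiringHom O O incl := by
  have hO := isTorsionFreeAt_self hm
  have hS := isTorsionFreeAt_blowup hm f
  have hSS := hS.tensor hm hS
  have hSSS := hS.tensor hm hSS
  obtain ⟨Δ, hΔ⟩ := exists_blowup_lift_tensor hm hincl hsurj _ fun p => map_coadd_eq_zero hf
  obtain ⟨M, hM⟩ := exists_blowup_lift_tensor hm hincl hsurj _ fun p => map_comul_eq_zero hf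
  obtain ⟨σ, hσ⟩ := exists_blowup_lift hincl hS
    (mapsKer_coneg hf hsurj (mapsKer_incl hincl hm))
  have hβ (c : O) := exists_blowup_lift hincl hO (mapsKer_colin hf c)
  choose β hβ using hβ
  exact exists_biring_of_map (fun _ _ => blowup_algHom_ext hincl hS)
    (fun _ _ => blowup_algHom_ext hincl hSS) (fun _ _ => blowup_algHom_ext hincl hSSS)
    (fun _ _ => blowup_algHom_ext hincl hO) hΔ hM hσ hβ

end

/-! ## The right action on the blowup -/

section

variable {O : Type u} [CommRing O] {m : Ideal O} [IsDedekindDomain O] {P Q : Type u} [CommRing P]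
  [Algebra O P] [CommRing Q] [Algebra O Q] {f : P →ₐ[O] Q}

theorem blowupTensor_map_incl {incl : P →ₐ[O] blowup m f} (hincl : ∀ p, (incl p).1 = 1 ⊗ₜ[O] p)
    (z : P ⊗[O] P) : blowupTensor m f (Algebra.TensorProduct.map incl incl z) = 1 ⊗ₜ[O] z := by
  have : (blowupTensor m f).comp (Algebra.TensorProduct.map incl incl) = includeRight := by
    refine tensor_hom_ext (fun p => ?_) fun p => ?_ <;>
    · simp [blowupTensor, hincl]
  exact DFunLike.congr_fun this z

/-- A multiple of `z` by `m ^ n` comes from `P ⊗ P`, which embeds into `K ⊗ (P ⊗ P)`; and `S ⊗ S`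
has no `m`-torsion. Hence the induced co-operations on `S` are determined by those of `K ⊗ P`. -/
theorem blowupTensor_injective (hm : m ≠ ⊥) (hP : IsTorsionFreeAt m P) {incl : P →ₐ[O] blowup m f}
    (hincl : ∀ p, (incl p).1 = 1 ⊗ₜ[O] p) : Function.Injective (blowupTensor m f) := by
  have hS := isTorsionFreeAt_blowup hm f
  refine (injective_iff_map_eq_zero _).2 fun z hz => ?_
  have key : ∃ n : ℕ, ∀ a ∈ m ^ n, ∃ y, Algebra.TensorProduct.map incl incl y = a • z := by
    clear hz
    induction z with
    | zero => exact ⟨0, fun a _ => ⟨0, by simp⟩⟩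
    | tmul x y =>
      obtain ⟨n, hn⟩ := exists_pow_smul_eq_incl hincl x
      obtain ⟨l, hl⟩ := exists_pow_smul_eq_incl hincl y
      refine ⟨n + l, fun a ha => ?_⟩
      rw [pow_add] at ha
      refine Submodule.mul_induction_on ha (fun b hb c hc => ?_) fun b c ⟨s, hs⟩ ⟨t, ht⟩ => ?_
      · obtain ⟨p, hp⟩ := hn b hb
        obtain ⟨q, hq⟩ := hl c hc
        exact ⟨p ⊗ₜ q, by rw [Algebra.TensorProduct.map_tmul, hp, hq, TensorProduct.smul_tmul_smul]⟩
      · exact ⟨s + t, by rw [map_add, hs, ht, add_smul]⟩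
    | add x y hx hy =>
      obtain ⟨n, hn⟩ := hx
      obtain ⟨l, hl⟩ := hy
      refine ⟨n + l, fun a ha => ?_⟩
      obtain ⟨b, hbx⟩ := hn a (Ideal.pow_le_pow_right (Nat.le_add_right n l) ha)
      obtain ⟨c, hcy⟩ := hl a (Ideal.pow_le_pow_right (Nat.le_add_left l n) ha)
      exact ⟨b + c, by rw [map_add, hbx, hcy, smul_add]⟩
  obtain ⟨n, hn⟩ := key
  refine hS.tensor hm hS z ⟨n, fun a ha => ?_⟩
  obtain ⟨y, hy⟩ := hn a ha
  have hy0 : (1 : IntegersAway m) ⊗ₜ[O] y = 0 := by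
    rw [← blowupTensor_map_incl hincl, hy, map_smul, hz, smul_zero]
  rw [← hy, IntegersAway.eq_zero_of_one_tmul_eq_zero (hP.tensor hm hP) hy0, map_zero]

theorem comap_incl_injective [Biring O P] [Biring O (blowup m f)] {incl : P →ₐ[O] blowup m f}
    (hincl : ∀ p, (incl p).1 = 1 ⊗ₜ[O] p) (hi : IsBiringHom O O incl) {R : Type*} [CommRing R]
    [Algebra O R] (hR : IsTorsionFreeAt m R) : Function.Injective (Points.comap hi R) :=
  fun _ _ h => blowup_algHom_ext hincl hR fun p => DFunLike.congr_fun h p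

/-- Operations of `P` extend to operations of the blowup, if the kernel of `f` acts by zero
modulo `m`. -/
theorem exists_blowup_op [Biring O P] [Biring O (blowup m f)] {incl : P →ₐ[O] blowup m f}
    (hincl : ∀ p, (incl p).1 = 1 ⊗ₜ[O] p) (hi : IsBiringHom O O incl) {R : Type*} [CommRing R]
    [Algebra O R] (hR : IsTorsionFreeAt m R) {A : Type*} [CommRing A] [Algebra O A]
    (b : A →ₐ[O] Points O P R) (hb : ∀ r, MapsKer m f (b r).toAlgHom) :
    ∃ σ : A →ₐ[O] Points O (blowup m f) R, ∀ r p, σ r (incl p) = b r p := by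
  obtain ⟨σ, hσ⟩ := exists_lift_of_injective (Points.comap hi R) (comap_incl_injective hincl hi hR) b
    fun r => by
      obtain ⟨F, hF⟩ := exists_blowup_lift hincl hR (hb r)
      exact ⟨Points.ofAlgHom F, Points.ext hF⟩
  exact ⟨σ, fun r p => DFunLike.congr_fun (hσ r) p⟩

theorem algebraMap_integersAway_injective : Function.Injective (algebraMap O (IntegersAway m)) := by
  have h : (algebraMap O (FractionRing O) : O → _) =
      IntegersAway.toFraction m ∘ algebraMap O (IntegersAway m) := by
    ext a; simp
  exact Function.Injective.of_comp (h ▸ IsFractionRing.injective O (FractionRing O))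

variable [Plethory O P]

/-- Both sides of each condition are maps from `S` to an `m`-torsion-free ring, so it suffices to
compare them on `P`. -/
theorem isInduced_blowup (hm : m ≠ ⊥) [Biring O (blowup m f)] {incl : P →ₐ[O] blowup m f}
    (hincl : ∀ p, (incl p).1 = 1 ⊗ₜ[O] p) (hi : IsBiringHom O O incl)
    {ρ : P →ₐ[O] Points O (blowup m f) (blowup m f)} (hρ : ∀ p q, ρ q (incl p) = incl (comp O p q)) :
    IsInduced m f ρ incl := by
  obtain ⟨h1, h2, h3⟩ := isBiringHom_iff.1 hi
  have hK (M : Type u) [AddCommGroup M] [Module O M] := IntegersAway.isTorsionFreeAt_tensor M hm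
  refine ⟨fun s => ?_, fun s => ?_, fun c s => ?_, fun p s => ?_, hincl⟩
  · refine DFunLike.congr_fun (blowup_algHom_ext hincl (hK (P ⊗[O] P))
      (h := (blowupTensor m f).comp Coring.coadd)
      (h' := AlgHom.comp (Algebra.TensorProduct.map (AlgHom.id O (IntegersAway m)) Coring.coadd)
        (blowup m f).val) fun p => ?_) s
    rw [AlgHom.comp_apply, AlgHom.comp_apply, h1, blowupTensor_map_incl hincl, Subalgebra.val_apply,
      hincl, Algebra.TensorProduct.map_tmul, map_one]
  · refine DFunLike.congr_fun (blowup_algHom_ext hincl (hK (P ⊗[O] P))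
      (h := (blowupTensor m f).comp Coring.comul)
      (h' := AlgHom.comp (Algebra.TensorProduct.map (AlgHom.id O (IntegersAway m)) Coring.comul)
        (blowup m f).val) fun p => ?_) s
    rw [AlgHom.comp_apply, AlgHom.comp_apply, h2, blowupTensor_map_incl hincl, Subalgebra.val_apply,
      hincl, Algebra.TensorProduct.map_tmul, map_one]
  -- `K` is `m`-torsion-free because it is `K ⊗ O`.
  · refine DFunLike.congr_fun (blowup_algHom_ext hincl
      ((hK O).of_injective (TensorProduct.rid O _).symm.toLinearMap (LinearEquiv.injective _))
      (h := (Algebra.ofId O (IntegersAway m)).comp (Biring.colin c : Points O _ O).toAlgHom)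
      (h' := (productMap (AlgHom.id O (IntegersAway m)) ((Algebra.ofId O (IntegersAway m)).comp
        (Biring.colin c : Points O P O).toAlgHom)).comp (blowup m f).val) fun p => ?_) s
    rw [AlgHom.comp_apply, AlgHom.comp_apply, Points.toAlgHom_apply, h3, Subalgebra.val_apply,
      hincl, Algebra.TensorProduct.productMap_apply_tmul, map_one, one_mul]
    rfl
  · refine DFunLike.congr_fun (blowup_algHom_ext hincl (hK P)
      (h := (blowup m f).val.comp (ρ p).toAlgHom)
      (h' := (Algebra.TensorProduct.map (AlgHom.id O (IntegersAway m))
        (Plethory.compHom (k := O) p).toAlgHom).comp (blowup m f).val) fun q => ?_) s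
    rw [AlgHom.comp_apply, AlgHom.comp_apply, Subalgebra.val_apply, Subalgebra.val_apply, hincl,
      Points.toAlgHom_apply, hρ, hincl, Algebra.TensorProduct.map_tmul, map_one]
    rfl

/-- In a given amplification the structure on `S` is known only inside `K ⊗ P`; injectivity of
`blowupTensor` brings the identities back to `S ⊗ S`. -/
theorem IsInduced.isPointed (hm : m ≠ ⊥) (hP : IsTorsionFreeAt m P) [Biring O (blowup m f)]
    {ρ : P →ₐ[O] Points O (blowup m f) (blowup m f)} {incl : P →ₐ[O] blowup m f}
    (h : IsInduced m f ρ incl) (hρ : IsRightAction O ρ) : IsPointed ρ incl where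
  isBiringComp := hρ.isBiringComp
  isBiringHom := isBiringHom_iff.2
    ⟨fun p => blowupTensor_injective hm hP h.incl (by
      rw [h.coadd, h.incl, blowupTensor_map_incl h.incl, Algebra.TensorProduct.map_tmul, map_one]),
    fun p => blowupTensor_injective hm hP h.incl (by
      rw [h.comul, h.incl, blowupTensor_map_incl h.incl, Algebra.TensorProduct.map_tmul, map_one]),
    fun c p => algebraMap_integersAway_injective (by
      rw [h.colin, h.incl, Algebra.TensorProduct.productMap_apply_tmul, map_one, one_mul]
      rfl)⟩
  map_comp p q := Subtype.ext (by
    rw [h.act, h.incl, h.incl, Algebra.TensorProduct.map_tmul, map_one]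
    rfl)

/-- All targets are `m`-torsion-free, so the identities need only be verified on `P`, where they are
those of the composition of `P`. -/
theorem isBiringComp_blowup (hm : m ≠ ⊥) [Biring O (blowup m f)] {incl : P →ₐ[O] blowup m f}
    (hincl : ∀ p, (incl p).1 = 1 ⊗ₜ[O] p) (hi : IsBiringHom O O incl)
    {ρ : P →ₐ[O] Points O (blowup m f) (blowup m f)} (hρ : ∀ p q, ρ q (incl p) = incl (comp O p q)) :
    IsBiringComp ρ := by
  have hO := isTorsionFreeAt_self hm
  have hS := isTorsionFreeAt_blowup hm f
  have hSS := hS.tensor hm hS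
  obtain ⟨h1, h2, h3⟩ := isBiringHom_iff.1 hi
  have hc : (Points.comap hi _).comp (compTensor ρ) =
      (Points.map P (Algebra.TensorProduct.map incl incl)).comp
        (compTensor (Plethory.compHom (k := O) (P := P))) := by
    refine tensor_hom_ext (fun r => ?_) fun r => ?_ <;>
    · ext p
      simp [compTensor, hρ, comp]
  have hc' (z : P ⊗[O] P) (p : P) : compTensor ρ z (incl p) =
      Algebra.TensorProduct.map incl incl (compTensor (Plethory.compHom (k := O)) z p) :=
    DFunLike.congr_fun (DFunLike.congr_fun hc z) p
  refine ⟨fun s r => ?_, fun s r => ?_, fun c s r => ?_⟩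
  · refine DFunLike.congr_fun (blowup_algHom_ext hincl hSS
      (h := Coring.coadd.comp (ρ r).toAlgHom)
      (h' := (compTensor ρ (Coring.coadd (k := O) r)).toAlgHom) fun p => ?_) s
    rw [Points.toAlgHom_apply, hc', ← Plethory.compHom_isBiringComp.coadd, AlgHom.comp_apply,
      Points.toAlgHom_apply, hρ, h1]
    rfl
  · refine DFunLike.congr_fun (blowup_algHom_ext hincl hSS
      (h := Coring.comul.comp (ρ r).toAlgHom)
      (h' := (compTensor ρ (Coring.comul (k := O) r)).toAlgHom) fun p => ?_) s
    rw [Points.toAlgHom_apply, hc', ← Plethory.compHom_isBiringComp.comul, AlgHom.comp_apply,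
      Points.toAlgHom_apply, hρ, h2]
    rfl
  · refine DFunLike.congr_fun (blowup_algHom_ext hincl hO
      (h := (Biring.colin c : Points O (blowup m f) O).toAlgHom.comp (ρ r).toAlgHom)
      (h' := (Biring.colin _ : Points O (blowup m f) O).toAlgHom) fun p => ?_) s
    rw [AlgHom.comp_apply, Points.toAlgHom_apply, Points.toAlgHom_apply, Points.toAlgHom_apply, h3,
      hρ, h3]
    exact Plethory.compHom_isBiringComp.colin c p r

theorem isRightAction_blowup (hm : m ≠ ⊥) [Biring O (blowup m f)] {incl : P →ₐ[O] blowup m f}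
    (hincl : ∀ p, (incl p).1 = 1 ⊗ₜ[O] p) (hi : IsBiringHom O O incl)
    {ρ : P →ₐ[O] Points O (blowup m f) (blowup m f)} (hρ : ∀ p q, ρ q (incl p) = incl (comp O p q)) :
    IsRightAction O ρ where
  isBiringComp := isBiringComp_blowup hm hincl hi hρ
  act_comp s α β := by
    refine DFunLike.congr_fun (blowup_algHom_ext hincl (isTorsionFreeAt_blowup hm f)
      (h := (ρ (comp O α β)).toAlgHom)
      (h' := (ρ β).toAlgHom.comp (ρ α).toAlgHom) fun p => ?_) s
    rw [AlgHom.comp_apply, Points.toAlgHom_apply, Points.toAlgHom_apply, Points.toAlgHom_apply, hρ,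
      hρ, hρ]
    exact congrArg incl (Plethory.comp_assoc p α β).symm
  act_e s := by
    refine DFunLike.congr_fun (blowup_algHom_ext hincl (isTorsionFreeAt_blowup hm f)
      (h := (ρ (Plethory.e O)).toAlgHom) (h' := AlgHom.id O _) fun p => ?_) s
    rw [AlgHom.id_apply, Points.toAlgHom_apply, hρ]
    exact congrArg incl (Plethory.comp_e p)

variable [Algebra (O ⧸ m) Q] [IsScalarTower O (O ⧸ m) Q] [Plethory (O ⧸ m) Q]

/-- `I` is stable under right composition, as `f (p ∘ r) = 0 ∘ f r = 0`. Hence `p ↦ p ∘ r`, followed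
by the inclusion, carries `I` into `m S` and extends to `S`. -/
theorem exists_rightAction_blowup (hm : m ≠ ⊥) (hf : IsPlethoryHom O (O ⧸ m) f)
    [Biring O (blowup m f)] {incl : P →ₐ[O] blowup m f} (hincl : ∀ p, (incl p).1 = 1 ⊗ₜ[O] p)
    (hi : IsBiringHom O O incl) :
    ∃ ρ : P →ₐ[O] Points O (blowup m f) (blowup m f), ∀ p q, ρ q (incl p) = incl (comp O p q) := by
  obtain ⟨ρ, hρ⟩ := exists_blowup_op hincl hi (isTorsionFreeAt_blowup hm f)
    ((Points.map P incl).comp Plethory.compHom)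
    fun r p hp => mapsKer_incl hincl hm _ (by
      have := hf.map_comp p r
      rw [hp] at this
      exact this.trans (map_zero (Plethory.compHom (k := O ⧸ m) (f r))))
  exact ⟨ρ, fun p q => hρ q p⟩

end

/-! ## Actions of free plethories and of their torsion-free quotients -/

section

variable {k P S T : Type u} [CommRing k] [CommRing P] [Algebra k P] [Plethory k P] [CommRing S]
  [Algebra k S] [Biring k S] [CommRing T] [Algebra k T] [Plethory k T] {ρ : P →ₐ[k] Points k S S}
  {g : P →ₐ[k] S} {φ : P →ₐ[k] T} {i : S →ₐ[k] T}

theorem IsPointed.isOpVariety_true (hg : IsPointed ρ g) :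
    IsOpVariety (pointedOps ρ g fun _ _ _ => True) :=
  hg.isOpVariety trivial (fun _ _ _ _ _ _ _ _ => trivial) fun _ _ _ _ => trivial

/-- Only the universal property of `T` is given. The term model acts on `R`, and this action is
restricted along the map from `T` that initiality provides. -/
theorem IsFreePointed.exists_action (hT : IsFreePointed ρ g φ i) (hg : IsPointed ρ g) {R : Type u}
    [CommRing R] [Algebra k R] {σ : R →ₐ[k] Points k S R} (hσ : IsPointedOp ρ g σ) :
    ∃ a : PAction k T R, ∀ r s, a.actHom r (i s) = σ r s := by
  have h𝒱 := hg.isOpVariety_true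
  obtain ⟨τ, e, hF⟩ := exists_isFreeOn h𝒱
  let _ := hF.plethory h𝒱
  have hFP := hF.isFreePointed h𝒱 (fun _ _ _ _ => and_iff_left trivial) hg
  obtain ⟨h, ⟨hh, -, hi⟩, -⟩ := hT.initial _ _ _ hFP.isPointedMap
  refine ⟨(hF.action h𝒱 ⟨hσ, trivial⟩).restrict hh, fun r s => ?_⟩
  rw [← hF.action_unitMap h𝒱 ⟨hσ, trivial⟩, ← hi]
  rfl

/-- Maps between rings with an action of a free plethory are equivariant if they respect the
operations of the generators. -/
theorem IsFreePointed.isEquivariant (hT : IsFreePointed ρ g φ i) (hg : IsPointed ρ g)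
    {R R' : Type u} [CommRing R] [Algebra k R] [CommRing R'] [Algebra k R'] {a : PAction k T R}
    {a' : PAction k T R'} {h : R →ₐ[k] R'}
    (hh : ∀ r s, h (a.actHom r (i s)) = a'.actHom (h r) (i s)) : a.IsEquivariant a' h := by
  have h𝒱 := hg.isOpVariety_true
  obtain ⟨τ, e, hF⟩ := exists_isFreeOn h𝒱
  let _ := hF.plethory h𝒱
  have hFP := hF.isFreePointed h𝒱 (fun _ _ _ _ => and_iff_left trivial) hg
  obtain ⟨u, ⟨hu, huφ, hui⟩, -⟩ := hT.initial _ _ _ hFP.isPointedMap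
  obtain ⟨v, ⟨hv, hvφ, hvi⟩, -⟩ := hFP.initial _ _ _ hT.isPointedMap
  -- `u` embeds `T` into the term model, with retraction `v`; this allows arguing by freeness of the
  -- model.
  have hvu : v.comp u = AlgHom.id k T := by
    have hid : IsPlethoryHom k k (AlgHom.id k T) :=
      { isBiringHom_id with
        map_e := rfl
        map_comp := fun _ _ => rfl }
    refine (hT.initial T φ i hT.isPointedMap).unique ⟨hv.trans hu, ?_, ?_⟩ ⟨hid, rfl, rfl⟩
    · rw [AlgHom.comp_assoc, huφ, hvφ]
    · rw [AlgHom.comp_assoc, hui, hvi]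
  have hσ' := hT.isPointedMap.isPointedOp a'
  have hvτ (t) (s : S) : v (τ t s) = comp k (i s) (v t) := by
    have : τ t s = comp k (hF.unitMap s) t := (hF.action_unitMap h𝒱 hF.mem t s).symm
    rw [this, hv.map_comp]
    exact congrArg (fun x => comp k x (v t)) (DFunLike.congr_fun hvi s)
  intro t r
  -- The maps `t ↦ h (t ∘ r)` and `t ↦ t ∘ h r`, pulled back to the term model, respect the
  -- operations and agree at `e`.
  have key := hF.hom_ext R' _ ⟨hσ', trivial⟩ ((h.comp (a.actHom r).toAlgHom).comp v)
    ((a'.actHom (h r)).toAlgHom.comp v)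
    (isOpHom_iff.2 fun t s => by
      simp only [AlgHom.comp_apply, Points.toAlgHom_apply, Points.comap_apply]
      rw [hvτ, a.comp_act, hh])
    (isOpHom_iff.2 fun t s => by
      simp only [AlgHom.comp_apply, Points.toAlgHom_apply, Points.comap_apply]
      rw [hvτ, a'.comp_act])
    (by
      have hve : v e = Plethory.e k := hv.map_e
      simp [hve, a.e_act, a'.e_act])
  have := DFunLike.congr_fun key (u t)
  have hvut : v (u t) = t := DFunLike.congr_fun hvu t
  change h (a.actHom r t) = a'.actHom (h r) t
  simpa [hvut] using this

end

/-! ### Actions of the maximal torsion-free quotient -/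

section

variable {O : Type u} [CommRing O] {m : Ideal O} {T T' : Type u} [CommRing T] [Algebra O T]
  [Plethory O T] [CommRing T'] [Algebra O T'] [Plethory O T'] {π : T →ₐ[O] T'}

/-- For each `r` the orbit `U = T ∘ r ⊆ R` is an `m`-torsion-free quotient `T`-ring of `T`, so by
maximality the kernel of `π` annihilates `r`. -/
theorem IsMaximalTorsionFreeQuotient.exists_action (hπ : IsMaximalTorsionFreeQuotient m π)
    {R : Type u} [CommRing R] [Algebra O R] (hR : IsTorsionFreeAt m R) (a : PAction O T R) :
    ∃ a' : PAction O T' R, ∀ r t, a'.actHom r (π t) = a.actHom r t := by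
  have hker (r : R) (t : T) (ht : π t = 0) : a.actHom r t = 0 := by
    let U := (a.actHom r).toAlgHom.range
    obtain ⟨σ, hσ⟩ := exists_op_subalgebra a.actHom U (by
      rintro _ ⟨t, rfl⟩ s
      exact ⟨comp O s t, a.comp_act s t r⟩)
    have hσ' (x : U) (s : T) : (σ x s).1 = a.actHom x.1 s := hσ.apply x s
    let b : PAction O T U :=
      { actHom := σ
        comp_act := fun α β x => Subtype.ext (by simp only [hσ', a.comp_act])
        e_act := fun x => Subtype.ext (by rw [hσ', a.e_act]) }
    have := hπ.maximal U b (a.actHom r).toAlgHom.rangeRestrict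
      (hR.of_injective U.val.toLinearMap Subtype.val_injective)
      (AlgHom.rangeRestrict_surjective _) (fun α β => Subtype.ext (by
        change a.actHom r (comp O α β) = (σ _ α).1
        rw [hσ', a.comp_act]
        rfl)) t ht
    exact congrArg Subtype.val this
  obtain ⟨σ, hσ⟩ := exists_lift_of_injective (Points.comap hπ.isPlethoryHom.toIsBiringHom R)
    (fun x y h => Points.ext fun t => by
      obtain ⟨t, rfl⟩ := hπ.surjective t
      exact DFunLike.congr_fun h t) a.actHom fun r => by
      exact ⟨Points.ofAlgHom (AlgHom.liftOfSurjective π hπ.surjective (a.actHom r).toAlgHom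
        fun t ht => hker r t ht), Points.ext fun t => AlgHom.liftOfSurjective_apply π hπ.surjective
        (a.actHom r).toAlgHom (fun t ht => hker r t ht) t⟩
  have hσ' (r : R) (t : T) : σ r (π t) = a.actHom r t := DFunLike.congr_fun (hσ r) t
  refine ⟨⟨σ, fun α β r => ?_, fun r => ?_⟩, hσ'⟩
  · obtain ⟨α, rfl⟩ := hπ.surjective α
    obtain ⟨β, rfl⟩ := hπ.surjective β
    rw [← hπ.isPlethoryHom.map_comp, hσ', hσ', hσ', a.comp_act]
  · rw [← hπ.isPlethoryHom.map_e, hσ', a.e_act]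

end

/-! ## Deformations -/

section

variable {k ℓ P Q A : Type*} [CommRing k] [CommRing ℓ] [Algebra k ℓ] [CommRing P] [Algebra k P]
  [CommRing Q] [Algebra ℓ Q] [Algebra k Q] [IsScalarTower k ℓ Q] [CommRing A] [Algebra ℓ A]
  [Algebra k A] [IsScalarTower k ℓ A]

theorem productMap_restrictScalars (f : P →ₐ[k] Q) (x y : Q →ₐ[ℓ] A) (z : P ⊗[k] P) :
    productMap x y (productMap
      (((includeLeft : Q →ₐ[ℓ] Q ⊗[ℓ] Q).restrictScalars k).comp f)
      (((includeRight : Q →ₐ[ℓ] Q ⊗[ℓ] Q).restrictScalars k).comp f) z) =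
    productMap ((x.restrictScalars k).comp f) ((y.restrictScalars k).comp f) z := by
  have : ((productMap x y).restrictScalars k).comp (productMap
      (((includeLeft : Q →ₐ[ℓ] Q ⊗[ℓ] Q).restrictScalars k).comp f)
      (((includeRight : Q →ₐ[ℓ] Q ⊗[ℓ] Q).restrictScalars k).comp f)) =
      productMap ((x.restrictScalars k).comp f) ((y.restrictScalars k).comp f) :=
    tensor_hom_ext (fun p => by simp) fun p => by simp
  exact DFunLike.congr_fun this z

variable [Biring k P] [Biring ℓ Q]

theorem IsBiringHom.algebraMap_apply {f : P →ₐ[k] Q} (hf : IsBiringHom k ℓ f) (c : k) (p : P) :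
    (algebraMap ℓ (Points ℓ Q A) (algebraMap k ℓ c)) (f p) = algebraMap k (Points k P A) c p := by
  rw [Points.algebraMap_apply, hf.colin, Points.algebraMap_apply,
    ← IsScalarTower.algebraMap_apply]

/-- A morphism of birings over `k → ℓ` induces ring homomorphisms
`Ring_ℓ(Q, A) → Ring_k(P, A)` for `ℓ`-rings `A`. -/
def Points.comapOver {f : P →ₐ[k] Q} (hf : IsBiringHom k ℓ f) (A : Type*) [CommRing A]
    [Algebra ℓ A] [Algebra k A] [IsScalarTower k ℓ A] : Points ℓ Q A →+* Points k P A where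
  toFun x := Points.ofAlgHom ((x.toAlgHom.restrictScalars k).comp f)
  map_zero' := Points.ext fun p => by
    have := hf.algebraMap_apply (A := A) 0 p
    rwa [map_zero, map_zero, map_zero] at this
  map_one' := Points.ext fun p => by
    have := hf.algebraMap_apply (A := A) 1 p
    rwa [map_one, map_one, map_one] at this
  map_add' x y := Points.ext fun p => by
    change productMap x.toAlgHom y.toAlgHom (Coring.coadd (k := ℓ) (f p)) =
      productMap ((x.toAlgHom.restrictScalars k).comp f) ((y.toAlgHom.restrictScalars k).comp f)
        (Coring.coadd (k := k) p)
    rw [hf.coadd]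
    exact productMap_restrictScalars f _ _ _
  map_mul' x y := Points.ext fun p => by
    change productMap x.toAlgHom y.toAlgHom (Coring.comul (k := ℓ) (f p)) =
      productMap ((x.toAlgHom.restrictScalars k).comp f) ((y.toAlgHom.restrictScalars k).comp f)
        (Coring.comul (k := k) p)
    rw [hf.comul]
    exact productMap_restrictScalars f _ _ _

end

section

variable {O : Type u} [CommRing O] {m : Ideal O} {P Q : Type u} [CommRing P] [Algebra O P]
  [Plethory O P] [CommRing Q] [Algebra O Q] {f : P →ₐ[O] Q} [Algebra (O ⧸ m) Q]
  [IsScalarTower O (O ⧸ m) Q] [Plethory (O ⧸ m) Q]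
  {R : Type u} [CommRing R] [Algebra O R] {b : PAction O P R}

theorem one_tmul_eq_zero_iff {r : R} :
    (1 : O ⧸ m) ⊗ₜ[O] r = 0 ↔ r ∈ m.map (algebraMap O R) := by
  rw [← (TensorProduct.quotTensorEquivQuotSMul R m).map_eq_zero_iff]
  have : (TensorProduct.quotTensorEquivQuotSMul R m) ((1 : O ⧸ m) ⊗ₜ[O] r) =
      Submodule.Quotient.mk r := by
    have := TensorProduct.quotTensorEquivQuotSMul_mk_tmul m 1 r
    rwa [one_smul] at this
  rw [this, Submodule.Quotient.mk_eq_zero, Ideal.smul_top_eq_map]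
  rfl

-- Modulo `m`, an element `p` of the kernel acts as `f p = 0`, and `0 ∘ x = 0`.
omit [IsScalarTower O (O ⧸ m) Q] in
theorem IsDeformation.mapsKer (h : IsDeformation m f b) (r : R) :
    MapsKer m f (b.actHom r).toAlgHom := fun p hp => by
  obtain ⟨c, hc⟩ := h.factors
  have := hc p r
  rw [hp] at this
  exact one_tmul_eq_zero_iff.1 (this.symm.trans (map_zero (c.actHom (1 ⊗ₜ[O] r))))

/-- If the kernel of `f` acts by zero modulo `m`, then the action of `P` modulo `m` factors through
an action of `Q`. -/
theorem isDeformation_of_mapsKer (hf : IsPlethoryHom O (O ⧸ m) f) (hsurj : Function.Surjective f)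
    (hR : IsTorsionFreeAt m R) (hb : ∀ r, MapsKer m f (b.actHom r).toAlgHom) :
    IsDeformation m f b := by
  refine ⟨hR, ?_⟩
  let R' := (O ⧸ m) ⊗[O] R
  let q : R →ₐ[O] R' := includeRight
  have hq : Function.Surjective q := by
    intro x
    induction x using TensorProduct.induction_on with
    | zero => exact ⟨0, map_zero q⟩
    | tmul c r =>
      obtain ⟨a, rfl⟩ := Ideal.Quotient.mk_surjective c
      refine ⟨a • r, ?_⟩
      change (1 : O ⧸ m) ⊗ₜ[O] (a • r) = _
      rw [← TensorProduct.smul_tmul, Algebra.smul_def, mul_one]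
      rfl
    | add x y hx hy =>
      obtain ⟨r, rfl⟩ := hx
      obtain ⟨s, rfl⟩ := hy
      exact ⟨r + s, map_add q r s⟩
  -- As `f` is surjective, `Ring_{O/m}(Q, R')` embeds into `Ring_O(P, R')`, and identities can be
  -- verified there.
  let c := Points.comapOver hf.toIsBiringHom R'
  have hc : Function.Injective c := fun x y h => Points.ext fun α => by
    obtain ⟨p, rfl⟩ := hsurj α
    exact DFunLike.congr_fun h p
  -- The hypothesis on the kernel lets `p ↦ 1 ⊗ (p ∘ r)` descend along `f`.
  have hex (r : R) : ∃ y, c y = Points.map P q (b.actHom r) := by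
    let F := AlgHom.liftOfSurjective f hsurj (q.comp (b.actHom r).toAlgHom)
      fun p hp => one_tmul_eq_zero_iff.2 (hb r p hp)
    have hF (p : P) : F (f p) = q (b.actHom r p) := AlgHom.liftOfSurjective_apply f hsurj
      (q.comp (b.actHom r).toAlgHom) (fun p hp => one_tmul_eq_zero_iff.2 (hb r p hp)) p
    refine ⟨Points.ofAlgHom { F.toRingHom with commutes' := fun c => ?_ }, Points.ext hF⟩
    obtain ⟨a, rfl⟩ := Ideal.Quotient.mk_surjective c
    have h1 : algebraMap (O ⧸ m) Q (Ideal.Quotient.mk m a) = algebraMap O Q a :=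
      (IsScalarTower.algebraMap_apply O (O ⧸ m) Q a).symm
    have h2 : algebraMap (O ⧸ m) R' (Ideal.Quotient.mk m a) = algebraMap O R' a :=
      (IsScalarTower.algebraMap_apply O (O ⧸ m) R' a).symm
    rw [h1, h2]
    exact F.commutes a
  choose G hG using hex
  -- With this `O`-algebra structure, `G` becomes `O`-linear and extends to the base change `(O/m) ⊗
  -- R`.
  let _ : Algebra O (Points (O ⧸ m) Q R') :=
    ((algebraMap (O ⧸ m) (Points (O ⧸ m) Q R')).comp (algebraMap O (O ⧸ m))).toAlgebra
  have : IsScalarTower O (O ⧸ m) (Points (O ⧸ m) Q R') := .of_algebraMap_eq fun _ => rfl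
  let G' : R →ₐ[O] Points (O ⧸ m) Q R' :=
    { toFun := G
      map_zero' := hc (by rw [hG, map_zero, map_zero, map_zero])
      map_one' := hc (by rw [hG, map_one, map_one, map_one])
      map_add' := fun x y => hc (by rw [hG, map_add, map_add, map_add, hG, hG])
      map_mul' := fun x y => hc (by rw [hG, map_mul, map_mul, map_mul, hG, hG])
      commutes' := fun a => hc (by
        rw [hG, AlgHom.commutes, AlgHom.commutes]
        exact Points.ext fun p => (hf.algebraMap_apply a p).symm) }
  let H : R' →ₐ[O ⧸ m] Points (O ⧸ m) Q R' :=
    Algebra.TensorProduct.productLeftAlgHom (Algebra.ofId _ _) G'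
  have hH (r : R) (p : P) : H (q r) (f p) = q (b.actHom r p) := by
    have h1 : H (q r) = G r := by
      change Algebra.TensorProduct.productLeftAlgHom (Algebra.ofId _ _) G' (1 ⊗ₜ[O] r) = _
      simp [G']
    rw [h1]
    exact DFunLike.congr_fun (hG r) p
  refine ⟨⟨H, fun α β x => ?_, fun x => ?_⟩, fun α r => hH r α⟩
  · obtain ⟨α, rfl⟩ := hsurj α
    obtain ⟨β, rfl⟩ := hsurj β
    obtain ⟨r, rfl⟩ := hq x
    rw [← hf.map_comp, hH, hH, hH, b.comp_act]
  · obtain ⟨r, rfl⟩ := hq x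
    rw [← hf.map_e, hH, b.e_act]

variable [IsDedekindDomain O] [Biring O (blowup m f)]
  {ρ : P →ₐ[O] Points O (blowup m f) (blowup m f)} {incl : P →ₐ[O] blowup m f}

/-- An action that extends to the blowup defines a deformation. -/
theorem isDeformation_of_blowup_op (hm : m ≠ ⊥) (hf : IsPlethoryHom O (O ⧸ m) f)
    (hsurj : Function.Surjective f) (hincl : ∀ p, (incl p).1 = 1 ⊗ₜ[O] p)
    (hR : IsTorsionFreeAt m R) (σ : R →ₐ[O] Points O (blowup m f) R)
    (hσ : ∀ r p, σ r (incl p) = b.actHom r p) : IsDeformation m f b :=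
  isDeformation_of_mapsKer hf hsurj hR fun r p hp => by
    have := map_mem_map (σ r).toAlgHom (mapsKer_incl hincl hm p hp)
    rwa [Points.toAlgHom_apply, hσ] at this

omit [IsScalarTower O (O ⧸ m) Q] in
/-- The action on a deformation extends to the blowup. -/
theorem IsDeformation.exists_isPointedOp (h : IsDeformation m f b) (hg : IsPointed ρ incl)
    (hincl : ∀ p, (incl p).1 = 1 ⊗ₜ[O] p) :
    ∃ σ : R →ₐ[O] Points O (blowup m f) R, IsPointedOp ρ incl σ ∧
      ∀ r p, σ r (incl p) = b.actHom r p := by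
  obtain ⟨σ, hσ⟩ := exists_blowup_op hincl hg.isBiringHom h.torsionFree b.actHom h.mapsKer
  refine ⟨σ, ⟨fun r => by rw [hσ, b.e_act], fun p s r => ?_⟩, hσ⟩
  refine DFunLike.congr_fun (blowup_algHom_ext hincl h.torsionFree
    (h := (σ r).toAlgHom.comp (ρ p).toAlgHom) (h' := (σ (σ r (incl p))).toAlgHom) fun q => ?_) s
  rw [AlgHom.comp_apply, Points.toAlgHom_apply, Points.toAlgHom_apply, Points.toAlgHom_apply,
    ← hg.map_comp, hσ, hσ, hσ, b.comp_act]

end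

/-! ## Existence of the amplification -/

section

variable (k P : Type*) [CommRing k] [CommRing P] [Algebra k P] [Plethory k P]

theorem isPlethoryOp_compHom : IsPlethoryOp (Plethory.compHom (k := k) (P := P)) where
  coadd := isOpHom_iff.2 fun r s => isEquivariant_coadd k P s r
  comul := isOpHom_iff.2 fun r s => isEquivariant_comul k P s r
  colin c := isOpHom_iff.2 fun r s => isEquivariant_colin P c s r
  comp β := isOpHom_iff.2 fun r s => isEquivariant_actHom (.self k P) β s r

end

section

variable {O : Type u} [CommRing O] {m : Ideal O}

/-- A ring with a coring structure is nonzero, so it is torsion if `m = 0`. -/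
theorem IsTorsionFreeAt.ne_bot [Nontrivial O] {P : Type*} [CommRing P] [Algebra O P] [Coring O P]
    (hP : IsTorsionFreeAt m P) : m ≠ ⊥ := by
  rintro rfl
  have h : (1 : P) = 0 := hP 1 ⟨1, fun a ha => by
    rw [pow_one, Ideal.mem_bot] at ha
    rw [ha, zero_smul]⟩
  simpa using congrArg (Coring.cozero (k := O)) h

variable [IsDedekindDomain O]

/-- `T` and `T'` are the free objects on one generator among all pointed `S`-rings and among the
`m`-torsion-free ones. Both are plethories for the same reason, and `π` sends generator to
generator. -/
theorem IsPointed.exists_isMaximalTorsionFreeQuotient (hm : m ≠ ⊥) {P S : Type u} [CommRing P]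
    [Algebra O P] [Plethory O P] [CommRing S] [Algebra O S] [Biring O S]
    {ρ : P →ₐ[O] Points O S S} {g : P →ₐ[O] S} (hg : IsPointed ρ g) :
    ∃ (T : Type u) (_ : CommRing T) (_ : Algebra O T) (_ : Plethory O T) (φ : P →ₐ[O] T)
      (i : S →ₐ[O] T) (T' : Type u) (_ : CommRing T') (_ : Algebra O T') (_ : Plethory O T')
      (π : T →ₐ[O] T'), IsFreePointed ρ g φ i ∧ IsMaximalTorsionFreeQuotient m π := by
  have h𝒱 := hg.isOpVariety_true
  have h𝒲 : IsOpVariety (pointedOps ρ g fun R _ _ => IsTorsionFreeAt m R) :=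
    hg.isOpVariety (isTorsionFreeAt_self hm) (fun R R' _ _ _ _ h h' => h.tensor hm h')
      fun T _ _ H x ⟨n, hn⟩ => H x 0 fun R _ _ h hR => (hR (h x) ⟨n, fun a ha => by
        rw [← map_smul, hn a ha, map_zero]⟩).trans (map_zero h).symm
  obtain ⟨τ, e, hT⟩ := exists_isFreeOn h𝒱
  obtain ⟨τ', e', hT'⟩ := exists_isFreeOn h𝒲
  let _ := hT.plethory h𝒱
  let _ := hT'.plethory h𝒲
  have hFP := hT.isFreePointed h𝒱 (fun _ _ _ _ => and_iff_left trivial) hg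
  have hmem : pointedOps ρ g (fun _ _ _ => True) _ τ' := ⟨hT'.mem.1, trivial⟩
  have hop := hT.isOpHom_lift hmem e'
  refine ⟨_, _, _, _, _, _, _, _, _, _, hT.lift hmem e', hFP,
    hT.isPlethoryHom_lift h𝒱 hmem (hT'.isPlethoryOp h𝒲), ?_, hT'.mem.2, ?_⟩
  -- The image contains the generator and is stable under the operations.
  · rw [← AlgHom.range_eq_top]
    refine hT'.eq_top h𝒲 _ ⟨e, hT.lift_e _ _⟩ ?_
    rintro _ ⟨t, rfl⟩ s
    exact ⟨τ t s, hop.apply t s⟩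
  · intro R _ _ a ψ hR _ hψ t ht
    let σ := (Points.comap hFP.isPointedMap.isBiringHom R).comp a.actHom
    have hσ : pointedOps ρ g (fun R _ _ => IsTorsionFreeAt m R) R σ :=
      ⟨hFP.isPointedMap.isPointedOp a, hR⟩
    have hψ' : IsOpHom τ σ ψ := isOpHom_iff.2 fun t s => by
      rw [← hT.action_unitMap h𝒱 hT.mem]
      exact hψ (hT.unitMap s) t
    -- By freeness of `T'`, the map `ψ` factors through `T → T'`.
    have := hT.hom_ext R σ ⟨hσ.1, trivial⟩ ((hT'.lift hσ (ψ e)).comp (hT.lift hmem e')) ψ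
      ((hT'.isOpHom_lift _ _).comp hop) hψ' (by simp)
    rw [← this, AlgHom.comp_apply, ht, map_zero]

variable {P Q : Type u} [CommRing P] [Algebra O P] [Plethory O P] [CommRing Q] [Algebra O Q]
  {f : P →ₐ[O] Q} [Algebra (O ⧸ m) Q] [IsScalarTower O (O ⧸ m) Q] [Plethory (O ⧸ m) Q]

theorem nonempty_amplification (hP : IsTorsionFreeAt m P) (hf : IsPlethoryHom O (O ⧸ m) f)
    (hsurj : Function.Surjective f) : Nonempty (Amplification m f) := by
  have hm := hP.ne_bot
  obtain ⟨incl, hincl⟩ := exists_blowup_incl hm f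
  obtain ⟨_, hi⟩ := exists_biring_blowup hm hf.toIsBiringHom hsurj hincl
  obtain ⟨ρ, hρ⟩ := exists_rightAction_blowup hm hf hincl hi
  have hact := isRightAction_blowup hm hincl hi hρ
  have hind := isInduced_blowup hm hincl hi hρ
  obtain ⟨T, _, _, _, φ, i, T', _, _, _, π, hfree, hquot⟩ :=
    (hind.isPointed hm hP hact).exists_isMaximalTorsionFreeQuotient hm
  exact ⟨
    { ρ := ρ
      isRightAction := hact
      incl := incl
      isInduced := hind
      T := T
      toT := φ
      ι := i
      isFree := hfree
      P' := T'
      π := π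
      isQuotient := hquot }⟩

/-! ## Properties of the amplification -/

namespace Amplification

variable (A : Amplification m f) {R R' : Type u} [CommRing R] [Algebra O R] [CommRing R']
  [Algebra O R'] {a : PAction O A.P' R} {a' : PAction O A.P' R'} {g : R →ₐ[O] R'}

theorem isPointed (hP : IsTorsionFreeAt m P) :
    letI := A.biring
    IsPointed A.ρ A.incl :=
  letI := A.biring
  A.isInduced.isPointed hP.ne_bot hP A.isRightAction

theorem ι_incl (p : P) : A.ι (A.incl p) = A.toT p :=
  letI := A.biring
  DFunLike.congr_fun A.isFree.isPointedMap.comp_eq p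

theorem isBiringHom_π_comp_ι :
    letI := A.biring
    IsBiringHom O O (A.π.comp A.ι) :=
  letI := A.biring
  A.isQuotient.isPlethoryHom.toIsBiringHom.trans A.isFree.isPointedMap.isBiringHom

theorem isDeformation_forget (hP : IsTorsionFreeAt m P) (hf : IsPlethoryHom O (O ⧸ m) f)
    (hsurj : Function.Surjective f) (a : PAction O A.P' R) (hR : IsTorsionFreeAt m R) :
    IsDeformation m f (A.forget a) := by
  let _ := A.biring
  refine isDeformation_of_blowup_op hP.ne_bot hf hsurj A.isInduced.incl hR
    ((Points.comap A.isBiringHom_π_comp_ι R).comp a.actHom) fun r p => ?_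
  change a.actHom r (A.π (A.ι (A.incl p))) = a.actHom r (A.π (A.toT p))
  rw [A.ι_incl]

/-- Equivariance spreads from `P` to `S`, since maps from `S` to the `m`-torsion-free ring `R'` are
determined on `P`; from `S` to the free plethory `T`; and from `T` to its quotient `P'`. -/
theorem isEquivariant_iff (hP : IsTorsionFreeAt m P) (hR' : IsTorsionFreeAt m R') :
    a.IsEquivariant a' g ↔ (A.forget a).IsEquivariant (A.forget a') g := by
  refine ⟨fun h p r => h (A.structureMap p) r, fun h t r => ?_⟩
  let _ := A.biring
  have hS (r : R) (s : blowup m f) :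
      g (a.actHom r (A.π (A.ι s))) = a'.actHom (g r) (A.π (A.ι s)) := by
    refine DFunLike.congr_fun (blowup_algHom_ext A.isInduced.incl hR'
      (h := g.comp ((a.actHom r).toAlgHom.comp (A.π.comp A.ι)))
      (h' := (a'.actHom (g r)).toAlgHom.comp (A.π.comp A.ι)) fun p => ?_) s
    change g (a.actHom r (A.π (A.ι (A.incl p)))) = a'.actHom (g r) (A.π (A.ι (A.incl p)))
    rw [A.ι_incl]
    exact h p r
  obtain ⟨t, rfl⟩ := A.isQuotient.surjective t
  exact A.isFree.isEquivariant (A.isPointed hP) (a := a.restrict A.isQuotient.isPlethoryHom)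
    (a' := a'.restrict A.isQuotient.isPlethoryHom) hS t r

/-- This is `isEquivariant_iff` for the identity of `R`. -/
theorem forget_injective (hP : IsTorsionFreeAt m P) (hR : IsTorsionFreeAt m R)
    {a a' : PAction O A.P' R} (h : A.forget a = A.forget a') : a = a' := by
  have := (A.isEquivariant_iff hP hR (a := a) (a' := a') (g := .id O R)).2 fun p r => by
    rw [h]; rfl
  exact PAction.ext (AlgHom.ext fun r => Points.ext fun t => this t r)

/-- The action is extended from `P` to `S` by the deformation property, to `T` by freeness, and to
`P'` by torsion-freeness. -/
theorem exists_forget_eq (hP : IsTorsionFreeAt m P) {b : PAction O P R}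
    (hb : IsDeformation m f b) : ∃ a : PAction O A.P' R, A.forget a = b := by
  let _ := A.biring
  obtain ⟨σ, hσ, hσb⟩ := hb.exists_isPointedOp (A.isPointed hP) A.isInduced.incl
  obtain ⟨c, hc⟩ := A.isFree.exists_action (A.isPointed hP) hσ
  obtain ⟨a, ha⟩ := A.isQuotient.exists_action hb.torsionFree c
  refine ⟨a, PAction.ext (AlgHom.ext fun r => Points.ext fun p => ?_)⟩
  change a.actHom r (A.π (A.toT p)) = b.actHom r p
  rw [ha, ← A.ι_incl, hc, hσb]

section

variable {P'' : Type u} [CommRing P''] [Algebra O P''] [Plethory O P''] {φ : P →ₐ[O] P''}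
  (hφ : IsPlethoryHom O O φ) {a : PAction O A.P' P''}
  (ha : A.forget a = (PAction.self O P'').restrict hφ)

-- The structure maps of `P''` are `P`-equivariant because `φ` is a map of plethories. Their targets
-- `P'' ⊗ P''`, `O` and `P''` are `m`-torsion-free, so they are also `P'`-equivariant.
include ha in
theorem isPlethoryOp_actHom (hP : IsTorsionFreeAt m P) (hP'' : IsTorsionFreeAt m P'') :
    IsPlethoryOp a.actHom := by
  have hop := isPlethoryOp_comap hφ.toIsBiringHom
  have h₂ := hP''.tensor hP.ne_bot hP''
  have ha' (x : P'') (p : P) : a.actHom x (A.structureMap p) = comp O (φ p) x :=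
    DFunLike.congr_fun (DFunLike.congr_fun (congrArg PAction.actHom ha) x) p
  have hat (z : P'' ⊗[O] P'') (p : P) : tensorOp a.actHom a.actHom z (A.structureMap p) =
      tensorOp ((Points.comap hφ.toIsBiringHom P'').comp Plethory.compHom)
        ((Points.comap hφ.toIsBiringHom P'').comp Plethory.compHom) z p := by
    have := congrArg PAction.actHom ha
    rw [← tensorOp_comap A.isPlethoryHom_structureMap.toIsBiringHom]
    exact congrArg (fun σ => tensorOp σ σ z p) this
  have hcoop (Δ : P'' →ₐ[O] P'' ⊗[O] P'') (hΔ : IsOpHom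
      ((Points.comap hφ.toIsBiringHom P'').comp Plethory.compHom)
      (tensorOp ((Points.comap hφ.toIsBiringHom P'').comp Plethory.compHom)
        ((Points.comap hφ.toIsBiringHom P'').comp Plethory.compHom)) Δ) :
      IsOpHom a.actHom (tensorOp a.actHom a.actHom) Δ :=
    PAction.isOpHom (b := a.tensor a) <| (A.isEquivariant_iff hP h₂).2 fun p x => by
      change Δ (a.actHom x (A.structureMap p)) = tensorOp a.actHom a.actHom _ (A.structureMap p)
      rw [hat, ← hΔ.apply, ha']
      rfl
  refine ⟨hcoop _ hop.coadd, hcoop _ hop.comul, fun c => ?_, fun β => ?_⟩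
  · refine PAction.isOpHom (b := PAction.base O A.P') <|
      (A.isEquivariant_iff hP (isTorsionFreeAt_self hP.ne_bot)).2 fun p x => ?_
    change (Biring.colin c : Points O P'' O) (a.actHom x (A.structureMap p)) =
      (Biring.colin _ : Points O A.P' O) (A.structureMap p)
    rw [ha']
    exact ((hop.colin c).apply x p).trans (A.isPlethoryHom_structureMap.colin _ p).symm
  · refine PAction.isOpHom <| (A.isEquivariant_iff hP hP'').2 fun p x => ?_
    change (Plethory.compHom β) (a.actHom x (A.structureMap p)) =
      a.actHom _ (A.structureMap p)
    rw [ha', ha']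
    exact (hop.comp β).apply x p

/-- The universal property of the amplification among `P`-plethories. -/
theorem isPlethoryHom_of_isEquivariant (hP : IsTorsionFreeAt m P)
    (h'' : IsDeformation m f ((PAction.self O P'').restrict hφ)) {h : A.P' →ₐ[O] P''}
    (hh : (A.forget (PAction.self O A.P')).IsEquivariant ((PAction.self O P'').restrict hφ) h)
    (hc : h.comp A.structureMap = φ) : IsPlethoryHom O O h := by
  obtain ⟨a, ha⟩ := A.exists_forget_eq hP h''
  rw [← ha, ← A.isEquivariant_iff hP h''.torsionFree] at hh
  have he : h (Plethory.e O) = Plethory.e O := by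
    rw [← A.isPlethoryHom_structureMap.map_e, ← AlgHom.comp_apply, hc, hφ.map_e]
  have hh' : IsOpHom Plethory.compHom a.actHom h := isOpHom_iff.2 fun r s => hh s r
  exact (isPlethoryOp_compHom O A.P').isPlethoryHom
    (A.isPlethoryOp_actHom hφ ha hP h''.torsionFree) hh' he
    (fun x y hx hy => PAction.hom_ext (a := a) (fun s r => hx.apply r s) fun s r => hy.apply r s)
    (fun x y hx hy => PAction.hom_ext (a := a.tensor a) (fun s r => hx.apply r s)
      fun s r => hy.apply r s)
    (fun x y hx hy => PAction.hom_ext (a := .base O A.P') (fun s r => hx.apply r s)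
      fun s r => hy.apply r s)

/-- The map is `α ↦ α ∘ e` for the action of `P'` on `P''`. It is the only one: a `P'`-equivariant
map is determined by the image of `e`, and compatibility with the maps from `P` forces `e ↦ e`. -/
theorem existsUnique_isEquivariant (hP : IsTorsionFreeAt m P)
    (h'' : IsDeformation m f ((PAction.self O P'').restrict hφ)) :
    ∃! h : A.P' →ₐ[O] P'', (A.forget (PAction.self O A.P')).IsEquivariant
      ((PAction.self O P'').restrict hφ) h ∧ h.comp A.structureMap = φ := by
  obtain ⟨a, ha⟩ := A.exists_forget_eq hP h''
  rw [← ha]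
  refine ⟨(a.actHom (Plethory.e O)).toAlgHom,
    ⟨(A.isEquivariant_iff hP h''.torsionFree).1 (isEquivariant_actHom a _), AlgHom.ext fun p => ?_⟩,
    fun h ⟨hh, hc⟩ => PAction.hom_ext ((A.isEquivariant_iff hP h''.torsionFree).2 hh)
      (isEquivariant_actHom a _) ?_⟩
  · have := DFunLike.congr_fun (DFunLike.congr_fun (congrArg PAction.actHom ha) (Plethory.e O)) p
    exact this.trans (Plethory.comp_e (k := O) (φ p))
  · rw [Points.toAlgHom_apply, a.e_act, ← A.isPlethoryHom_structureMap.map_e, ← AlgHom.comp_apply,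
      hc, hφ.map_e]

end

end Amplification

end

end Plethystic

/-! ### The theorem -/

theorem mainTheorem1 {O : Type u} [CommRing O] [IsDedekindDomain O] (m : Ideal O)
    {P Q : Type u} [CommRing P] [Algebra O P] [Plethystic.Plethory O P]
    (hP : Plethystic.IsTorsionFreeAt m P)
    [CommRing Q] [Algebra (O ⧸ m) Q] [Algebra O Q] [IsScalarTower O (O ⧸ m) Q]
    [Plethystic.Plethory (O ⧸ m) Q] (f : P →ₐ[O] Q)
    (hf : Plethystic.IsPlethoryHom O (O ⧸ m) f) (hsurj : Function.Surjective f) :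
    -- the amplification can be constructed
    Nonempty (Plethystic.Amplification m f) ∧
    ∀ A : Plethystic.Amplification m f,
      -- it is `m`-torsion-free
      Plethystic.IsTorsionFreeAt m A.P' ∧
      -- the forgetful functor from `m`-torsion-free `P'`-rings to `P`-rings takes values in
      -- `P`-deformations of `Q`-rings, is bijective onto them on objects, and is (faithful and) full
      (∀ (R : Type u) [CommRing R] [Algebra O R] (a : Plethystic.PAction O A.P' R),
        Plethystic.IsTorsionFreeAt m R → Plethystic.IsDeformation m f (A.forget a)) ∧
      (∀ (R : Type u) [CommRing R] [Algebra O R] (b : Plethystic.PAction O P R),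
        Plethystic.IsDeformation m f b →
          ∃! a : Plethystic.PAction O A.P' R, A.forget a = b) ∧
      (∀ (R R' : Type u) [CommRing R] [Algebra O R] [CommRing R'] [Algebra O R']
        (a : Plethystic.PAction O A.P' R) (a' : Plethystic.PAction O A.P' R'),
        Plethystic.IsTorsionFreeAt m R → Plethystic.IsTorsionFreeAt m R' →
        ∀ g : R →ₐ[O] R', a.IsEquivariant a' g ↔ (A.forget a).IsEquivariant (A.forget a') g) ∧
      -- universal property
      (∀ (P'' : Type u) [CommRing P''] [Algebra O P''] [Plethystic.Plethory O P'']
        (φ : P →ₐ[O] P'') (hφ : Plethystic.IsPlethoryHom O O φ),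
        Plethystic.IsDeformation m f ((Plethystic.PAction.self O P'').restrict hφ) →
        (∃! h : A.P' →ₐ[O] P'',
          (A.forget (Plethystic.PAction.self O A.P')).IsEquivariant
            ((Plethystic.PAction.self O P'').restrict hφ) h ∧ h.comp A.structureMap = φ) ∧
        ∀ h : A.P' →ₐ[O] P'',
          (A.forget (Plethystic.PAction.self O A.P')).IsEquivariant
            ((Plethystic.PAction.self O P'').restrict hφ) h → h.comp A.structureMap = φ →
          Plethystic.IsPlethoryHom O O h) := by
  refine ⟨Plethystic.nonempty_amplification hP hf hsurj, fun A => ⟨A.isQuotient.torsionFree,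
    fun R _ _ a hR => A.isDeformation_forget hP hf hsurj a hR, fun R _ _ b hb => ?_,
    fun R R' _ _ _ _ a a' _ hR' g => A.isEquivariant_iff hP hR', fun P'' _ _ _ φ hφ h'' =>
      ⟨A.existsUnique_isEquivariant hφ hP h'',
        fun h hh hc => A.isPlethoryHom_of_isEquivariant hφ hP h'' hh hc⟩⟩⟩
  obtain ⟨a, ha⟩ := A.exists_forget_eq hP hb
  exact ⟨a, ha, fun a' ha' => A.forget_injective hP hb.torsionFree (ha'.trans ha.symm)⟩
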